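/- A set $S\subseteq\mathbb{R}^d$ is a \emph{universal differentiability set} if every Lipschitz function $g:\mathbb{R}^d\to\mathbb{R}$ is Fréchet differentiable at some point of $S$. For bounded $A\subseteq\mathbb{R}^d$ let $N_\epsilon(A)$ be the least number of closed balls of radius $\epsilon$ that cover $A$; the upper Minkowski dimension of $A$ is $\overline{\dim}_M(A)=\inf\{s>0:\limsup_{\epsilon\to0+}N_\epsilon(A)\epsilon^s=0\}$. \textbf{Theorem.} (a) For every $d\ge1$ there is a compact set $S\subseteq\mathbb{R}^d$ with $\overline{\dim}_M(S)=1$ that is a universal differentiability set. Moreover, for every Lipschitz $g:\mathbb{R}^d\to\mathbb{R}$, the set of points $x\in S$ at which $g$ is Fréchet differentiable is dense in $S$. (b) For $d\ge2$ such a set is given explicitly: the construction below can be carried out, and, whatever choices are made in it, the resulting set $S$ is compact and has all the properties listed in (a). \emph{Construction.} Fix $Q\in(1,2)$ and integer sequences $(s_k)_{k\ge1}$, $(M_k)_{k\ge1}$ with $3\le M_k\le s_k$, $M_k\to\infty$, $s_k\to\infty$, $M_k\log s_k/s_k\to0$, and such that there is a real sequence $\tilde s_k\ge s_k$ with $(\tilde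 s_k-\tilde s_{k-1})/s_k\to0$. Let $w_1=Q^{-s_1}$ and $w_k=Q^{-s_k}w_{k-1}$ for $k\ge2$. (A set is $\epsilon$-separated if any two distinct points of it have distance $>\epsilon$.) Let $\mathcal{E}_k$ be a maximal $\frac1{s_k}$-separated subset of the unit sphere $S^{d-1}$. For $k\ge2$, a line segment $l$, an integer $j\ge1$ with $\mathrm{length}(l)\ge Q^jw_k/s_k$, and $e\in S^{d-1}$, choose a maximal $Q^jw_k/s_k$-separated subset $X$ of $l$, and put $\mathcal{R}_{k,l}(j,e)=\{x+[-1,1]\,Q^jw_k\,e: x\in X\}$. Let $\mathcal{L}_1=\mathcal{L}_{(1,0)}=\{l_1\}$ for a line segment $l_1$ of length $1$, and $\mathcal{L}_{(1,m)}=\emptyset$ for $m\ge1$. For $k\ge2$ let $\mathcal{L}_{(k,0)}=\mathcal{L}_{k-1}$ (with the empty category); for $m\ge1$ and integers $s_k\ge j_1\ge\dots\ge j_m\ge1$ let $$\mathcal{L}_{(k,m)}^{(j_1,\dots,j_m)}=\bigcup_{l\in\mathcal{L}_{(k,m-1)}^{(j_1,\dots,j_{m-1})}}\ \bigcup_{e\in\mathcal{E}_k}\mathcal{R}_{k,l}(j_m,e),$$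 let $\mathcal{L}_{(k,m)}$ be the union of these collections over all such $(j_1,\dots,j_m)$, and let $\mathcal{L}_k=\bigcup_{m=0}^{M_k}\mathcal{L}_{(k,m)}$. With $\overline{B}_w(l)=\bigcup_{x\in l}\overline{B}(x,w)$ put, for $q\in[0,1]$, $$\mathcal{U}_q=\bigcap_{k=1}^\infty\ \bigcup_{0\le m\le qM_k}\ \bigcup_{l\in\mathcal{L}_{(k,m)}}\overline{B}_{qw_k}(l),\qquad S=\overline{\bigcup_{0\le q<1}\mathcal{U}_q}.$$ -/

import Mathlib

open Set Filter Topology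
open scoped NNReal ENNReal

noncomputable section

/-- The upper Minkowski dimension of a set `A`: the infimum of all `s > 0` such that
`limsup_{ε → 0+} N_ε(A) ε ^ s = 0`, where `N_ε(A)` is the least number of closed balls of
radius `ε`, with arbitrary centres, that cover `A`. -/
def upperMinkowskiDim {X : Type*} [PseudoEMetricSpace X] (A : Set X) : ℝ≥0∞ :=
  ⨅ (s : ℝ≥0) (_ : 0 < s)
    (_ : limsup (fun ε : ℝ≥0 =>
      ((Metric.externalCoveringNumber ε A : ℕ∞) : ℝ≥0∞) * (ε : ℝ≥0∞) ^ (s : ℝ)) (𝓝[>] 0) = 0),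
    (s : ℝ≥0∞)

/-- A universal differentiability set contains, for every real-valued Lipschitz function on the
whole space, a point at which the function is (Fréchet) differentiable. -/
def IsUniversalDifferentiabilitySet {E : Type*} [NormedAddCommGroup E] [NormedSpace ℝ E]
    (S : Set E) : Prop :=
  ∀ g : E → ℝ, (∃ K : ℝ≥0, LipschitzWith K g) → ∃ x ∈ S, DifferentiableAt ℝ g x

/-- `T` is a maximal `ε`-separated subset of `A`. -/
def IsMaximalSeparatedIn {X : Type*} [PseudoEMetricSpace X] (ε : ℝ) (A T : Set X) : Prop :=
  Maximal (fun N : Set X => N ⊆ A ∧ Metric.IsSeparated (ENNReal.ofReal ε) N) T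

/-- The closed neighbourhood `B̄_w(A)`, the union of the closed balls of radius `w` centred
in `A`. If `A` is a line segment, this is the tube of width `w` around it. -/
def closedNhd {X : Type*} [PseudoMetricSpace X] (w : ℝ) (A : Set X) : Set X :=
  ⋃ x ∈ A, Metric.closedBall x w

/-- The widths `w_1 = Q ^ (-s_1)`, `w_{k+1} = Q ^ (-s_{k+1}) * w_k`. The levels `1, 2, 3, …` are
indexed by `0, 1, 2, …`, here and in everything below. -/
def tubeWidth (Q : ℝ) (s : ℕ → ℕ) : ℕ → ℝ
  | 0 => (Q ^ s 0)⁻¹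
  | k + 1 => (Q ^ s (k + 1))⁻¹ * tubeWidth Q s k

/-- The parameters and choices that enter the multi-scale construction of line segments. -/
structure SegmentScheme (d : ℕ) where
  s : ℕ → ℕ
  M : ℕ → ℕ
  three_le_M : ∀ k, 3 ≤ M k
  M_le_s : ∀ k, M k ≤ s k
  tendsto_M : Tendsto M atTop atTop
  tendsto_s : Tendsto s atTop atTop
  tendsto_ratio : Tendsto (fun k => (M k : ℝ) * Real.log (s k) / (s k : ℝ)) atTop (𝓝 0)
  exists_majorant : ∃ σ : ℕ → ℝ, (∀ k, (s k : ℝ) ≤ σ k) ∧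
    Tendsto (fun k => (σ (k + 1) - σ k) / (s (k + 1) : ℝ)) atTop (𝓝 0)
  Q : ℝ
  one_lt_Q : 1 < Q
  Q_lt_two : Q < 2
  /-- end points of the single segment of the first level -/
  a : EuclideanSpace ℝ (Fin d)
  b : EuclideanSpace ℝ (Fin d)
  dist_a_b : dist a b = 1
  /-- the finite set of directions used on each level -/
  dirs : ℕ → Set (EuclideanSpace ℝ (Fin d))
  dirs_maximal : ∀ k, IsMaximalSeparatedIn (1 / (s k : ℝ))
    (Metric.sphere (0 : EuclideanSpace ℝ (Fin d)) 1) (dirs k)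
  /-- `net k l j e` is the set of centres, on the segment `l`, of the new segments of
  level `k`, half-length `Q ^ j * w_k` and direction `e` -/
  net : ℕ → Set (EuclideanSpace ℝ (Fin d)) → ℕ → EuclideanSpace ℝ (Fin d) →
    Set (EuclideanSpace ℝ (Fin d))
  net_maximal : ∀ (k : ℕ) (x y : EuclideanSpace ℝ (Fin d)) (j : ℕ)
    (e : EuclideanSpace ℝ (Fin d)), 1 ≤ j → e ∈ Metric.sphere 0 1 →
    Q ^ j * tubeWidth Q s k / (s k : ℝ) ≤ dist x y →
    IsMaximalSeparatedIn (Q ^ j * tubeWidth Q s k / (s k : ℝ)) (segment ℝ x y)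
      (net k (segment ℝ x y) j e)

namespace SegmentScheme

variable {d : ℕ} (D : SegmentScheme d)

/-- The width of the tubes of level `k`. -/
def width (k : ℕ) : ℝ := tubeWidth D.Q D.s k

/-- The segments `x + [-1,1] Q ^ j w_k e` with `x` in the chosen net of `l`. -/
def newLines (k : ℕ) (l : Set (EuclideanSpace ℝ (Fin d))) (j : ℕ)
    (e : EuclideanSpace ℝ (Fin d)) : Set (Set (EuclideanSpace ℝ (Fin d))) :=
  (fun x => segment ℝ (x - (D.Q ^ j * D.width k) • e) (x + (D.Q ^ j * D.width k) • e)) ''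
    D.net k l j e

/-- The lines of a given category of level `k`, where `L₀` is the collection of lines of class 0.
The category `(j_1, …, j_m)` is encoded by the list `[j_m, …, j_1]`. -/
def categoryLines (k : ℕ) (L₀ : Set (Set (EuclideanSpace ℝ (Fin d)))) :
    List ℕ → Set (Set (EuclideanSpace ℝ (Fin d)))
  | [] => L₀
  | j :: J => ⋃ l ∈ categoryLines k L₀ J, ⋃ e ∈ D.dirs k, D.newLines k l j e

/-- The admissible categories of level `k` and class `m`: lists `[j_m, …, j_1]` with
`1 ≤ j_m ≤ … ≤ j_1 ≤ s_k`. -/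
def IsCategory (k m : ℕ) (J : List ℕ) : Prop :=
  J.length = m ∧ J.Pairwise (· ≤ ·) ∧ ∀ j ∈ J, 1 ≤ j ∧ j ≤ D.s k

/-- The lines of level `k` and class `m`, where `L₀` is the collection of lines of class 0. -/
def classLinesOver (k : ℕ) (L₀ : Set (Set (EuclideanSpace ℝ (Fin d)))) (m : ℕ) :
    Set (Set (EuclideanSpace ℝ (Fin d))) :=
  ⋃ (J : List ℕ) (_ : D.IsCategory k m J), D.categoryLines k L₀ J

/-- All lines of a level: the first level has the single line `[a, b]`, and the lines of level
`k` are the lines of class 0 for level `k + 1`. -/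
def levelLines : ℕ → Set (Set (EuclideanSpace ℝ (Fin d)))
  | 0 => {segment ℝ D.a D.b}
  | k + 1 => ⋃ (m : ℕ) (_ : m ≤ D.M (k + 1)), D.classLinesOver (k + 1) (levelLines k) m

/-- The lines of level `k` and class `m`; the single line of the first level has class 0. -/
def classLines : ℕ → ℕ → Set (Set (EuclideanSpace ℝ (Fin d)))
  | 0, 0 => {segment ℝ D.a D.b}
  | 0, _ + 1 => ∅
  | k + 1, m => D.classLinesOver (k + 1) (D.levelLines k) m

/-- The closed sets `𝒰_q`, `0 ≤ q ≤ 1`. -/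
def tubeSet (q : ℝ) : Set (EuclideanSpace ℝ (Fin d)) :=
  ⋂ k : ℕ, ⋃ (m : ℕ) (_ : (m : ℝ) ≤ q * (D.M k : ℝ)), ⋃ l ∈ D.classLines k m,
    closedNhd (q * D.width k) l

/-- The set `S`, the closure of the union of the sets `𝒰_q` with `0 ≤ q < 1`. -/
def limitSet : Set (EuclideanSpace ℝ (Fin d)) :=
  closure (⋃ q ∈ Ico (0 : ℝ) 1, D.tubeSet q)

end SegmentScheme

end

/-! Differentiability is forced by almost maximising a directional derivative. Among points x of the
sets 𝒰_q and vectors v, one repeatedly increases the derivative at x along v minus a quadratic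
penalty in v. New points stay near the old ones, their index may grow only a little, and their
chords in the old direction may differ from the old chords only by a small slack plus a multiple of
√gain. Adding smaller and smaller multiples of ‖u - v_n‖² to the penalty makes the directions
converge. The limit pair (x, v) then admits no improvement by any fixed c > 0 from points near x in
a slightly larger 𝒰_q', once the linear part p of the penalty at v and ‖v' - v‖² are subtracted
(`AscentStage.exists_almost_maximal_lineDeriv`).

This p is an approximate gradient at x. Otherwise h = f - ⟪p, ·⟫ satisfies |h(x+y) - h(x)| >
(2048/A)‖y‖ for arbitrarily small y. Bend the segment x + [-s,s]v, with s = A‖y‖, into a polygonal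
curve passing near x + y. Its direction changes by at most 9/A, while h along the curve, minus its
linear growth, has almost equal values at the ends and differs from them near the middle by about
8cs or more, where c = 256/A². A mean value theorem that also bounds all chords by a multiple of the
square root of the derivative (`LipschitzWith.exists_hasDerivAt_ge_and_chord_le`) yields a point
where the derivative has grown by at least c. Since (9/A)² is much smaller than c, this is a
forbidden improvement (`HasSegmentsNear.exists_larger_lineDeriv`).

What remains to ask of the sets is that, for p < q, around each point of 𝒰_p every short segment is
approximated by one inside 𝒰_q (`SegmentScheme.hasSegmentsNear_tubeSet`). Chains of lines of
comparable length provide it: they raise the class by at most 16, which (q - p)M_k eventually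
exceeds, with relative error of order M_k/s_k.

For the dimension, level k multiplies the total length of the lines by at most a power s_k^(C M_k),
so this length is exp(o(s_1 + ⋯ + s_k)), whereas w_k = Q^(-(s_1 + ⋯ + s_k)). Covering the tubes by
balls of radius 2w_k shows that the dimension is at most 1; the majorant hypothesis makes the gap
between consecutive scales harmless. The segment of the first level lies in S, which gives the lower
bound. -/

noncomputable section

open scoped InnerProductSpace

/-! ### Approximate gradients and line derivatives. -/

section ApproximateDerivative

variable {E : Type*} [NormedAddCommGroup E] [InnerProductSpace ℝ E]

/-- A function which admits approximate gradients to any accuracy is differentiable. -/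
theorem differentiableAt_of_forall_exists_approx [CompleteSpace E] {f : E → ℝ} {x : E}
    (h : ∀ η > (0 : ℝ), ∃ p : E, ∀ᶠ y in 𝓝 (0 : E), |f (x + y) - f x - ⟪p, y⟫_ℝ| ≤ η * ‖y‖) :
    DifferentiableAt ℝ f x := by
  choose! P hP using h
  -- Testing both approximations on a small multiple of P η - P η' bounds this difference, so the
  -- approximate gradients form a Cauchy sequence as η tends to 0.
  have hdist : ∀ η > 0, ∀ η' > 0, ‖P η - P η'‖ ≤ η + η' := by
    intro η hη η' hη'
    set w := P η - P η' with hw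
    by_contra hcon
    push Not at hcon
    have hw0 : 0 < ‖w‖ := by linarith
    have htend : Tendsto (fun s : ℝ => s • w) (𝓝[>] 0) (𝓝 0) := by
      have : Tendsto (fun s : ℝ => s • w) (𝓝 0) (𝓝 ((0 : ℝ) • w)) :=
        (continuous_id.smul continuous_const).tendsto 0
      rw [zero_smul] at this
      exact this.mono_left nhdsWithin_le_nhds
    obtain ⟨s, ⟨h1, h2⟩, hs⟩ := (((htend.eventually (hP η hη)).and
      (htend.eventually (hP η' hη'))).and self_mem_nhdsWithin).exists
    have hs : 0 < s := hs
    have h3 : ⟪P η, s • w⟫_ℝ - ⟪P η', s • w⟫_ℝ = s * ‖w‖ ^ 2 := by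
      rw [← inner_sub_left, ← hw, real_inner_smul_right, real_inner_self_eq_norm_sq]
    rw [norm_smul, Real.norm_eq_abs, abs_of_pos hs] at h1 h2
    have h4 := abs_le.1 h1
    have h5 := abs_le.1 h2
    have h6 : s * ‖w‖ ^ 2 ≤ (η + η') * (s * ‖w‖) := by linarith
    have h7 : 0 < s * ‖w‖ := by positivity
    nlinarith
  have hη : ∀ n : ℕ, (0 : ℝ) < (1 / 2) ^ n := fun n => by positivity
  have hcauchy : CauchySeq fun n : ℕ => P ((1 / 2) ^ n) := by
    refine cauchySeq_of_le_geometric (1 / 2) 2 (by norm_num) fun n => ?_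
    rw [dist_eq_norm]
    refine (hdist _ (hη n) _ (hη (n + 1))).trans ?_
    rw [pow_succ]
    linarith [hη n]
  obtain ⟨p, hp⟩ := cauchySeq_tendsto_of_complete hcauchy
  have hpη : ∀ η > 0, ‖P η - p‖ ≤ η := by
    intro η h
    have h1 : Tendsto (fun n : ℕ => ‖P η - P ((1 / 2) ^ n)‖) atTop (𝓝 ‖P η - p‖) :=
      (tendsto_const_nhds.sub hp).norm
    have h2 : Tendsto (fun n : ℕ => η + (1 / 2 : ℝ) ^ n) atTop (𝓝 (η + 0)) :=
      tendsto_const_nhds.add (tendsto_pow_atTop_nhds_zero_of_lt_one (by norm_num) (by norm_num))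
    rw [add_zero] at h2
    exact le_of_tendsto_of_tendsto' h1 h2 fun n => hdist _ h _ (hη n)
  refine HasFDerivAt.differentiableAt (f' := innerSL ℝ p) ?_
  rw [hasFDerivAt_iff_isLittleO_nhds_zero, Asymptotics.isLittleO_iff]
  intro c hc
  filter_upwards [hP (c / 2) (by positivity)] with y hy
  have h1 : ⟪P (c / 2), y⟫_ℝ - ⟪p, y⟫_ℝ = ⟪P (c / 2) - p, y⟫_ℝ := (inner_sub_left _ _ _).symm
  have h2 : |⟪P (c / 2) - p, y⟫_ℝ| ≤ c / 2 * ‖y‖ :=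
    (abs_real_inner_le_norm _ _).trans (by gcongr; exact hpη _ (by positivity))
  rw [Real.norm_eq_abs, innerSL_apply_apply]
  have h3 := abs_le.1 hy
  have h4 := abs_le.1 h2
  rw [abs_le]
  constructor <;> linarith

end ApproximateDerivative

section

variable {E : Type*} [NormedAddCommGroup E] [NormedSpace ℝ E]

theorem HasLineDerivAt.eventually_abs_sub_le {f : E → ℝ} {β : ℝ} {x v : E}
    (h : HasLineDerivAt ℝ f β x v) {ε : ℝ} (hε : 0 < ε) :
    ∃ τ > 0, ∀ t : ℝ, |t| < τ → |f (x + t • v) - f x - t * β| ≤ ε * |t| := by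
  have h1 := (hasLineDerivAt_iff_isLittleO_nhds_zero.1 h).def hε
  obtain ⟨τ, hτ, h2⟩ := Metric.eventually_nhds_iff.1 h1
  refine ⟨τ, hτ, fun t ht => ?_⟩
  simpa using h2 (by simpa using ht)

theorem HasLineDerivAt.abs_le_of_lipschitz {f : E → ℝ} {L β : ℝ} {x v : E}
    (hf : ∀ x y, |f x - f y| ≤ L * ‖x - y‖) (h : HasLineDerivAt ℝ f β x v) :
    |β| ≤ L * ‖v‖ := by
  have hL : 0 ≤ L * ‖v‖ := by simpa using (abs_nonneg _).trans (hf v 0)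
  have := HasDerivAt.le_of_lip' (C := L * ‖v‖) h hL (Eventually.of_forall fun t => ?_)
  · simpa using this
  · have := hf (x + t • v) (x + (0 : ℝ) • v)
    rw [add_sub_add_left_eq_sub, ← sub_smul, norm_smul] at this
    simp only [Real.norm_eq_abs] at this ⊢
    linarith

end

/-! ### The search for an almost maximal directional derivative. -/

/-- A stage of the search for an almost maximal directional derivative: the current point,
direction and derivative, the current and the admissible index, the radius within which the next
point is sought, and the penalty on directions. -/
structure AscentStage (E : Type*) where
  x : E
  v : E
  β : ℝ
  q : ℝ
  q' : ℝ
  δ : ℝ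
  ψ : E → ℝ

namespace AscentStage

variable {E : Type*} [NormedAddCommGroup E] [InnerProductSpace ℝ E]

/-- The increase of the penalised derivative. -/
def gain (S : AscentStage E) (v' : E) (β' : ℝ) : ℝ := (β' - S.ψ v') - (S.β - S.ψ S.v)

/-- The points, directions and derivatives among which the next stage is chosen. -/
structure IsCompetitor (f : E → ℝ) (U : ℝ → Set E) (K σ : ℝ) (S : AscentStage E)
    (x' v' : E) (β' q₁ : ℝ) : Prop where
  hasLineDerivAt : HasLineDerivAt ℝ f β' x' v'
  mem : x' ∈ U q₁
  le_q : S.q ≤ q₁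
  q_lt : q₁ < S.q'
  norm_lt : ‖x' - S.x‖ < S.δ
  gain_nonneg : 0 ≤ S.gain v' β'
  chord_le : ∃ σ' < σ, ∀ t : ℝ, |(f (x' + t • S.v) - f x') - (f (S.x + t • S.v) - f S.x)| ≤
    (σ' + K * √(S.gain v' β')) * |t|

/-- The penalties that occur: quadratic functions with controlled coefficients. -/
structure IsPenalty (L : ℝ) (n : ℕ) (ψ : E → ℝ) : Prop where
  exists_coeff : ∃ (c d : ℝ) (b : E), 0 ≤ c ∧ c ≤ 1 - (1 / 2) ^ (n + 1) ∧
    ‖b‖ ≤ 4 * L * (1 / 2 - (1 / 2) ^ (n + 1)) ∧ ∀ u, ψ u = c * ‖u‖ ^ 2 - ⟪b, u⟫_ℝ + d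
  sq_le : ∀ u, ‖u‖ ^ 2 / 2 ≤ ψ u

/-- The slack in the chord condition at stage `n`. -/
def slack (L : ℝ) (n : ℕ) : ℝ := 200 * L ^ 2 * (1 / 4) ^ n

/-- The bound on the change of direction at stage `n`. -/
def dirStep (L : ℝ) (n : ℕ) : ℝ := 2 * L * (1 / 4) ^ n

/-- The bound on the gain of competitors at stage `n`. -/
def gainBound (L : ℝ) (n : ℕ) : ℝ := (1 / 2) ^ (n + 1) * dirStep L n ^ 2

/-- The properties of a stage that are kept during the search. -/
structure IsGood (f : E → ℝ) (U : ℝ → Set E) (K L r : ℝ) (n : ℕ) (S : AscentStage E) : Prop where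
  hasLineDerivAt : HasLineDerivAt ℝ f S.β S.x S.v
  mem : S.x ∈ U S.q
  q_nonneg : 0 ≤ S.q
  q_lt : S.q < S.q'
  q'_le : S.q' ≤ 1
  δ_pos : 0 < S.δ
  δ_le : S.δ ≤ r * (1 / 2) ^ n
  penalty : IsPenalty L n S.ψ
  nonneg : S.ψ S.v ≤ S.β
  gain_le : ∀ x' v' β' q₁, IsCompetitor f U K (slack L n) S x' v' β' q₁ →
    S.gain v' β' ≤ gainBound L n
  dir_le : ∀ x' v' β' q₁, IsCompetitor f U K (slack L n) S x' v' β' q₁ →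
    ‖v' - S.v‖ ≤ dirStep L n

/-- The derivative grows at most linearly in v and the penalty at least like ‖v‖²/2, so long
directions have a negative penalised derivative. -/
theorem IsPenalty.norm_le {f : E → ℝ} {L : ℝ} (hL : 1 ≤ L) (hf : ∀ x y, |f x - f y| ≤ L * ‖x - y‖)
    {n : ℕ} {ψ : E → ℝ} (hψ : IsPenalty L n ψ) {x v : E} {β : ℝ} (h : HasLineDerivAt ℝ f β x v)
    (hβ : ψ v ≤ β) : ‖v‖ ≤ 2 * L := by
  have h1 := hψ.sq_le v
  have h2 := (abs_le.1 (h.abs_le_of_lipschitz hf)).2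
  by_contra hcon
  push Not at hcon
  nlinarith [norm_nonneg v]

theorem IsPenalty.sub_le {L : ℝ} (hL : 1 ≤ L) {n : ℕ} {ψ : E → ℝ} (hψ : IsPenalty L n ψ) {u v : E}
    (hu : ‖u‖ ≤ 2 * L) (hv : ‖v‖ ≤ 2 * L) : |ψ u - ψ v| ≤ 6 * L * ‖u - v‖ := by
  obtain ⟨c, d, b, hc0, hc, hb, h⟩ := hψ.exists_coeff
  have hp : (0 : ℝ) < (1 / 2) ^ (n + 1) := by positivity
  have hb2 : ‖b‖ ≤ 2 * L := by nlinarith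
  have h1 : ψ u - ψ v = c * ⟪u + v, u - v⟫_ℝ - ⟪b, u - v⟫_ℝ := by
    rw [h, h, inner_sub_right b, inner_add_left, inner_sub_right, inner_sub_right,
      real_inner_self_eq_norm_sq, real_inner_self_eq_norm_sq, real_inner_comm u v]
    ring
  rw [h1]
  have h2 : |⟪u + v, u - v⟫_ℝ| ≤ 4 * L * ‖u - v‖ :=
    (abs_real_inner_le_norm _ _).trans (by gcongr; linarith [norm_add_le u v])
  have h3 : |⟪b, u - v⟫_ℝ| ≤ 2 * L * ‖u - v‖ :=
    (abs_real_inner_le_norm _ _).trans (by gcongr)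
  calc |c * ⟪u + v, u - v⟫_ℝ - ⟪b, u - v⟫_ℝ| ≤ |c * ⟪u + v, u - v⟫_ℝ| + |⟪b, u - v⟫_ℝ| := abs_sub _ _
    _ ≤ 1 * (4 * L * ‖u - v‖) + 2 * L * ‖u - v‖ := by
        rw [abs_mul, abs_of_nonneg hc0]
        gcongr
        linarith
    _ = _ := by ring

/-- As K ≥ 2L and √(a + b) ≤ L, the function K√· has slope at least 1 on the interval concerned.
This lets the gain b of one step, which appears linearly in the chord estimate, be absorbed by the
square root of the total gain. -/
theorem mul_sqrt_add_le {K L a b : ℝ} (hL : 1 ≤ L) (hK : 2 * L ≤ K) (ha : 0 ≤ a) (hb : 0 ≤ b)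
    (hab : a + b ≤ L ^ 2 / 2) : K * √a + b ≤ K * √(a + b) := by
  have h1 : √(a + b) ^ 2 = a + b := Real.sq_sqrt (by positivity)
  have h2 : √a ^ 2 = a := Real.sq_sqrt ha
  have h3 : √a ≤ √(a + b) := Real.sqrt_le_sqrt (by linarith)
  have h4 : √(a + b) ≤ L := Real.sqrt_le_iff.2 ⟨by linarith, by nlinarith⟩
  have h5 : b = (√(a + b) - √a) * (√(a + b) + √a) := by nlinarith
  nlinarith [Real.sqrt_nonneg a]

/-- The stage obtained by moving to a competitor. -/
def next (S : AscentStage E) (n : ℕ) (x₁ v₁ : E) (β₁ q₁ q₁' δ₁ : ℝ) : AscentStage E where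
  x := x₁
  v := v₁
  β := β₁
  q := q₁
  q' := q₁'
  δ := δ₁
  ψ := fun u => S.ψ u + (1 / 2) ^ (n + 2) * ‖u - v₁‖ ^ 2

/-- Gains of consecutive stages add up, and the new penalty contributes a further nonnegative
square. An upper bound for the total gain therefore bounds the change of direction as well. -/
theorem gain_eq_gain_next {F : Type*} [NormedAddCommGroup F] (S : AscentStage F) (n : ℕ)
    (x₁ v₁ : F) (β₁ q₁ q₁' δ₁ : ℝ) (v' : F) (β' : ℝ) : S.gain v' β' = (S.next n x₁ v₁ β₁ q₁ q₁' δ₁).gain v' β' + S.gain v₁ β₁ +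
      (1 / 2) ^ (n + 2) * ‖v' - v₁‖ ^ 2 := by
  simp [gain, next]
  ring

/-- The weights (1/2)^(n+2) form a geometric series, which keeps c below 1 and ‖b‖ below 2L at every
stage. -/
theorem IsPenalty.next {L : ℝ} {n : ℕ} {S : AscentStage E} (hψ : IsPenalty L n S.ψ)
    (x₁ : E) {v₁ : E} (hv : ‖v₁‖ ≤ 2 * L) (β₁ q₁ q₁' δ₁ : ℝ) :
    IsPenalty L (n + 1) (S.next n x₁ v₁ β₁ q₁ q₁' δ₁).ψ := by
  obtain ⟨c, d, b, hc0, hc, hb, h⟩ := hψ.exists_coeff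
  have hp : (0 : ℝ) < (1 / 2) ^ (n + 2) := by positivity
  have hp2 : (1 / 2 : ℝ) ^ (n + 1) = 2 * (1 / 2) ^ (n + 2) := by rw [pow_succ _ (n + 1)]; ring
  refine ⟨⟨c + (1 / 2) ^ (n + 2), d + (1 / 2) ^ (n + 2) * ‖v₁‖ ^ 2,
    b + (2 * (1 / 2) ^ (n + 2) : ℝ) • v₁, by positivity, ?_, ?_, fun u => ?_⟩, fun u => ?_⟩
  · show _ ≤ 1 - (1 / 2 : ℝ) ^ (n + 2)
    linarith
  · show _ ≤ 4 * L * (1 / 2 - (1 / 2 : ℝ) ^ (n + 2))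
    refine (norm_add_le _ _).trans ?_
    rw [norm_smul, Real.norm_eq_abs, abs_of_nonneg (by positivity)]
    rw [hp2] at hb
    nlinarith
  · show S.ψ u + (1 / 2) ^ (n + 2) * ‖u - v₁‖ ^ 2 = _
    rw [h, norm_sub_sq_real, inner_add_left, real_inner_smul_left, real_inner_comm u v₁]
    ring
  · show _ ≤ S.ψ u + (1 / 2) ^ (n + 2) * ‖u - v₁‖ ^ 2
    have := hψ.sq_le u
    have : 0 ≤ (1 / 2 : ℝ) ^ (n + 2) * ‖u - v₁‖ ^ 2 := by positivity
    linarith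

/-- Competitors of a subsequent stage are competitors of the given stage, provided that the
radius of the subsequent stage is small enough. -/
theorem IsGood.exists_radius {f : E → ℝ} {U : ℝ → Set E} {K L r : ℝ} (hL : 1 ≤ L)
    (hK : 2 * L ≤ K) (hf : ∀ x y, |f x - f y| ≤ L * ‖x - y‖) {n : ℕ} {S : AscentStage E}
    (hS : IsGood f U K L r n S) {x₁ v₁ : E} {β₁ q₁ : ℝ}
    (h₁ : IsCompetitor f U K (slack L n) S x₁ v₁ β₁ q₁) :
    ∃ δ₀ > 0, ∀ q₁' ≤ S.q', ∀ δ₁ ≤ δ₀, ∀ x' v' β' q₂,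
      IsCompetitor f U K (slack L (n + 1)) (S.next n x₁ v₁ β₁ q₁ q₁' δ₁) x' v' β' q₂ →
      IsCompetitor f U K (slack L n) S x' v' β' q₂ := by
  obtain ⟨σ₁, hσ₁, hchord⟩ := h₁.chord_le
  have hs0 : 0 < slack L n := by unfold slack; positivity
  have hs1 : slack L (n + 1) = slack L n / 4 := by unfold slack; rw [pow_succ]; ring
  have hK0 : 0 ≤ K := by linarith
  -- The competitor satisfies its chord condition with a strict margin slack - σ₁; ε spends half of
  -- it on long chords, and at most an eighth of the slack on short ones.
  set ε := min ((slack L n - σ₁) / 2) (slack L n / 8) with hε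
  have hε0 : 0 < ε := lt_min (by linarith) (by linarith)
  have hε1 : ε ≤ (slack L n - σ₁) / 2 := min_le_left _ _
  have hε2 : ε ≤ slack L n / 8 := min_le_right _ _
  obtain ⟨τ₁, hτ₁, hd₁⟩ := h₁.hasLineDerivAt.eventually_abs_sub_le (half_pos hε0)
  obtain ⟨τ₂, hτ₂, hd₂⟩ := hS.hasLineDerivAt.eventually_abs_sub_le (half_pos hε0)
  set τ := min τ₁ τ₂ with hτ
  have hτ0 : 0 < τ := lt_min hτ₁ hτ₂
  have hδ : 0 < S.δ - ‖x₁ - S.x‖ := by linarith [h₁.norm_lt]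
  refine ⟨min (S.δ - ‖x₁ - S.x‖) (ε * τ / (2 * L)), lt_min hδ (by positivity), ?_⟩
  intro q₁' hq₁' δ₁ hδ₁ x' v' β' q₂ h
  obtain ⟨σ₂, hσ₂, hchord₂⟩ := h.chord_le
  have hx' : ‖x' - x₁‖ < δ₁ := h.norm_lt
  have ha : 0 ≤ (S.next n x₁ v₁ β₁ q₁ q₁' δ₁).gain v' β' := h.gain_nonneg
  have hb := h₁.gain_nonneg
  have hg := S.gain_eq_gain_next n x₁ v₁ β₁ q₁ q₁' δ₁ v' β'
  set a := (S.next n x₁ v₁ β₁ q₁ q₁' δ₁).gain v' β' with hadef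
  set b := S.gain v₁ β₁ with hbdef
  set g := S.gain v' β' with hgdef
  have hpen : 0 ≤ (1 / 2 : ℝ) ^ (n + 2) * ‖v' - v₁‖ ^ 2 := by positivity
  have hgab : a + b ≤ g := by linarith
  have hgL : g ≤ L ^ 2 / 2 := by
    have h1 := hS.penalty.sq_le v'
    have h2 := (abs_le.1 (h.hasLineDerivAt.abs_le_of_lipschitz hf)).2
    have h3 := hS.nonneg
    rw [hgdef, gain]
    nlinarith [sq_nonneg (L - ‖v'‖)]
  refine ⟨h.hasLineDerivAt, h.mem, h₁.le_q.trans h.le_q, h.q_lt.trans_le hq₁', ?_, by linarith,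
    max (σ₁ + ε) (slack L n / 2), max_lt (by linarith) (by linarith), fun t => ?_⟩
  · have := norm_sub_le_norm_sub_add_norm_sub x' x₁ S.x
    have := hδ₁.trans (min_le_left _ _)
    linarith
  -- Short chords at `x₁` and `S.x` are replaced by their derivatives, and x' is compared with x₁
  -- through the chord condition of the new stage. For long chords the distance from x' to x₁ is
  -- negligible compared with |t|.
  rcases lt_or_ge |t| τ with ht | ht
  · have e1 := hd₁ t (ht.trans_le (min_le_left _ _))
    have e2 := hd₂ t (ht.trans_le (min_le_right _ _))
    have e3 : |(f (x' + t • v₁) - f x') - (f (x₁ + t • v₁) - f x₁)| ≤ (σ₂ + K * √a) * |t| :=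
      hchord₂ t
    have e4 : |f (x' + t • S.v) - f (x' + t • v₁)| ≤ L * dirStep L n * |t| := by
      refine (hf _ _).trans ?_
      rw [add_sub_add_left_eq_sub, ← smul_sub, norm_smul, Real.norm_eq_abs, norm_sub_rev]
      have := hS.dir_le _ _ _ _ h₁
      calc L * (|t| * ‖v₁ - S.v‖) ≤ L * (|t| * dirStep L n) := by gcongr
        _ = _ := by ring
    have hv₁ : ‖v₁‖ ≤ 2 * L := hS.penalty.norm_le hL hf h₁.hasLineDerivAt (by
      have := hS.nonneg
      rw [hbdef, gain] at hb
      linarith)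
    have hv : ‖S.v‖ ≤ 2 * L := hS.penalty.norm_le hL hf hS.hasLineDerivAt hS.nonneg
    have e5 := hS.penalty.sub_le hL hv₁ hv
    have e6 : |β₁ - S.β| ≤ b + 6 * L * dirStep L n := by
      have h1 : β₁ - S.β = b + (S.ψ v₁ - S.ψ S.v) := by rw [hbdef, gain]; ring
      rw [h1]
      have := hS.dir_le _ _ _ _ h₁
      calc |b + (S.ψ v₁ - S.ψ S.v)| ≤ |b| + |S.ψ v₁ - S.ψ S.v| := abs_add_le _ _
        _ ≤ b + 6 * L * dirStep L n := by
          rw [abs_of_nonneg hb]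
          gcongr
          exact e5.trans (by gcongr)
    have e7 : |t * (β₁ - S.β)| ≤ (b + 6 * L * dirStep L n) * |t| := by
      rw [abs_mul, mul_comm]; gcongr
    have e8 : (f (x' + t • S.v) - f x') - (f (S.x + t • S.v) - f S.x) =
        (f (x' + t • S.v) - f (x' + t • v₁)) +
        ((f (x' + t • v₁) - f x') - (f (x₁ + t • v₁) - f x₁)) +
        (f (x₁ + t • v₁) - f x₁ - t * β₁) - (f (S.x + t • S.v) - f S.x - t * S.β) +
        t * (β₁ - S.β) := by ring
    have e9 : |(f (x' + t • S.v) - f x') - (f (S.x + t • S.v) - f S.x)| ≤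
        (7 * L * dirStep L n + σ₂ + K * √a + ε + b) * |t| := by
      have e10 : (7 * L * dirStep L n + σ₂ + K * √a + ε + b) * |t| = L * dirStep L n * |t| +
          (σ₂ + K * √a) * |t| + ε / 2 * |t| + ε / 2 * |t| + (b + 6 * L * dirStep L n) * |t| := by
        ring
      rw [e8, e10, abs_le]
      have e1' := abs_le.1 e1
      have e2' := abs_le.1 e2
      have e3' := abs_le.1 e3
      have e4' := abs_le.1 e4
      have e7' := abs_le.1 e7
      constructor <;> linarith
    have hsq := mul_sqrt_add_le hL hK ha hb (hgab.trans hgL)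
    have hsq2 : K * √(a + b) ≤ K * √g := by gcongr
    -- The constants fit because 7/100 + 1/4 + 1/8 < 1/2: direction change, slack of the new stage,
    -- and ε, all relative to the slack of stage n.
    have hds : 7 * L * dirStep L n = 7 / 100 * slack L n := by unfold dirStep slack; ring
    refine e9.trans (mul_le_mul_of_nonneg_right ?_ (abs_nonneg t))
    have := le_max_right (σ₁ + ε) (slack L n / 2)
    linarith
  · have e1 := hchord t
    have e2 := hf (x' + t • S.v) (x₁ + t • S.v)
    have e3 := hf x' x₁
    rw [add_sub_add_right_eq_sub] at e2
    have e4 : 2 * (L * ‖x' - x₁‖) ≤ ε * |t| := by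
      have h1 : ‖x' - x₁‖ ≤ ε * τ / (2 * L) := hx'.le.trans (hδ₁.trans (min_le_right _ _))
      calc 2 * (L * ‖x' - x₁‖) ≤ 2 * (L * (ε * τ / (2 * L))) := by gcongr
        _ = ε * τ := by field_simp
        _ ≤ _ := by gcongr
    have e5 : |(f (x' + t • S.v) - f x') - (f (S.x + t • S.v) - f S.x)| ≤
        (σ₁ + ε + K * √b) * |t| := by
      have e6 : (σ₁ + ε + K * √b) * |t| = (σ₁ + K * √b) * |t| + ε * |t| := by ring
      rw [e6, abs_le]
      have e1' := abs_le.1 e1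
      have e2' := abs_le.1 e2
      have e3' := abs_le.1 e3
      constructor <;> linarith
    refine e5.trans ?_
    have : √b ≤ √g := Real.sqrt_le_sqrt (by linarith)
    gcongr
    exact le_max_left _ _

/-- One step of the search. -/
theorem IsGood.exists_next {f : E → ℝ} {U : ℝ → Set E} {K L r : ℝ} (hL : 1 ≤ L)
    (hK : 2 * L ≤ K) (hf : ∀ x y, |f x - f y| ≤ L * ‖x - y‖) {n : ℕ} {S : AscentStage E}
    (hS : IsGood f U K L r n S) :
    ∃ S' : AscentStage E, IsGood f U K L r (n + 1) S' ∧
      IsCompetitor f U K (slack L n) S S'.x S'.v S'.β S'.q ∧ S'.q' < S.q' ∧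
      ‖S'.x - S.x‖ + S'.δ < S.δ ∧
      ∀ x' v' β' q₂, IsCompetitor f U K (slack L (n + 1)) S' x' v' β' q₂ →
        IsCompetitor f U K (slack L n) S x' v' β' q₂ := by
  have hs0 : 0 < slack L n := by unfold slack; positivity
  set G : Set ℝ := {g | ∃ x' v' β' q₁, IsCompetitor f U K (slack L n) S x' v' β' q₁ ∧
    g = S.gain v' β'} with hG
  have hself : IsCompetitor f U K (slack L n) S S.x S.v S.β S.q :=
    ⟨hS.hasLineDerivAt, hS.mem, le_rfl, hS.q_lt, by simpa using hS.δ_pos, by simp [gain],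
      0, hs0, fun t => by simp [gain]⟩
  have hGne : G.Nonempty := ⟨_, _, _, _, _, hself, rfl⟩
  have hGbdd : BddAbove G := by
    refine ⟨gainBound L n, ?_⟩
    rintro g ⟨x', v', β', q₁, h, rfl⟩
    exact hS.gain_le _ _ _ _ h
  have hgb : 0 < gainBound L (n + 1) := by unfold gainBound dirStep; positivity
  -- The next stage comes within `gainBound L (n + 1)` of the supremum of the possible gains.
  obtain ⟨g, ⟨x₁, v₁, β₁, q₁, h₁, rfl⟩, hg⟩ :=
    exists_lt_of_lt_csSup hGne (show sSup G - gainBound L (n + 1) < sSup G by linarith)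
  have hmax : ∀ x' v' β' q₂, IsCompetitor f U K (slack L n) S x' v' β' q₂ →
      S.gain v' β' ≤ S.gain v₁ β₁ + gainBound L (n + 1) := by
    intro x' v' β' q₂ h
    have := le_csSup hGbdd (show S.gain v' β' ∈ G from ⟨_, _, _, _, h, rfl⟩)
    linarith
  obtain ⟨δ₀, hδ₀, hnest⟩ := hS.exists_radius hL hK hf h₁
  set δ₁ := min δ₀ ((S.δ - ‖x₁ - S.x‖) / 2) with hδ₁
  have hδd : 0 < S.δ - ‖x₁ - S.x‖ := by linarith [h₁.norm_lt]
  have hδpos : 0 < δ₁ := lt_min hδ₀ (by linarith)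
  have hδle : δ₁ ≤ (S.δ - ‖x₁ - S.x‖) / 2 := min_le_right _ _
  set q₁' := (q₁ + S.q') / 2 with hq₁'
  have hq : q₁ < S.q' := h₁.q_lt
  have hψ₁ : S.ψ v₁ ≤ β₁ := by
    have h1 := hS.nonneg
    have h2 := h₁.gain_nonneg
    rw [gain] at h2
    linarith
  have hv₁ : ‖v₁‖ ≤ 2 * L := hS.penalty.norm_le hL hf h₁.hasLineDerivAt hψ₁
  have hsub := hnest q₁' (by rw [hq₁']; linarith) δ₁ (min_le_left _ _)
  -- A competitor of the new stage is one of the old stage, so at most `gainBound L (n + 1)` of gain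
  -- is left for it, including the penalty square. Since this bound is (1/2)^(n+2) times the square
  -- of `dirStep L (n + 1)`, both required estimates follow.
  have hkey : ∀ x' v' β' q₂, IsCompetitor f U K (slack L (n + 1))
      (S.next n x₁ v₁ β₁ q₁ q₁' δ₁) x' v' β' q₂ →
      (S.next n x₁ v₁ β₁ q₁ q₁' δ₁).gain v' β' + (1 / 2) ^ (n + 2) * ‖v' - v₁‖ ^ 2 ≤
        gainBound L (n + 1) := by
    intro x' v' β' q₂ h
    have h1 := hmax _ _ _ _ (hsub _ _ _ _ h)
    rw [S.gain_eq_gain_next n x₁ v₁ β₁ q₁ q₁' δ₁ v' β'] at h1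
    linarith
  refine ⟨S.next n x₁ v₁ β₁ q₁ q₁' δ₁, ⟨h₁.hasLineDerivAt, h₁.mem, hS.q_nonneg.trans h₁.le_q, ?_,
    ?_, hδpos, ?_, hS.penalty.next x₁ hv₁ β₁ q₁ q₁' δ₁, ?_, ?_, ?_⟩, h₁, ?_, ?_, hsub⟩
  · show q₁ < q₁'
    rw [hq₁']; linarith
  · show q₁' ≤ 1
    have := hS.q'_le
    rw [hq₁']; linarith
  · show δ₁ ≤ _
    have := hS.δ_le
    rw [pow_succ]
    linarith [norm_nonneg (x₁ - S.x)]
  · show S.ψ v₁ + _ * ‖v₁ - v₁‖ ^ 2 ≤ β₁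
    simpa using hψ₁
  · intro x' v' β' q₂ h
    have h1 := hkey _ _ _ _ h
    have : 0 ≤ (1 / 2 : ℝ) ^ (n + 2) * ‖v' - v₁‖ ^ 2 := by positivity
    linarith
  · intro x' v' β' q₂ h
    have h1 := hkey _ _ _ _ h
    have h2 := h.gain_nonneg
    have h3 : (1 / 2 : ℝ) ^ (n + 2) * ‖v' - v₁‖ ^ 2 ≤
        (1 / 2) ^ (n + 2) * dirStep L (n + 1) ^ 2 := by
      have : gainBound L (n + 1) = (1 / 2) ^ (n + 2) * dirStep L (n + 1) ^ 2 := rfl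
      linarith
    have h4 := le_of_mul_le_mul_left h3 (by positivity)
    exact le_of_sq_le_sq h4 (by unfold dirStep; positivity)
  · show q₁' < S.q'
    rw [hq₁']; linarith
  · show ‖x₁ - S.x‖ + δ₁ < S.δ
    linarith


theorem tendsto_slack (L : ℝ) : Tendsto (slack L) atTop (𝓝 0) := by
  have := (tendsto_pow_atTop_nhds_zero_of_lt_one (r := (1 / 4 : ℝ)) (by norm_num)
    (by norm_num)).const_mul (200 * L ^ 2)
  rwa [mul_zero] at this

theorem tendsto_gainBound (L : ℝ) : Tendsto (gainBound L) atTop (𝓝 0) := by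
  have h1 := (tendsto_pow_atTop_nhds_zero_of_lt_one (r := (1 / 4 : ℝ)) (by norm_num)
    (by norm_num)).const_mul (2 * L)
  have h2 := (tendsto_pow_atTop_nhds_zero_of_lt_one (r := (1 / 2 : ℝ)) (by norm_num)
    (by norm_num)).comp (tendsto_add_atTop_nat 1)
  have := h2.mul (h1.pow 2)
  simp only [mul_zero, ne_eq, OfNat.ofNat_ne_zero, not_false_eq_true, zero_pow] at this
  exact this

/-- Starting from direction 0, the bounds required at stage 0 hold a priori: L‖v‖ - ‖v‖²/2 never
exceeds L²/2, and ‖v'‖ ≤ 2L for every competitor. -/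
theorem isGood_initial {f : E → ℝ} {U : ℝ → Set E} {K L r q₀ : ℝ} (hL : 1 ≤ L)
    (hf : ∀ x y, |f x - f y| ≤ L * ‖x - y‖) {x₀ : E} (hx₀ : x₀ ∈ U q₀) (h0 : 0 ≤ q₀) (h1 : q₀ < 1)
    (hr : 0 < r) : IsGood f U K L r 0 ⟨x₀, 0, 0, q₀, 1, r, fun u => ‖u‖ ^ 2 / 2⟩ := by
  have hpen : IsPenalty L 0 (fun u : E => ‖u‖ ^ 2 / 2) :=
    ⟨⟨1 / 2, 0, 0, by norm_num, by norm_num, by norm_num, fun u => by simp; ring⟩, fun u => le_rfl⟩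
  refine ⟨?_, hx₀, h0, h1, le_rfl, hr, by simp, hpen, by simp, ?_, ?_⟩
  · simp [HasLineDerivAt, hasDerivAt_const]
  · intro x' v' β' q₁ h
    have h2 := (abs_le.1 (h.hasLineDerivAt.abs_le_of_lipschitz hf)).2
    simp only [gain, gainBound, dirStep]
    norm_num
    nlinarith [sq_nonneg (L - ‖v'‖), norm_nonneg v']
  · intro x' v' β' q₁ h
    have h2 := h.gain_nonneg
    simp only [gain] at h2
    have h3 := hpen.norm_le hL hf h.hasLineDerivAt (by simpa using h2)
    simpa [dirStep] using h3

/-- Existence of a point and a direction at which the directional derivative cannot be increased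
substantially by moving to a nearby point at which the function behaves similarly along lines of
the given direction. -/
theorem exists_almost_maximal_lineDeriv [CompleteSpace E] {f : E → ℝ} {U : ℝ → Set E} {K L r q₀ : ℝ}
    (hmono : ∀ p q, p ≤ q → U p ⊆ U q) (hclosed : ∀ q, IsClosed (U q))
    (hL : 1 ≤ L) (hK : 2 * L ≤ K) (hf : ∀ x y, |f x - f y| ≤ L * ‖x - y‖)
    {x₀ : E} (hx₀ : x₀ ∈ U q₀) (h0 : 0 ≤ q₀) (h1 : q₀ < 1) (hr : 0 < r) :
    ∃ (x v : E) (β q : ℝ), ‖x - x₀‖ ≤ r ∧ 0 ≤ q ∧ q < 1 ∧ x ∈ U q ∧ HasLineDerivAt ℝ f β x v ∧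
      ‖v‖ ≤ 2 * L ∧ ∀ c > 0, ∃ p : E, ‖p‖ ≤ 6 * L ∧ ∃ δ > 0, ∃ q', q < q' ∧ q' < 1 ∧
        ∀ x' ∈ U q', ‖x' - x‖ < δ → ∀ (v' : E) (β' : ℝ), HasLineDerivAt ℝ f β' x' v' →
          c ≤ β' - β - ⟪p, v' - v⟫_ℝ - ‖v' - v‖ ^ 2 →
          ¬ ∀ t : ℝ, |(f (x' + t • v) - f x') - (f (x + t • v) - f x)| ≤
            K / 2 * √(β' - β - ⟪p, v' - v⟫_ℝ - ‖v' - v‖ ^ 2) * |t| := by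
  have hfc : Continuous f := by
    refine (LipschitzWith.of_dist_le_mul (K := L.toNNReal) fun x y => ?_).continuous
    rw [Real.dist_eq, dist_eq_norm, Real.coe_toNNReal _ (by linarith)]
    exact hf x y
  have hK0 : 0 ≤ K := by linarith
  choose! nxt hnxt using fun (n : ℕ) (S : AscentStage E) (hS : IsGood f U K L r n S) =>
    hS.exists_next hL hK hf
  let S : ℕ → AscentStage E := fun n =>
    Nat.rec ⟨x₀, 0, 0, q₀, 1, r, fun u => ‖u‖ ^ 2 / 2⟩ (fun n T => nxt n T) n
  have hgood : ∀ n, IsGood f U K L r n (S n) := by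
    intro n
    induction n with
    | zero => exact isGood_initial hL hf hx₀ h0 h1 hr
    | succ n ih => exact (hnxt n (S n) ih).1
  have hcomp1 : ∀ n, IsCompetitor f U K (slack L n) (S n) (S (n + 1)).x (S (n + 1)).v
      (S (n + 1)).β (S (n + 1)).q := fun n => (hnxt n (S n) (hgood n)).2.1
  have hq' : ∀ n, (S (n + 1)).q' < (S n).q' := fun n => (hnxt n (S n) (hgood n)).2.2.1
  have hball : ∀ n, ‖(S (n + 1)).x - (S n).x‖ + (S (n + 1)).δ < (S n).δ :=
    fun n => (hnxt n (S n) (hgood n)).2.2.2.1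
  have hnest : ∀ n k x' v' β' q₂, IsCompetitor f U K (slack L (n + k)) (S (n + k)) x' v' β' q₂ →
      IsCompetitor f U K (slack L n) (S n) x' v' β' q₂ := by
    intro n k
    induction k with
    | zero => exact fun x' v' β' q₂ h => h
    | succ k ih =>
      exact fun x' v' β' q₂ h => ih _ _ _ _ ((hnxt (n + k) (S (n + k)) (hgood _)).2.2.2.2 _ _ _ _ h)
  have hcomp : ∀ n m, n < m → IsCompetitor f U K (slack L n) (S n) (S m).x (S m).v
      (S m).β (S m).q := by
    intro n m hnm
    obtain ⟨k, rfl⟩ := Nat.exists_eq_add_of_lt hnm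
    exact hnest n k _ _ _ _ (hcomp1 (n + k))
  have hxc : CauchySeq fun n => (S n).x := by
    refine cauchySeq_of_le_geometric (1 / 2) r (by norm_num) fun n => ?_
    rw [dist_comm, dist_eq_norm]
    exact (hcomp1 n).norm_lt.le.trans (hgood n).δ_le
  have hvc : CauchySeq fun n => (S n).v := by
    refine cauchySeq_of_le_geometric (1 / 4) (2 * L) (by norm_num) fun n => ?_
    rw [dist_comm, dist_eq_norm]
    exact (hgood n).dir_le _ _ _ _ (hcomp1 n)
  obtain ⟨x, hx⟩ := cauchySeq_tendsto_of_complete hxc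
  obtain ⟨v, hv⟩ := cauchySeq_tendsto_of_complete hvc
  have hqm : Monotone fun n => (S n).q := monotone_nat_of_le_succ fun n => (hcomp1 n).le_q
  have hq'a : Antitone fun n => (S n).q' := antitone_nat_of_succ_le fun n => (hq' n).le
  have hqq' : ∀ n m, (S m).q ≤ (S n).q' := by
    intro n m
    calc (S m).q ≤ (S (max n m)).q := hqm (le_max_right _ _)
      _ ≤ (S (max n m)).q' := (hgood _).q_lt.le
      _ ≤ (S n).q' := hq'a (le_max_left _ _)
  have hbdd : BddAbove (range fun n => (S n).q) := ⟨(S 0).q', by rintro _ ⟨m, rfl⟩; exact hqq' 0 m⟩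
  set q := ⨆ n, (S n).q with hqdef
  have hle_q : ∀ n, (S n).q ≤ q := fun n => le_ciSup hbdd n
  -- The strict decrease of the upper indices leaves room above the limit index q at every stage.
  have hq_lt : ∀ n, q < (S n).q' := fun n =>
    (ciSup_le fun m => hqq' (n + 1) m).trans_lt (hq' n)
  have hxU : x ∈ U q := (hclosed q).mem_of_tendsto hx
    (Eventually.of_forall fun n => hmono _ _ (hle_q n) (hgood n).mem)
  have hx_lt : ∀ n, ‖x - (S n).x‖ < (S n).δ := by
    intro n
    have h2 : ‖x - (S (n + 1)).x‖ ≤ (S (n + 1)).δ :=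
      le_of_tendsto (hx.sub_const _).norm
        ((eventually_gt_atTop (n + 1)).mono fun m hm => (hcomp _ _ hm).norm_lt.le)
    have h3 := norm_sub_le_norm_sub_add_norm_sub x (S (n + 1)).x (S n).x
    linarith [hball n]
  set e : ℕ → ℝ := fun n => slack L n + K * √(gainBound L n) with he
  have he0 : Tendsto e atTop (𝓝 0) := by
    have := (tendsto_slack L).add (((tendsto_gainBound L).sqrt).const_mul K)
    simpa using this
  have hchord : ∀ n (t : ℝ), |(f (x + t • (S n).v) - f x) -
      (f ((S n).x + t • (S n).v) - f (S n).x)| ≤ e n * |t| := by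
    intro n t
    have h2 : Tendsto (fun m => |(f ((S m).x + t • (S n).v) - f (S m).x) -
        (f ((S n).x + t • (S n).v) - f (S n).x)|) atTop (𝓝 |(f (x + t • (S n).v) - f x) -
        (f ((S n).x + t • (S n).v) - f (S n).x)|) :=
      ((((hfc.tendsto _).comp (hx.add_const _)).sub ((hfc.tendsto _).comp hx)).sub_const _).abs
    refine le_of_tendsto h2 ((eventually_gt_atTop n).mono fun m hm => ?_)
    obtain ⟨σ', hσ', h3⟩ := (hcomp n m hm).chord_le
    refine (h3 t).trans ?_
    have h4 := (hgood n).gain_le _ _ _ _ (hcomp n m hm)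
    have h5 : K * √((S n).gain (S m).v (S m).β) ≤ K * √(gainBound L n) := by gcongr
    refine mul_le_mul_of_nonneg_right ?_ (abs_nonneg t)
    rw [he]
    linarith
  have hchord' : ∀ n (t : ℝ), |(f (x + t • v) - f x) -
      (f ((S n).x + t • (S n).v) - f (S n).x)| ≤ (e n + L * ‖v - (S n).v‖) * |t| := by
    intro n t
    have h2 := hchord n t
    have h3 := hf (x + t • v) (x + t • (S n).v)
    rw [add_sub_add_left_eq_sub, ← smul_sub, norm_smul, Real.norm_eq_abs] at h3
    have h4 := abs_le.1 h2
    have h5 := abs_le.1 h3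
    have h6 : (e n + L * ‖v - (S n).v‖) * |t| = e n * |t| + L * (|t| * ‖v - (S n).v‖) := by ring
    rw [h6, abs_le]
    constructor <;> linarith
  have hE0 : Tendsto (fun n => e n + L * ‖v - (S n).v‖) atTop (𝓝 0) := by
    have h2 : Tendsto (fun n => ‖v - (S n).v‖) atTop (𝓝 ‖v - v‖) := (tendsto_const_nhds.sub hv).norm
    simpa using he0.add (h2.const_mul L)
  -- Chords at x along v are uniformly close, relative to |t|, to those of stage n, where the
  -- derivative exists. This is the approximate gradient criterion on the real line.
  have hdiff : LineDifferentiableAt ℝ f x v := by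
    refine differentiableAt_of_forall_exists_approx (E := ℝ) fun η hη => ?_
    obtain ⟨n, hn⟩ := (hE0.eventually_lt_const (half_pos hη)).exists
    obtain ⟨τ, hτ, h2⟩ := (hgood n).hasLineDerivAt.eventually_abs_sub_le (half_pos hη)
    refine ⟨(S n).β, Metric.eventually_nhds_iff.2 ⟨τ, hτ, fun t ht => ?_⟩⟩
    have ht : |t| < τ := by simpa using ht
    have h3 := abs_le.1 (h2 t ht)
    have h4 := abs_le.1 (hchord' n t)
    have h5 : (e n + L * ‖v - (S n).v‖) * |t| ≤ η / 2 * |t| :=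
      mul_le_mul_of_nonneg_right hn.le (abs_nonneg t)
    simp only [zero_add, zero_smul, add_zero, Real.norm_eq_abs, RCLike.inner_apply, conj_trivial]
    rw [abs_le]
    constructor <;> linarith
  set β := lineDeriv ℝ f x v with hβ
  have hd : HasLineDerivAt ℝ f β x v := hdiff.hasLineDerivAt
  have hβn : ∀ n, |β - (S n).β| ≤ e n + L * ‖v - (S n).v‖ := by
    intro n
    have h2 : HasDerivAt (fun t : ℝ => f (x + t • v) - f ((S n).x + t • (S n).v))
        (β - (S n).β) 0 := HasDerivAt.sub hd (hgood n).hasLineDerivAt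
    have hnn : 0 ≤ e n + L * ‖v - (S n).v‖ := by
      have := (abs_nonneg _).trans (hchord' n 1)
      simpa using this
    refine h2.le_of_lip' hnn (Eventually.of_forall fun t => ?_)
    have := hchord' n t
    simp only [zero_smul, add_zero, sub_zero, Real.norm_eq_abs]
    convert this using 2
    ring
  have hβt : Tendsto (fun n => (S n).β) atTop (𝓝 β) := by
    rw [tendsto_iff_dist_tendsto_zero]
    refine squeeze_zero (fun n => dist_nonneg) (fun n => ?_) hE0
    rw [dist_comm, Real.dist_eq]
    exact hβn n
  have hv2 : ‖v‖ ≤ 2 * L := le_of_tendsto hv.norm (Eventually.of_forall fun n =>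
    (hgood n).penalty.norm_le hL hf (hgood n).hasLineDerivAt (hgood n).nonneg)
  refine ⟨x, v, β, q, (hx_lt 0).le, (hgood 0).q_nonneg.trans (hle_q 0),
    (hq_lt 0).trans_le (hgood 0).q'_le, hxU, hd, hv2, fun c hc => ?_⟩
  have hlim : Tendsto (fun n => e n + L * ‖v - (S n).v‖ + L * ‖v - (S n).v‖) atTop (𝓝 0) := by
    have h2 : Tendsto (fun n => ‖v - (S n).v‖) atTop (𝓝 ‖v - v‖) := (tendsto_const_nhds.sub hv).norm
    simpa using hE0.add (h2.const_mul L)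
  have hKc : 0 < K / 2 * √c := mul_pos (by linarith) (Real.sqrt_pos.2 hc)
  obtain ⟨n, hn1, hn2⟩ := ((hlim.eventually_lt_const hKc).and
    ((tendsto_gainBound L).eventually_lt_const hc)).exists
  obtain ⟨c₁, d₁, b₁, hc0, hc1, hb1, hψ⟩ := (hgood n).penalty.exists_coeff
  have hp : (0 : ℝ) < (1 / 2) ^ (n + 1) := by positivity
  -- The vector p is the gradient at v of the penalty of stage n; the remainder of its expansion is
  -- c₁‖v' - v‖² with c₁ ≤ 1.
  refine ⟨(2 * c₁) • v - b₁, ?_, (S n).δ - ‖x - (S n).x‖, by linarith [hx_lt n],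
    (q + (S n).q') / 2, by linarith [hq_lt n], by linarith [hq_lt n, (hgood n).q'_le], ?_⟩
  · refine (norm_sub_le _ _).trans ?_
    rw [norm_smul, Real.norm_eq_abs, abs_of_nonneg (by positivity)]
    have : 2 * c₁ * ‖v‖ ≤ 2 * 1 * (2 * L) := by gcongr; linarith
    have : ‖b₁‖ ≤ 2 * L := by nlinarith
    linarith
  intro x' hx' hx'd v' β' hd' hcg hch
  set g := β' - β - ⟪(2 * c₁) • v - b₁, v' - v⟫_ℝ - ‖v' - v‖ ^ 2 with hg
  have hlimit : (S n).β - (S n).ψ (S n).v ≤ β - (S n).ψ v := by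
    have hψc : Continuous (S n).ψ := by
      have : (S n).ψ = fun u => c₁ * ‖u‖ ^ 2 - ⟪b₁, u⟫_ℝ + d₁ := funext hψ
      rw [this]
      fun_prop
    refine ge_of_tendsto (hβt.sub ((hψc.tendsto _).comp hv))
      ((eventually_gt_atTop n).mono fun m hm => ?_)
    have := (hcomp n m hm).gain_nonneg
    rw [gain] at this
    simp only [Function.comp_apply]
    linarith
  have hexp : (S n).ψ v' - (S n).ψ v = ⟪(2 * c₁) • v - b₁, v' - v⟫_ℝ + c₁ * ‖v' - v‖ ^ 2 := by
    rw [hψ, hψ, inner_sub_left, real_inner_smul_left, norm_sub_sq_real, inner_sub_right,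
      inner_sub_right, real_inner_self_eq_norm_sq, real_inner_comm v v']
    ring
  have hgain : g ≤ (S n).gain v' β' := by
    have : c₁ * ‖v' - v‖ ^ 2 ≤ 1 * ‖v' - v‖ ^ 2 := by gcongr; linarith
    rw [gain, hg]
    linarith
  -- The data would be a competitor of stage n. Half of K is used by the assumed chord bound; the
  -- other half pays for passing from (x, v) to stage n. Its gain is at least c, which exceeds
  -- `gainBound L n`.
  have hcomp' : IsCompetitor f U K (slack L n) (S n) x' v' β' ((q + (S n).q') / 2) := by
    refine ⟨hd', hx', by linarith [hle_q n, hq_lt n], by linarith [hq_lt n], ?_, by linarith, 0, by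
      unfold slack; positivity, fun t => ?_⟩
    · have := norm_sub_le_norm_sub_add_norm_sub x' x (S n).x
      linarith
    have h2 := abs_le.1 (hch t)
    have h3 := abs_le.1 (hchord n t)
    have h4 := hf (x' + t • v) (x' + t • (S n).v)
    have h5 := hf (x + t • v) (x + t • (S n).v)
    rw [add_sub_add_left_eq_sub, ← smul_sub, norm_smul, Real.norm_eq_abs] at h4 h5
    have h4 := abs_le.1 h4
    have h5 := abs_le.1 h5
    have h6 : (e n + L * ‖v - (S n).v‖ + L * ‖v - (S n).v‖) * |t| ≤ K / 2 * √g * |t| := by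
      refine mul_le_mul_of_nonneg_right (hn1.le.trans ?_) (abs_nonneg t)
      have : √c ≤ √g := Real.sqrt_le_sqrt hcg
      gcongr
    have h7 : K * √g * |t| ≤ (0 + K * √((S n).gain v' β')) * |t| := by
      rw [zero_add]
      gcongr
    have h8 : |(f (x' + t • (S n).v) - f x') - (f ((S n).x + t • (S n).v) - f (S n).x)| ≤
        K * √g * |t| := by
      have h9 : (e n + L * ‖v - (S n).v‖ + L * ‖v - (S n).v‖) * |t| =
        e n * |t| + L * (|t| * ‖v - (S n).v‖) + L * (|t| * ‖v - (S n).v‖) := by ring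
      rw [h9] at h6
      have h10 : K * √g * |t| = K / 2 * √g * |t| + K / 2 * √g * |t| := by ring
      rw [h10, abs_le]
      constructor <;> linarith
    exact h8.trans h7
  have := (hgood n).gain_le _ _ _ _ hcomp'
  linarith

end AscentStage
end

/-! ### A mean value theorem with control of all chords. -/

noncomputable section

open MeasureTheory

theorem LipschitzWith.integral_deriv_eq_sub {F : ℝ → ℝ} {C : ℝ≥0} (hF : LipschitzWith C F)
    (a b : ℝ) : ∫ t in a..b, deriv F t = F b - F a :=
  (hF.lipschitzOnWith.absolutelyContinuousOnInterval (a := a) (b := b)).integral_deriv_eq_sub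

theorem LipschitzWith.intervalIntegrable_deriv {F : ℝ → ℝ} {C : ℝ≥0} (hF : LipschitzWith C F)
    (a b : ℝ) : IntervalIntegrable (deriv F) volume a b :=
  (hF.lipschitzOnWith.absolutelyContinuousOnInterval (a := a) (b := b)).intervalIntegrable_deriv

/-- A chord of a Lipschitz function is controlled by the variation over the chord. -/
theorem LipschitzWith.ofReal_abs_sub_le_lintegral {F : ℝ → ℝ} {C : ℝ≥0} (hF : LipschitzWith C F)
    (x y : ℝ) : ENNReal.ofReal |F y - F x| ≤ ∫⁻ t in uIcc x y, ENNReal.ofReal |deriv F t| := by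
  have key : ∀ x y : ℝ, x ≤ y →
      ENNReal.ofReal |F y - F x| ≤ ∫⁻ t in Icc x y, ENNReal.ofReal |deriv F t| := by
    intro x y hxy
    rw [← hF.integral_deriv_eq_sub x y, intervalIntegral.integral_of_le hxy,
      ← integral_Icc_eq_integral_Ioc]
    have hi : IntegrableOn (deriv F) (Icc x y) :=
      (intervalIntegrable_iff_integrableOn_Icc_of_le hxy).1 (hF.intervalIntegrable_deriv x y)
    rw [← ofReal_integral_eq_lintegral_ofReal hi.abs (Eventually.of_forall fun t => abs_nonneg _)]
    exact ENNReal.ofReal_le_ofReal abs_integral_le_integral_abs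
  rcases le_total x y with h | h
  · rw [uIcc_of_le h]; exact key x y h
  · rw [uIcc_of_ge h, abs_sub_comm]; exact key y x h

/-- Weak type estimate for the maximal chord slope of a Lipschitz function. -/
theorem LipschitzWith.volume_chord_slope_gt_le {F : ℝ → ℝ} {C : ℝ≥0} (hF : LipschitzWith C F)
    (a b : ℝ) {κ : ℝ} (hκ : 0 < κ) :
    volume {τ ∈ Icc a b | ∃ y ∈ Icc a b, κ * |y - τ| < |F y - F τ|} ≤
      ENNReal.ofReal (5 / κ) * ∫⁻ t in Icc a b, ENNReal.ofReal |deriv F t| := by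
  set T := {τ ∈ Icc a b | ∃ y ∈ Icc a b, κ * |y - τ| < |F y - F τ|} with hT
  have hex : ∀ τ, ∃ y, τ ∈ T → y ∈ Icc a b ∧ κ * |y - τ| < |F y - F τ| := by
    intro τ
    by_cases h : τ ∈ T
    · obtain ⟨y, hy, h'⟩ := h.2
      exact ⟨y, fun _ => ⟨hy, h'⟩⟩
    · exact ⟨0, fun h' => absurd h' h⟩
  choose y hy using hex
  have hball : ∀ τ, Metric.closedBall ((τ + y τ) / 2) (|y τ - τ| / 2) = uIcc τ (y τ) := by
    intro τ
    rw [Real.closedBall_eq_Icc]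
    rcases le_total τ (y τ) with h | h
    · rw [uIcc_of_le h, abs_of_nonneg (by linarith)]; congr 1 <;> ring
    · rw [uIcc_of_ge h, abs_of_nonpos (by linarith)]; congr 1 <;> ring
  have hpos : ∀ τ ∈ T, 0 < |y τ - τ| := by
    intro τ hτ
    rw [abs_pos]
    intro h
    have := (hy τ hτ).2
    rw [sub_eq_zero.1 h] at this
    simp at this
  -- Vitali's selection is applied to the intervals between τ and y τ, seen as balls about their
  -- midpoints. On each one the length is below |F(y τ) - F τ|/κ, hence below 1/κ times the integral
  -- of |F'|, and disjointness lets these integrals be added.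
  obtain ⟨u, huT, hdisj, hcov⟩ :=
    Vitali.exists_disjoint_subfamily_covering_enlargement_closedBall T
      (fun τ => (τ + y τ) / 2) (fun τ => |y τ - τ| / 2) ((b - a) / 2) (by
        intro τ hτ
        have h1 := (hy τ hτ).1
        have h2 := hτ.1
        have : |y τ - τ| ≤ b - a := abs_le.2 ⟨by linarith [h1.1, h2.2], by linarith [h1.2, h2.1]⟩
        linarith) 5 (by norm_num)
  have hcount : u.Countable := by
    refine hdisj.countable_of_nonempty_interior fun τ hτ => ?_
    refine ⟨(τ + y τ) / 2, ?_⟩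
    refine interior_mono Metric.ball_subset_closedBall ?_
    rw [Metric.isOpen_ball.interior_eq]
    exact Metric.mem_ball_self (by linarith [hpos τ (huT hτ)])
  have hsub : T ⊆ ⋃ τ ∈ u, Metric.closedBall ((τ + y τ) / 2) (5 * (|y τ - τ| / 2)) := by
    intro τ hτ
    obtain ⟨σ, hσ, h⟩ := hcov τ hτ
    refine mem_biUnion hσ (h ?_)
    rw [hball]; exact left_mem_uIcc
  calc volume T ≤ volume (⋃ τ ∈ u, Metric.closedBall ((τ + y τ) / 2) (5 * (|y τ - τ| / 2))) :=
        measure_mono hsub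
    _ ≤ ∑' τ : u, volume (Metric.closedBall (((τ : ℝ) + y τ) / 2) (5 * (|y τ - τ| / 2))) :=
        measure_biUnion_le _ hcount _
    _ ≤ ∑' τ : u, ENNReal.ofReal (5 / κ) *
          ∫⁻ t in uIcc (τ : ℝ) (y τ), ENNReal.ofReal |deriv F t| := by
        refine ENNReal.tsum_le_tsum fun τ => ?_
        rw [Real.volume_closedBall]
        calc ENNReal.ofReal (2 * (5 * (|y τ - τ| / 2)))
            ≤ ENNReal.ofReal (5 / κ * |F (y τ) - F τ|) := by
              refine ENNReal.ofReal_le_ofReal ?_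
              have := (hy τ (huT τ.2)).2
              rw [div_mul_eq_mul_div, le_div_iff₀ hκ]
              nlinarith
          _ = ENNReal.ofReal (5 / κ) * ENNReal.ofReal |F (y τ) - F τ| :=
              ENNReal.ofReal_mul (by positivity)
          _ ≤ _ := by gcongr; exact hF.ofReal_abs_sub_le_lintegral _ _
    _ = ENNReal.ofReal (5 / κ) *
          ∫⁻ t in ⋃ τ ∈ u, uIcc τ (y τ), ENNReal.ofReal |deriv F t| := by
        rw [ENNReal.tsum_mul_left, lintegral_biUnion hcount (fun τ _ => measurableSet_uIcc)]
        simpa only [hball] using hdisj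
    _ ≤ _ := by
        gcongr
        refine iUnion₂_subset fun τ hτ => ?_
        exact uIcc_subset_Icc (huT hτ).1 (hy τ (huT hτ)).1

/-- If at every point of `B` some chord is steep compared to the square root of the derivative,
then the derivative has small integral over `B`. -/
theorem LipschitzWith.setIntegral_deriv_le_of_steep_chords {F : ℝ → ℝ} {M : ℝ} (hM : 0 < M)
    (hF : LipschitzWith M.toNNReal F) (a b : ℝ) {K : ℝ} (hK : 0 < K) {B : Set ℝ}
    (hBm : MeasurableSet B) (hB : B ⊆ Icc a b) (hpos : ∀ τ ∈ B, 0 ≤ deriv F τ)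
    (hsteep : ∀ τ ∈ B, ∃ y ∈ Icc a b, K * √(deriv F τ) * |y - τ| < |F y - F τ|) :
    ∫ τ in B, deriv F τ ≤ 10 * √M / K * ∫ t in Icc a b, |deriv F t| := by
  have hle : ∀ t, |deriv F t| ≤ M := by
    intro t
    have := norm_deriv_le_of_lipschitz hF (x₀ := t)
    rwa [Real.coe_toNNReal _ hM.le, Real.norm_eq_abs] at this
  have hi : IntegrableOn (deriv F) (Icc a b) := by
    rcases le_total a b with hab | hab
    · exact (intervalIntegrable_iff_integrableOn_Icc_of_le hab).1 (hF.intervalIntegrable_deriv a b)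
    · rcases eq_or_lt_of_le hab with rfl | h
      · simp
      · simp [Icc_eq_empty (not_le.2 h)]
  set V := ∫ t in Icc a b, |deriv F t| with hV
  have hV0 : 0 ≤ V := integral_nonneg fun t => abs_nonneg _
  have hVl : ∫⁻ t in Icc a b, ENNReal.ofReal |deriv F t| = ENNReal.ofReal V :=
    (ofReal_integral_eq_lintegral_ofReal hi.abs (Eventually.of_forall fun t => abs_nonneg _)).symm
  set φ : ℝ → ℝ := B.indicator (deriv F) with hφ
  have hφ0 : ∀ t, 0 ≤ φ t := fun t => indicator_nonneg hpos t
  have hφm : Measurable φ := (measurable_deriv F).indicator hBm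
  -- Where the derivative exceeds t, some chord has slope above K√t, so the weak type estimate
  -- bounds the level set by 5V/(K√t). Integrating over levels t ≤ M gives 10√M V/K; t^(-1/2) is
  -- integrable at 0, and this is why the square root appears in the chord condition.
  have hlev : ∀ t ∈ Ioi (0 : ℝ), volume {τ | t < φ τ} ≤
      (Ioc 0 M).indicator (fun t => ENNReal.ofReal (5 / K * V * t ^ (-(1 / 2) : ℝ))) t := by
    intro t ht
    have ht : 0 < t := ht
    by_cases htM : t ≤ M
    · rw [indicator_of_mem (show t ∈ Ioc 0 M from ⟨ht, htM⟩)]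
      have hst : 0 < √t := Real.sqrt_pos.2 ht
      calc volume {τ | t < φ τ}
          ≤ volume {τ ∈ Icc a b | ∃ y ∈ Icc a b, K * √t * |y - τ| < |F y - F τ|} := by
            refine measure_mono fun τ hτ => ?_
            have hτ : t < φ τ := hτ
            have hτB : τ ∈ B := by
              by_contra h
              rw [hφ, indicator_of_notMem h] at hτ
              linarith
            rw [hφ, indicator_of_mem hτB] at hτ
            obtain ⟨y, hy, h⟩ := hsteep τ hτB
            refine ⟨hB hτB, y, hy, lt_of_le_of_lt ?_ h⟩
            gcongr
        _ ≤ _ := hF.volume_chord_slope_gt_le a b (by positivity)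
        _ = ENNReal.ofReal (5 / K * V * t ^ (-(1 / 2) : ℝ)) := by
            rw [hVl, ← ENNReal.ofReal_mul (by positivity)]
            congr 1
            rw [Real.rpow_neg ht.le, ← Real.sqrt_eq_rpow]
            field_simp
    · have : {τ | t < φ τ} = ∅ := by
        ext τ
        simp only [mem_ofPred_eq, mem_empty_iff_false, iff_false, not_lt]
        refine le_trans ?_ (not_le.1 htM).le
        by_cases h : τ ∈ B
        · rw [hφ, indicator_of_mem h]; exact (le_abs_self _).trans (hle τ)
        · rw [hφ, indicator_of_notMem h]; exact hM.le
      simp [this]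
  have hkernel : IntervalIntegrable (fun t : ℝ => 5 / K * V * t ^ (-(1 / 2) : ℝ)) volume 0 M :=
    (intervalIntegral.intervalIntegrable_rpow' (by norm_num)).const_mul _
  have hval : ∫ t in (0 : ℝ)..M, 5 / K * V * t ^ (-(1 / 2) : ℝ) = 10 * √M / K * V := by
    rw [intervalIntegral.integral_const_mul, integral_rpow (Or.inl (by norm_num)),
      Real.sqrt_eq_rpow]
    norm_num
    ring
  have hup : ∫⁻ τ, ENNReal.ofReal (φ τ) ≤ ENNReal.ofReal (10 * √M / K * V) := by
    rw [lintegral_eq_lintegral_meas_lt volume (Eventually.of_forall hφ0) hφm.aemeasurable]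
    calc ∫⁻ t in Ioi (0 : ℝ), volume {τ | t < φ τ}
        ≤ ∫⁻ t in Ioi (0 : ℝ), (Ioc 0 M).indicator
            (fun t => ENNReal.ofReal (5 / K * V * t ^ (-(1 / 2) : ℝ))) t :=
          setLIntegral_mono' measurableSet_Ioi hlev
      _ = ∫⁻ t in Ioc 0 M, ENNReal.ofReal (5 / K * V * t ^ (-(1 / 2) : ℝ)) := by
          rw [setLIntegral_indicator measurableSet_Ioc,
            inter_eq_left.2 (fun t ht => ht.1)]
      _ = _ := by
          rw [← hval, intervalIntegral.integral_of_le hM.le]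
          refine (ofReal_integral_eq_lintegral_ofReal
            ((intervalIntegrable_iff_integrableOn_Ioc_of_le hM.le).1 hkernel) ?_).symm
          refine (ae_restrict_iff' measurableSet_Ioc).2 (Eventually.of_forall fun t ht => ?_)
          have : 0 ≤ t ^ (-(1 / 2) : ℝ) := Real.rpow_nonneg ht.1.le _
          positivity
  have hφi : Integrable φ := (integrable_indicator_iff hBm).2 (hi.mono_set hB)
  rw [← ofReal_integral_eq_lintegral_ofReal hφi (Eventually.of_forall hφ0)] at hup
  rw [← integral_indicator hBm]
  exact (ENNReal.ofReal_le_ofReal_iff (by positivity)).1 hup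

/-- A mean value theorem with control of all chords: a Lipschitz function which rises by a
definite amount inside `[a, b]` has, outside a small exceptional set, a point at which the
derivative is large and all chords are at most of the order of the square root of the derivative. -/
theorem LipschitzWith.exists_hasDerivAt_ge_and_chord_le {F : ℝ → ℝ} {M : ℝ} (hM : 0 < M)
    (hF : LipschitzWith M.toNNReal F) {a b : ℝ} (hab : a < b) {c : ℝ} (hc : 0 < c)
    {N : Set ℝ} (hN : MeasurableSet N)
    (hNvol : volume (N ∩ Icc a b) ≤ ENNReal.ofReal (c * (b - a) / (2 * M)))
    {y₁ y₂ : ℝ} (hay : a ≤ y₁) (hyy : y₁ ≤ y₂) (hyb : y₂ ≤ b)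
    (hrise : 2 * c * (b - a) ≤ F y₂ - F y₁) (hends : |F b - F a| ≤ c * (b - a))
    {K : ℝ} (hK : 100 * √M < K) :
    ∃ τ ∈ Icc a b \ N, ∃ g, c ≤ g ∧ HasDerivAt F g τ ∧
      ∀ y ∈ Icc a b, |F y - F τ| ≤ K * √g * |y - τ| := by
  by_contra hcon
  push Not at hcon
  have hK0 : 0 < K := lt_of_le_of_lt (by positivity) hK
  have hle : ∀ t, |deriv F t| ≤ M := by
    intro t
    have := norm_deriv_le_of_lipschitz hF (x₀ := t)
    rwa [Real.coe_toNNReal _ hM.le, Real.norm_eq_abs] at this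
  have hi : IntegrableOn (deriv F) (Icc a b) :=
    (intervalIntegrable_iff_integrableOn_Icc_of_le hab.le).1 (hF.intervalIntegrable_deriv a b)
  set B : Set ℝ := (Icc a b \ N) ∩ {τ | c ≤ deriv F τ} with hBdef
  have hBm : MeasurableSet B :=
    (measurableSet_Icc.diff hN).inter (measurableSet_le measurable_const (measurable_deriv F))
  have hBsub : B ⊆ Icc a b := fun τ hτ => hτ.1.1
  have hdiff : ∀ τ ∈ B, HasDerivAt F (deriv F τ) τ := by
    intro τ hτ
    refine DifferentiableAt.hasDerivAt ?_
    by_contra h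
    have := hτ.2
    -- At points without a derivative `deriv` takes the value 0, which is below c.
    rw [mem_ofPred_eq, deriv_zero_of_not_differentiableAt h] at this
    linarith
  have hbd := hF.setIntegral_deriv_le_of_steep_chords hM a b hK0 hBm hBsub
    (fun τ hτ => hc.le.trans hτ.2) (fun τ hτ => hcon τ hτ.1 _ hτ.2 (hdiff τ hτ))
  set I := ∫ τ in B, deriv F τ with hI
  set V := ∫ t in Icc a b, |deriv F t| with hV
  set W := ∫ t in Icc a b, max (deriv F t) 0 with hW
  have hip : IntegrableOn (fun t => max (deriv F t) 0) (Icc a b) := hi.pos_part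
  -- Because the values at the ends nearly agree, the total variation V is about twice the integral
  -- W of the positive part.
  have hVW : V = 2 * W - (F b - F a) := by
    rw [← hF.integral_deriv_eq_sub a b, intervalIntegral.integral_of_le hab.le,
      ← integral_Icc_eq_integral_Ioc, hV, hW, ← integral_const_mul,
      ← integral_sub (hip.const_mul 2) hi]
    refine integral_congr_ae (Eventually.of_forall fun t => ?_)
    rcases le_total 0 (deriv F t) with h | h
    · simp only [abs_of_nonneg h, max_eq_left h]; ring
    · simp only [abs_of_nonpos h, max_eq_right h]; ring
  have hW1 : 2 * c * (b - a) ≤ W := by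
    refine hrise.trans ?_
    rw [← hF.integral_deriv_eq_sub y₁ y₂, intervalIntegral.integral_of_le hyy,
      ← integral_Icc_eq_integral_Ioc]
    have hsub : Icc y₁ y₂ ⊆ Icc a b := Icc_subset_Icc hay hyb
    calc ∫ t in Icc y₁ y₂, deriv F t ≤ ∫ t in Icc y₁ y₂, max (deriv F t) 0 :=
          integral_mono (hi.mono_set hsub) (hip.mono_set hsub) fun t => le_max_left _ _
      _ ≤ W := setIntegral_mono_set hip (Eventually.of_forall fun t => le_max_right _ _)
          hsub.eventuallyLE
  have hW2 : W ≤ I + c * (b - a) + c * (b - a) / 2 := by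
    have hiB : IntegrableOn (B.indicator (deriv F)) (Icc a b) := hi.indicator hBm
    have hiN : IntegrableOn (N.indicator fun _ => M) (Icc a b) :=
      (integrableOn_const (by simp)).indicator hN
    have hic : IntegrableOn (fun _ => c) (Icc a b) := integrableOn_const (by simp)
    have h1 : W ≤ ∫ t in Icc a b, (B.indicator (deriv F) t + c + N.indicator (fun _ => M) t) := by
      refine setIntegral_mono_on hip ((hiB.add hic).add hiN) measurableSet_Icc fun t ht => ?_
      by_cases htN : t ∈ N
      · rw [indicator_of_mem htN, indicator_of_notMem (fun h => h.1.2 htN)]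
        exact max_le (by linarith [(le_abs_self _).trans (hle t)]) (by linarith)
      · rw [indicator_of_notMem htN]
        by_cases htc : c ≤ deriv F t
        · rw [indicator_of_mem (show t ∈ B from ⟨⟨ht, htN⟩, htc⟩)]
          exact max_le (by linarith) (by linarith)
        · rw [indicator_of_notMem (fun h => htc h.2)]
          exact max_le (by linarith) (by linarith)
    have h2 : ∫ t in Icc a b, (B.indicator (deriv F) t + c + N.indicator (fun _ => M) t) =
        I + c * (b - a) + volume.real (Icc a b ∩ N) * M := by
      have hadd : IntegrableOn (fun t => B.indicator (deriv F) t + c) (Icc a b) := hiB.add hic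
      rw [integral_add hadd hiN, integral_add hiB hic, setIntegral_indicator hBm,
        setIntegral_indicator hN, inter_eq_right.2 hBsub, setIntegral_const, setIntegral_const]
      simp only [smul_eq_mul, Real.volume_real_Icc_of_le hab.le]
      ring
    have h3 : volume.real (Icc a b ∩ N) ≤ c * (b - a) / (2 * M) := by
      rw [inter_comm]
      refine ENNReal.toReal_le_of_le_ofReal ?_ hNvol
      have : 0 < b - a := by linarith
      positivity
    have h4 : volume.real (Icc a b ∩ N) * M ≤ c * (b - a) / 2 := by
      calc _ ≤ c * (b - a) / (2 * M) * M := by gcongr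
        _ = _ := by field_simp
    linarith
  have hpos : 0 < c * (b - a) := mul_pos hc (by linarith)
  have hends' := abs_le.1 hends
  -- With r = c(b - a), one has 2r ≤ W ≤ I + 3r/2, so I ≥ r/2, and V ≤ 2W + r ≤ 2I + 4r ≤ 10I. The
  -- bound for I by V is then contradictory as soon as 100√M < K.
  have hV10 : V ≤ 10 * I := by linarith
  have hI0 : 0 < I := by linarith
  have h5 : 10 * √M / K * V ≤ 10 * √M / K * (10 * I) := by gcongr
  have h6 : 10 * √M / K * (10 * I) < I := by
    have : 10 * √M / K * (10 * I) = (100 * √M / K) * I := by ring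
    rw [this]
    have : 100 * √M / K < 1 := (div_lt_one hK0).2 hK
    nlinarith
  linarith

end

/-! ### Bent curves and the increase of a directional derivative. -/

noncomputable section

open MeasureTheory
open scoped InnerProductSpace

/-- The piecewise affine function which is `0` before `a` and `1` after `b`. -/
def ramp (a b t : ℝ) : ℝ := max 0 (min 1 ((t - a) / (b - a)))

theorem ramp_of_le {a b t : ℝ} (hab : a < b) (h : t ≤ a) : ramp a b t = 0 := by
  refine max_eq_left ((min_le_right _ _).trans ?_)
  exact div_nonpos_of_nonpos_of_nonneg (by linarith) (by linarith)

theorem ramp_of_ge {a b t : ℝ} (hab : a < b) (h : b ≤ t) : ramp a b t = 1 := by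
  have : 1 ≤ (t - a) / (b - a) := (one_le_div (by linarith)).2 (by linarith)
  rw [ramp, min_eq_left this]
  simp

theorem ramp_of_mem {a b t : ℝ} (hab : a < b) (h : t ∈ Icc a b) :
    ramp a b t = (t - a) / (b - a) := by
  have h1 : (t - a) / (b - a) ≤ 1 := (div_le_one (by linarith)).2 (by linarith [h.2])
  have h2 : 0 ≤ (t - a) / (b - a) := div_nonneg (by linarith [h.1]) (by linarith)
  rw [ramp, min_eq_right h1, max_eq_right h2]

theorem abs_ramp_sub_le {a b : ℝ} (hab : a < b) (t t' : ℝ) :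
    |ramp a b t - ramp a b t'| ≤ |t - t'| / (b - a) := by
  have h1 : |ramp a b t - ramp a b t'| ≤ |(t - a) / (b - a) - (t' - a) / (b - a)| := by
    unfold ramp
    refine (abs_max_sub_max_le_max _ _ _ _).trans ?_
    rw [sub_self, abs_zero]
    refine max_le (abs_nonneg _) ((abs_min_sub_min_le_max _ _ _ _).trans ?_)
    rw [sub_self, abs_zero]
    exact max_le (abs_nonneg _) le_rfl
  refine h1.trans (le_of_eq ?_)
  rw [← sub_div, sub_sub_sub_cancel_right, abs_div, abs_of_pos (show 0 < b - a by linarith)]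

section

variable {E : Type*} [NormedAddCommGroup E] [NormedSpace ℝ E]

theorem norm_ramp_smul_sub_le {a b : ℝ} (hab : a < b) {d : E} {C : ℝ} (hd : ‖d‖ ≤ C * (b - a))
    (t t' : ℝ) : ‖ramp a b t • d - ramp a b t' • d‖ ≤ C * |t - t'| := by
  rw [← sub_smul, norm_smul, Real.norm_eq_abs]
  have hba : 0 < b - a := by linarith
  calc |ramp a b t - ramp a b t'| * ‖d‖ ≤ |t - t'| / (b - a) * (C * (b - a)) := by
        gcongr
        exact abs_ramp_sub_le hab t t'
    _ = _ := by field_simp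

/-- A polygonal displacement which vanishes outside `(-s, s)` and is affine on two long pieces
with prescribed values at their ends. -/
theorem exists_polygonal_displacement {s κ A : ℝ} (hs : 0 < s) (hκ : 0 < κ) (hκ4 : κ ≤ 1 / 4)
    (hA : 0 < A) {y d₁ d₂ d₃ d₄ : E} (hy : ‖y‖ ≤ s / A) (h₁ : ‖d₁‖ ≤ κ / A * s)
    (h₂ : ‖d₂ - y‖ ≤ κ / A * s) (h₃ : ‖d₃ - y‖ ≤ κ / A * s) (h₄ : ‖d₄‖ ≤ κ / A * s) :
    ∃ w : ℝ → E, (∀ t, t ≤ -s → w t = 0) ∧ (∀ t, s ≤ t → w t = 0) ∧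
      (∀ t t', ‖w t - w t'‖ ≤ 9 / A * |t - t'|) ∧
      (∀ t ∈ Icc (-s + κ * s) (-(κ * s)), w t =
        d₁ + ((t - (-s + κ * s)) / (-(κ * s) - (-s + κ * s))) • (d₂ - d₁)) ∧
      (∀ t ∈ Icc (κ * s) (s - κ * s), w t =
        d₃ + ((t - κ * s) / (s - κ * s - κ * s)) • (d₄ - d₃)) := by
  have hκs : 0 < κ * s := by positivity
  have hκs4 : κ * s ≤ s / 4 := by nlinarith
  have i1 : -s < -s + κ * s := by linarith
  have i2 : -s + κ * s < -(κ * s) := by linarith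
  have i3 : -(κ * s) < κ * s := by linarith
  have i4 : κ * s < s - κ * s := by linarith
  have i5 : s - κ * s < s := by linarith
  have hsmall : κ / A * s ≤ 1 / A * (s / 4) := by
    rw [div_mul_eq_mul_div, div_mul_eq_mul_div, one_mul]
    gcongr
  have hyA : s / A = 1 / A * s := by ring
  have hA1 : 0 < 1 / A := by positivity
  have hA1s : 0 < 1 / A * s := by positivity
  have b1 : ‖d₁‖ ≤ 1 / A * (-s + κ * s - -s) := by
    refine h₁.trans (le_of_eq ?_); ring
  have b5 : ‖-d₄‖ ≤ 1 / A * (s - (s - κ * s)) := by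
    rw [norm_neg]; refine h₄.trans (le_of_eq ?_); ring
  have b3 : ‖d₃ - d₂‖ ≤ 1 / A * (κ * s - -(κ * s)) := by
    have := norm_sub_le (d₃ - y) (d₂ - y)
    rw [sub_sub_sub_cancel_right] at this
    have e : 1 / A * (κ * s - -(κ * s)) = κ / A * s + κ / A * s := by ring
    linarith
  have hlong : 1 / A * (s * (3 / 2)) ≤ 3 / A * (s - κ * s - κ * s) := by
    have : 3 / A * (s - κ * s - κ * s) = 1 / A * (3 * (s - κ * s - κ * s)) := by ring
    rw [this]
    exact mul_le_mul_of_nonneg_left (by linarith) hA1.le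
  have b2 : ‖d₂ - d₁‖ ≤ 3 / A * (-(κ * s) - (-s + κ * s)) := by
    have h5 := norm_sub_le (d₂ - y + y) d₁
    have h6 := norm_add_le (d₂ - y) y
    rw [sub_add_cancel] at h5 h6
    have e : -(κ * s) - (-s + κ * s) = s - κ * s - κ * s := by ring
    rw [e]
    linarith
  have b4 : ‖d₄ - d₃‖ ≤ 3 / A * (s - κ * s - κ * s) := by
    have h5 := norm_sub_le d₄ (d₃ - y + y)
    have h6 := norm_add_le (d₃ - y) y
    rw [sub_add_cancel] at h5 h6
    linarith
  -- The increments are switched on by ramps over five consecutive intervals, with Lipschitz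
  -- constants 1/A, 3/A, 1/A, 3/A, 1/A, of total 9/A.
  refine ⟨fun t => ramp (-s) (-s + κ * s) t • d₁ +
    ramp (-s + κ * s) (-(κ * s)) t • (d₂ - d₁) + ramp (-(κ * s)) (κ * s) t • (d₃ - d₂) +
    ramp (κ * s) (s - κ * s) t • (d₄ - d₃) + ramp (s - κ * s) s t • (-d₄),
    fun t ht => ?_, fun t ht => ?_, fun t t' => ?_, fun t ht => ?_, fun t ht => ?_⟩
  · dsimp only
    rw [ramp_of_le i1 ht, ramp_of_le i2 (by linarith), ramp_of_le i3 (by linarith),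
      ramp_of_le i4 (by linarith), ramp_of_le i5 (by linarith)]
    simp
  · dsimp only
    rw [ramp_of_ge i1 (by linarith), ramp_of_ge i2 (by linarith), ramp_of_ge i3 (by linarith),
      ramp_of_ge i4 (by linarith), ramp_of_ge i5 ht]
    simp
  · have n1 := norm_ramp_smul_sub_le i1 b1 t t'
    have n2 := norm_ramp_smul_sub_le i2 b2 t t'
    have n3 := norm_ramp_smul_sub_le i3 b3 t t'
    have n4 := norm_ramp_smul_sub_le i4 b4 t t'
    have n5 := norm_ramp_smul_sub_le i5 b5 t t'
    have e : ∀ p₁ p₂ p₃ p₄ p₅ r₁ r₂ r₃ r₄ r₅ : E, p₁ + p₂ + p₃ + p₄ + p₅ -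
        (r₁ + r₂ + r₃ + r₄ + r₅) = (p₁ - r₁) + (p₂ - r₂) + (p₃ - r₃) + (p₄ - r₄) + (p₅ - r₅) := by
      intros; abel
    rw [e]
    refine (norm_add_le_of_le (norm_add_le_of_le (norm_add_le_of_le
      (norm_add_le_of_le n1 n2) n3) n4) n5).trans (le_of_eq ?_)
    ring
  · dsimp only
    rw [ramp_of_ge i1 ht.1, ramp_of_mem i2 ht, ramp_of_le i3 ht.2,
      ramp_of_le i4 (by linarith [ht.2]), ramp_of_le i5 (by linarith [ht.2])]
    simp
  · dsimp only
    rw [ramp_of_ge i1 (by linarith [ht.1]), ramp_of_ge i2 (by linarith [ht.1]),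
      ramp_of_ge i3 ht.1, ramp_of_mem i4 ht, ramp_of_le i5 ht.2]
    simp

/-- Derivatives along an affine piece of a curve are directional derivatives. -/
theorem exists_hasLineDerivAt_of_affine_piece {f : E → ℝ} {x v d d' : E} {a b β g τ C : ℝ}
    {w : ℝ → E} (hab : a < b) (hw : ∀ t ∈ Icc a b, w t = d + ((t - a) / (b - a)) • (d' - d))
    (hlip : ∀ t t', ‖w t - w t'‖ ≤ C * |t - t'|) (hτ : τ ∈ Ioo a b)
    (hF : HasDerivAt (fun t => f (x + t • v + w t) - β * t) g τ) :
    x + τ • v + w τ ∈ segment ℝ (x + (a • v + d)) (x + (b • v + d')) ∧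
      ∃ v', ‖v' - v‖ ≤ C ∧ HasLineDerivAt ℝ f (g + β) (x + τ • v + w τ) v' := by
  have hba : 0 < b - a := by linarith
  have hτI := Ioo_subset_Icc_self hτ
  refine ⟨?_, v + (b - a)⁻¹ • (d' - d), ?_, ?_⟩
  · rw [segment_eq_image']
    refine ⟨(τ - a) / (b - a), ⟨div_nonneg (by linarith [hτI.1]) hba.le,
      (div_le_one hba).2 (by linarith [hτI.2])⟩, ?_⟩
    rw [hw τ hτI]
    have h1 : τ • v = a • v + ((τ - a) / (b - a)) • (b • v - a • v) := by
      rw [← sub_smul, smul_smul, div_mul_cancel₀ _ hba.ne', ← add_smul]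
      congr 1; ring
    have h2 : x + (b • v + d') - (x + (a • v + d)) = (b • v - a • v) + (d' - d) := by abel
    simp only [h2, h1, smul_add]
    abel
  · rw [add_sub_cancel_left]
    have h1 := hlip b a
    rw [hw b (right_mem_Icc.2 hab.le), hw a (left_mem_Icc.2 hab.le), div_self hba.ne', sub_self,
      zero_div, zero_smul, add_zero, one_smul, add_sub_cancel, abs_of_pos hba] at h1
    rw [norm_smul, norm_inv, Real.norm_eq_abs, abs_of_pos hba, inv_mul_le_iff₀ hba]
    linarith
  · have h1 : HasDerivAt (fun t => f (x + t • v + w t)) (g + β) τ := by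
      have h2 := hF.add ((hasDerivAt_id τ).const_mul β)
      simp only [mul_one] at h2
      refine h2.congr_of_eventuallyEq (Eventually.of_forall fun t => ?_)
      simp
    have h3 : HasDerivAt (fun t => f (x + (τ + t) • v + w (τ + t))) (g + β) 0 := by
      have := HasDerivAt.comp_const_add τ 0 (f := fun t => f (x + t • v + w t)) (f' := g + β)
        (by simpa using h1)
      exact this
    refine HasDerivAt.congr_of_eventuallyEq h3 ?_
    have h4 : ∀ᶠ t in 𝓝 (0 : ℝ), τ + t ∈ Ioo a b := by
      have : Tendsto (fun t : ℝ => τ + t) (𝓝 0) (𝓝 (τ + 0)) :=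
        (continuous_const.add continuous_id).tendsto 0
      rw [add_zero] at this
      exact this (Ioo_mem_nhds hτ.1 hτ.2)
    filter_upwards [h4] with t ht
    congr 1
    rw [hw _ (Ioo_subset_Icc_self ht), hw τ hτI, smul_add, smul_smul, add_smul]
    have : (τ + t - a) / (b - a) = (τ - a) / (b - a) + t * (b - a)⁻¹ := by ring
    rw [this, add_smul]
    abel

end

section

variable {E : Type*} [NormedAddCommGroup E] [NormedSpace ℝ E]

/-- The set `T` contains segments close to any given segment in small balls centred at `x`. -/
def HasSegmentsNear (T : Set E) (x : E) : Prop :=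
  ∀ η > (0 : ℝ), ∃ δ₀ > (0 : ℝ), ∀ δ, 0 < δ → δ < δ₀ → ∀ u₁ u₂ : E, ‖u₁‖ ≤ δ → ‖u₂‖ ≤ δ →
    ∃ u₁' u₂' : E, ‖u₁' - u₁‖ ≤ η * δ ∧ ‖u₂' - u₂‖ ≤ η * δ ∧
      segment ℝ (x + u₁') (x + u₂') ⊆ T

set_option maxHeartbeats 1000000 in
/-- If `f` is not flat at `x`, then there are points of `T` close to `x` at which `f` has a
larger directional derivative in a slightly changed direction, while behaving similarly along
lines of the original direction. -/
theorem HasSegmentsNear.exists_larger_lineDeriv {f : E → ℝ} {L V : ℝ} (hL : 1 ≤ L) (hV : 1 ≤ V)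
    (hf : ∀ x y, |f x - f y| ≤ L * ‖x - y‖) {x v : E} {β : ℝ} (hβ : HasLineDerivAt ℝ f β x v)
    (hv : ‖v‖ ≤ V) {T : Set E} (hT : HasSegmentsNear T x) {A : ℝ} (hA : 2048 ≤ A)
    (hbad : ∀ ρ > 0, ∃ y, ‖y‖ < ρ ∧ 2048 / A * ‖y‖ < |f (x + y) - f x|)
    {K : ℝ} (hK : 100 * √(L * (2 * V + 1)) < K) {δ : ℝ} (hδ : 0 < δ) :
    ∃ x' ∈ T, ‖x' - x‖ < δ ∧ ∃ (v' : E) (β' : ℝ), HasLineDerivAt ℝ f β' x' v' ∧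
      128 / A ^ 2 ≤ β' - β - ‖v' - v‖ ^ 2 ∧
      ∀ t : ℝ, |(f (x' + t • v) - f x') - (f (x + t • v) - f x)| ≤
        (2 * K + 9 * L + 2) * √(β' - β - ‖v' - v‖ ^ 2) * |t| := by
  have hA0 : 0 < A := by linarith
  set M := L * (2 * V + 1) with hM
  have hM1 : 1 ≤ M := by nlinarith
  have hLM : L ≤ M := by nlinarith
  have hLVM : 2 * (L * V) ≤ M := by nlinarith
  have hK0 : 0 < K := lt_of_le_of_lt (by positivity) hK
  -- With s = A‖y‖, the deviation (2048/A)‖y‖ equals 8cs. It leaves a rise of 4cs after all errors,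
  -- and c exceeds the squared direction change 81/A² by more than 128/A².
  set c := 256 / A ^ 2 with hc
  have hc0 : 0 < c := by positivity
  have hcA : c ≤ 1 / A := by
    rw [hc, div_le_div_iff₀ (by positivity) hA0]; nlinarith
  -- The pieces of the curve not known to lie in T have total parameter length 4κs = cs/M, exactly
  -- what the mean value theorem allows.
  set κ := c / (4 * M) with hκ
  have hκ0 : 0 < κ := by positivity
  have hκM : κ * M = c / 4 := by rw [hκ]; field_simp
  have hκc : κ ≤ c / 4 := by nlinarith
  have hA1 : 1 / A ≤ 1 / 2048 := one_div_le_one_div_of_le (by norm_num) hA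
  have hκ4 : κ ≤ 1 / 4 := by linarith
  -- This makes the deviation from linearity at the ends negligible even against chords of length
  -- κs, the distance kept between τ and ±s.
  set σ := κ * c / 4 with hσ
  have hσ0 : 0 < σ := by positivity
  have hσc : σ ≤ c / 4 := by rw [hσ]; nlinarith
  obtain ⟨ρ, hρ, hlin⟩ := hβ.eventually_abs_sub_le hσ0
  obtain ⟨δ₀, hδ₀, hseg⟩ := hT (κ / A / (V + 1)) (by positivity)
  -- The four bounds keep the curve within the range of linear approximation, allow segments of T to
  -- be found, keep x' within δ of x, and make ‖x' - x‖ negligible for chords of length at least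
  -- ρ/2.
  set s₀ := min (min (ρ / 4) (δ₀ / (V + 1))) (min (δ / (V + 2)) (c * ρ / (4 * L * (V + 2)))) with hs₀
  have hs₀pos : 0 < s₀ := by
    refine lt_min (lt_min ?_ ?_) (lt_min ?_ ?_) <;> positivity
  obtain ⟨y, hy, hfy⟩ := hbad (s₀ / A) (by positivity)
  have hy0 : 0 < ‖y‖ := by
    rw [norm_pos_iff]
    rintro rfl
    simp at hfy
  set s := A * ‖y‖ with hsdef
  have hs : 0 < s := by positivity
  have hss₀ : s < s₀ := by
    rw [hsdef, mul_comm]; exact (lt_div_iff₀ hA0).1 hy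
  have hs1 : s < ρ / 4 := hss₀.trans_le ((min_le_left _ _).trans (min_le_left _ _))
  have hs2 : s * (V + 1) < δ₀ := (lt_div_iff₀ (by linarith)).1
    (hss₀.trans_le ((min_le_left _ _).trans (min_le_right _ _)))
  have hs3 : s * (V + 2) < δ := (lt_div_iff₀ (by linarith)).1
    (hss₀.trans_le ((min_le_right _ _).trans (min_le_left _ _)))
  have hs4 : s * (4 * L * (V + 2)) < c * ρ := (lt_div_iff₀ (by positivity)).1
    (hss₀.trans_le ((min_le_right _ _).trans (min_le_right _ _)))
  have hyA : ‖y‖ ≤ s / A := by rw [hsdef]; field_simp; rfl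
  have hys : ‖y‖ ≤ s := hyA.trans (div_le_self hs.le (by linarith))
  have hκs : 0 < κ * s := by positivity
  have hκs4 : κ * s ≤ s / 4 := by linarith [mul_le_mul_of_nonneg_right hκ4 hs.le]
  have hδ' : 0 < s * (V + 1) := by positivity
  have herr : κ / A / (V + 1) * (s * (V + 1)) = κ / A * s := by field_simp
  have hsmul : ∀ t : ℝ, |t| ≤ s → ‖t • v‖ ≤ s * V := by
    intro t ht
    rw [norm_smul, Real.norm_eq_abs]
    gcongr
  have hsmul' : ∀ t : ℝ, |t| ≤ κ * s → ‖t • v‖ ≤ κ * s * V := by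
    intro t ht
    rw [norm_smul, Real.norm_eq_abs]
    gcongr
  have ab1 : |-s + κ * s| ≤ s := abs_le.2 ⟨by linarith, by linarith⟩
  have ab2 : |-(κ * s)| ≤ s := abs_le.2 ⟨by linarith, by linarith⟩
  have ab3 : |κ * s| ≤ s := abs_le.2 ⟨by linarith, by linarith⟩
  have ab4 : |s - κ * s| ≤ s := abs_le.2 ⟨by linarith, by linarith⟩
  obtain ⟨p₁, p₂, hp₁, hp₂, hsegL⟩ := hseg _ hδ' hs2 ((-s + κ * s) • v) ((-(κ * s)) • v + y)
    (by linarith [hsmul _ ab1])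
    (by linarith [norm_add_le ((-(κ * s)) • v) y, hsmul _ ab2])
  obtain ⟨p₃, p₄, hp₃, hp₄, hsegR⟩ := hseg _ hδ' hs2 ((κ * s) • v + y) ((s - κ * s) • v)
    (by linarith [norm_add_le ((κ * s) • v) y, hsmul _ ab3])
    (by linarith [hsmul _ ab4])
  rw [herr] at hp₁ hp₂ hp₃ hp₄
  obtain ⟨w, hwl, hwr, hwlip, hwL, hwR⟩ := exists_polygonal_displacement (y := y)
    (d₁ := p₁ - (-s + κ * s) • v) (d₂ := p₂ - (-(κ * s)) • v) (d₃ := p₃ - (κ * s) • v)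
    (d₄ := p₄ - (s - κ * s) • v) hs hκ0 hκ4 hA0 hyA hp₁ (by rwa [sub_sub]) (by rwa [sub_sub]) hp₄
  set d₁ := p₁ - (-s + κ * s) • v with hd₁
  set d₂ := p₂ - (-(κ * s)) • v with hd₂
  set d₃ := p₃ - (κ * s) • v with hd₃
  set d₄ := p₄ - (s - κ * s) • v with hd₄
  have hd₂y : ‖d₂ - y‖ ≤ κ / A * s := by rw [hd₂, sub_sub]; exact hp₂
  have hd₃y : ‖d₃ - y‖ ≤ κ / A * s := by rw [hd₃, sub_sub]; exact hp₃
  have hκA : κ / A ≤ κ := div_le_self hκ0.le (by linarith)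
  set F : ℝ → ℝ := fun t => f (x + t • v + w t) - β * t with hF
  have hβL : |β| ≤ L * V := (hβ.abs_le_of_lipschitz hf).trans (by gcongr)
  have h9A : 9 / A ≤ 1 := by rw [div_le_one hA0]; linarith
  have hFlip : LipschitzWith M.toNNReal F := by
    refine LipschitzWith.of_dist_le_mul fun t t' => ?_
    rw [Real.dist_eq, Real.dist_eq, Real.coe_toNNReal _ (by linarith)]
    have h1 := hf (x + t • v + w t) (x + t' • v + w t')
    have e1 : x + t • v + w t - (x + t' • v + w t') = (t - t') • v + (w t - w t') := by
      rw [sub_smul]; abel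
    rw [e1] at h1
    have h2 : ‖(t - t') • v + (w t - w t')‖ ≤ |t - t'| * V + 1 * |t - t'| := by
      refine norm_add_le_of_le ?_ ((hwlip t t').trans (by gcongr))
      rw [norm_smul, Real.norm_eq_abs]; gcongr
    have h3 : |β * (t - t')| ≤ L * V * |t - t'| := by rw [abs_mul]; gcongr
    have h4 : L * ‖(t - t') • v + (w t - w t')‖ ≤ L * (|t - t'| * V + 1 * |t - t'|) := by gcongr
    have h5 := abs_le.1 h1
    have h6 := abs_le.1 h3
    have e2 : M * |t - t'| = L * (|t - t'| * V + 1 * |t - t'|) + L * V * |t - t'| := by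
      rw [hM]; ring
    simp only [hF]
    rw [e2, abs_le]
    constructor <;> linarith
  have hFout : ∀ t, s ≤ |t| → |t| < ρ → |F t - f x| ≤ σ * |t| := by
    intro t ht htρ
    have h0 : w t = 0 := by
      rcases le_abs.1 ht with h | h
      · exact hwr t h
      · exact hwl t (by linarith)
    have h1 := hlin t htρ
    simp only [hF, h0, add_zero]
    convert h1 using 2
    ring
  have hFs : |F s - f x| ≤ σ * s := by
    have := hFout s (le_abs_self s) (by rw [abs_of_pos hs]; linarith)
    rwa [abs_of_pos hs] at this
  have hFs' : |F (-s) - f x| ≤ σ * s := by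
    have := hFout (-s) (by rw [abs_neg]; exact le_abs_self s)
      (by rw [abs_neg, abs_of_pos hs]; linarith)
    rwa [abs_neg, abs_of_pos hs] at this
  have hwκl : w (-(κ * s)) = d₂ := by
    rw [hwL _ (right_mem_Icc.2 (by linarith)), div_self (by linarith)]
    simp
  have hwκr : w (κ * s) = d₃ := by
    rw [hwR _ (left_mem_Icc.2 (by linarith)), sub_self, zero_div]
    simp
  have hFmid : ∀ t, |t| ≤ κ * s → ‖w t - y‖ ≤ κ / A * s →
      |F t - f (x + y)| ≤ 2 * (L * V) * (κ * s) + L * (κ * s) := by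
    intro t ht hwt
    have h1 := hf (x + t • v + w t) (x + y)
    have e1 : x + t • v + w t - (x + y) = t • v + (w t - y) := by abel
    rw [e1] at h1
    have h2 : ‖t • v + (w t - y)‖ ≤ κ * s * V + κ * s :=
      norm_add_le_of_le (hsmul' t ht) (hwt.trans (by gcongr))
    have h3 : |β * t| ≤ L * V * (κ * s) := by rw [abs_mul]; gcongr
    have h4 : L * ‖t • v + (w t - y)‖ ≤ L * (κ * s * V + κ * s) := by gcongr
    have h5 := abs_le.1 h1
    have h6 := abs_le.1 h3
    have e2 : 2 * (L * V) * (κ * s) + L * (κ * s) = L * (κ * s * V + κ * s) + L * V * (κ * s) := by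
      ring
    simp only [hF]
    rw [e2, abs_le]
    constructor <;> linarith
  have hmid : 2 * (L * V) * (κ * s) + L * (κ * s) ≤ c / 2 * s := by
    have h1 : 2 * (L * V) * (κ * s) ≤ M * (κ * s) := by gcongr
    have h2 : L * (κ * s) ≤ M * (κ * s) := by gcongr
    have h3 : M * (κ * s) = c / 4 * s := by rw [← hκM]; ring
    linarith
  have hFml := hFmid (-(κ * s)) (by rw [abs_neg, abs_of_pos hκs]) (by rw [hwκl]; exact hd₂y)
  have hFmr := hFmid (κ * s) (by rw [abs_of_pos hκs]) (by rw [hwκr]; exact hd₃y)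
  have hpeak : 8 * c * s ≤ 2048 / A * ‖y‖ := by
    have : 8 * c * s = 2048 / A * ‖y‖ := by rw [hc, hsdef]; field_simp; norm_num
    exact this.le
  have hσs : σ * s ≤ c / 4 * s := by gcongr
  have hcs : 0 < c * s := by positivity
  -- If f increases at x + y, the rise occurs on the way there; if it decreases, on the way back.
  obtain ⟨y₁, y₂, hy1, hy12, hy2, hrise⟩ : ∃ y₁ y₂, -s ≤ y₁ ∧ y₁ ≤ y₂ ∧ y₂ ≤ s ∧
      2 * c * (s - -s) ≤ F y₂ - F y₁ := by
    rcases lt_abs.1 hfy with h | h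
    · refine ⟨-s, -(κ * s), le_rfl, by linarith, by linarith, ?_⟩
      linarith [(abs_le.1 hFml).1, (abs_le.1 hFs').2]
    · refine ⟨κ * s, s, by linarith, by linarith, le_rfl, ?_⟩
      linarith [(abs_le.1 hFmr).2, (abs_le.1 hFs).1]
  set N : Set ℝ := Icc (-s) (-s + κ * s) ∪ Icc (-(κ * s)) (κ * s) ∪ Icc (s - κ * s) s with hN
  have hNm : MeasurableSet N := (measurableSet_Icc.union measurableSet_Icc).union measurableSet_Icc
  have hNvol : volume (N ∩ Icc (-s) s) ≤ ENNReal.ofReal (c * (s - -s) / (2 * M)) := by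
    calc volume (N ∩ Icc (-s) s) ≤ volume N := measure_mono inter_subset_left
      _ ≤ ENNReal.ofReal (κ * s) + ENNReal.ofReal (2 * (κ * s)) + ENNReal.ofReal (κ * s) := by
          refine (measure_union_le _ _).trans (add_le_add ((measure_union_le _ _).trans
            (add_le_add ?_ ?_)) ?_) <;> rw [Real.volume_Icc] <;> apply ENNReal.ofReal_le_ofReal <;>
            linarith
      _ = ENNReal.ofReal (c * (s - -s) / (2 * M)) := by
          rw [← ENNReal.ofReal_add (by positivity) (by positivity),
            ← ENNReal.ofReal_add (by positivity) (by positivity)]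
          congr 1
          rw [hκ]
          field_simp
          ring
  obtain ⟨τ, ⟨hτI, hτN⟩, g, hcg, hder, hchord⟩ := hFlip.exists_hasDerivAt_ge_and_chord_le
    (by linarith) (by linarith : -s < s) hc0 hNm hNvol hy1 hy12 hy2 hrise (by
      rw [abs_le]
      have h1 := abs_le.1 hFs
      have h2 := abs_le.1 hFs'
      constructor <;> linarith) hK
  have hτends : -s + κ * s < τ ∧ τ < s - κ * s := by
    constructor
    · by_contra h
      exact hτN (Or.inl (Or.inl ⟨hτI.1, not_lt.1 h⟩))
    · by_contra h
      exact hτN (Or.inr ⟨not_lt.1 h, hτI.2⟩)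
  have hτabs : |τ| ≤ s := abs_le.2 hτI
  have hpiece : x + τ • v + w τ ∈ T ∧
      ∃ v', ‖v' - v‖ ≤ 9 / A ∧ HasLineDerivAt ℝ f (g + β) (x + τ • v + w τ) v' := by
    rcases lt_or_ge τ (-(κ * s)) with h | h
    · have h1 := exists_hasLineDerivAt_of_affine_piece (by linarith) hwL hwlip ⟨hτends.1, h⟩ hder
      refine ⟨hsegL ?_, h1.2⟩
      have h2 := h1.1
      rwa [hd₁, hd₂, add_sub_cancel, add_sub_cancel] at h2
    · have h' : κ * s < τ := by
        by_contra h'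
        exact hτN (Or.inl (Or.inr ⟨h, not_lt.1 h'⟩))
      have h1 := exists_hasLineDerivAt_of_affine_piece (by linarith) hwR hwlip ⟨h', hτends.2⟩ hder
      refine ⟨hsegR ?_, h1.2⟩
      have h2 := h1.1
      rwa [hd₃, hd₄, add_sub_cancel, add_sub_cancel] at h2
  obtain ⟨hxT, v', hv', hd'⟩ := hpiece
  set x' := x + τ • v + w τ with hx'
  have hwτ : ‖w τ‖ ≤ 2 * s := by
    have h1 := hwlip τ s
    rw [hwr s le_rfl, sub_zero] at h1
    have h2 : |τ - s| ≤ 2 * s := abs_le.2 ⟨by linarith [hτI.1], by linarith [hτI.2]⟩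
    calc ‖w τ‖ ≤ 9 / A * |τ - s| := h1
      _ ≤ 1 * (2 * s) := by gcongr
      _ = _ := one_mul _
  have hxx' : ‖x' - x‖ ≤ s * (V + 2) := by
    have e1 : x' - x = τ • v + w τ := by rw [hx']; abel
    rw [e1]
    refine (norm_add_le_of_le (hsmul τ hτabs) hwτ).trans (le_of_eq ?_)
    ring
  have hvsq : ‖v' - v‖ ^ 2 ≤ 128 / A ^ 2 := by
    calc ‖v' - v‖ ^ 2 ≤ (9 / A) ^ 2 := by gcongr
      _ = 81 / A ^ 2 := by rw [div_pow]; norm_num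
      _ ≤ 128 / A ^ 2 := by gcongr; norm_num
  have hgc : 256 / A ^ 2 ≤ g := hcg
  set G := g + β - β - ‖v' - v‖ ^ 2 with hG
  have hAA : 256 / A ^ 2 = 2 * (128 / A ^ 2) := by ring
  have hG1 : 128 / A ^ 2 ≤ G := by rw [hG]; linarith
  have hG2 : g ≤ 2 * G := by rw [hG]; linarith
  have hG0 : 0 ≤ G := le_trans (by positivity) hG1
  -- Since G is at least of order 1/A², errors of size 1/A, in particular the bend of the curve and
  -- c, are absorbed by √G.
  have hsqA : 1 / A ≤ √G := by
    refine Real.le_sqrt_of_sq_le (le_trans ?_ hG1)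
    rw [div_pow, one_pow]
    gcongr
    norm_num
  have hsqc : c ≤ √G := hcA.trans hsqA
  have hsqg : √g ≤ 2 * √G := by
    refine Real.sqrt_le_iff.2 ⟨by positivity, ?_⟩
    rw [mul_pow, Real.sq_sqrt hG0]
    linarith
  refine ⟨x', hxT, by linarith, v', g + β, hd', hG1, fun t => ?_⟩
  have htn := abs_nonneg t
  rcases lt_or_ge |t| (ρ / 2) with ht | ht
  · have k1 : |F (τ + t) - F τ| ≤ (K * √g + c) * |t| := by
      -- When τ + t leaves the interval, one passes through the endpoint z in between: the chord
      -- bound applies up to z, and beyond it F is flat up to σ. Since |t| ≥ κs, this error is at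
      -- most c|t|.
      by_cases hin : τ + t ∈ Icc (-s) s
      · have h1 := hchord _ hin
        rw [add_sub_cancel_left] at h1
        refine h1.trans (mul_le_mul_of_nonneg_right ?_ htn)
        linarith
      · obtain ⟨z, hz, hzτ, hzs, hzF⟩ : ∃ z ∈ Icc (-s) s, |z - τ| ≤ |t| ∧ κ * s ≤ |t| ∧
            |F z - f x| ≤ σ * s := by
          rw [mem_Icc, not_and_or, not_le, not_le] at hin
          rcases hin with h | h
          · refine ⟨-s, left_mem_Icc.2 (by linarith), ?_, ?_, hFs'⟩
            · rw [abs_sub_comm, abs_of_nonneg (by linarith [hτI.1])]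
              linarith [neg_abs_le t]
            · linarith [neg_abs_le t]
          · refine ⟨s, right_mem_Icc.2 (by linarith), ?_, ?_, hFs⟩
            · rw [abs_of_nonneg (by linarith [hτI.2])]
              linarith [le_abs_self t]
            · linarith [le_abs_self t]
        have h1 := hchord z hz
        have h2 : K * √g * |z - τ| ≤ K * √g * |t| := by gcongr
        have h3 : |τ + t| ≤ s + |t| := (abs_add_le _ _).trans (by linarith)
        have h4 : |F (τ + t) - f x| ≤ σ * (s + |t|) := by
          refine (hFout (τ + t) ?_ (by linarith)).trans (by gcongr)
          by_contra hlt
          exact hin (abs_le.1 (not_le.1 hlt).le)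
        have h5 : σ * (2 * s + |t|) ≤ c * |t| := by
          have e1 : σ * (2 * s) = c / 2 * (κ * s) := by rw [hσ]; ring
          have e2 : c / 2 * (κ * s) ≤ c / 2 * |t| := by gcongr
          have e3 : σ * |t| ≤ c / 4 * |t| := by gcongr
          have e4 : 0 ≤ c * |t| := by positivity
          linarith
        have h6 := abs_le.1 (h1.trans h2)
        have h7 := abs_le.1 h4
        have h8 := abs_le.1 hzF
        have e5 : (K * √g + c) * |t| = K * √g * |t| + c * |t| := by ring
        rw [e5, abs_le]
        constructor <;> linarith
    have k2 : |f (x' + t • v) - f (x + (τ + t) • v + w (τ + t))| ≤ 9 * L * √G * |t| := by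
      refine (hf _ _).trans ?_
      have e1 : x' + t • v - (x + (τ + t) • v + w (τ + t)) = w τ - w (τ + t) := by
        rw [hx', add_smul]; abel
      rw [e1]
      have h1 := hwlip τ (τ + t)
      rw [sub_add_cancel_left, abs_neg] at h1
      calc L * ‖w τ - w (τ + t)‖ ≤ L * (9 / A * |t|) := by gcongr
        _ = 9 * L * (1 / A) * |t| := by ring
        _ ≤ _ := by gcongr
    have k3 : |f (x + t • v) - f x - t * β| ≤ √G * |t| := by
      refine (hlin t (by linarith)).trans ?_
      gcongr
      linarith
    have k4 : (K * √g + c) * |t| ≤ (2 * K + 1) * √G * |t| := by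
      refine mul_le_mul_of_nonneg_right ?_ htn
      calc K * √g + c ≤ K * (2 * √G) + √G := by gcongr
        _ = (2 * K + 1) * √G := by ring
    have e6 : (2 * K + 9 * L + 2) * √G * |t| =
      (2 * K + 1) * √G * |t| + 9 * L * √G * |t| + √G * |t| := by ring
    have j1 := abs_le.1 (k1.trans k4)
    have j2 := abs_le.1 k2
    have j3 := abs_le.1 k3
    simp only [hF] at j1
    rw [← hx'] at j1
    rw [e6, abs_le]
    constructor <;> linarith
  · have h1 := hf (x' + t • v) (x + t • v)
    have h2 := hf x' x
    rw [add_sub_add_right_eq_sub] at h1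
    have h3 : L * ‖x' - x‖ ≤ L * (s * (V + 2)) := by gcongr
    have h4 : 2 * (L * (s * (V + 2))) ≤ √G * |t| := by
      calc 2 * (L * (s * (V + 2))) ≤ c * (ρ / 2) := by linarith
        _ ≤ √G * |t| := by gcongr
    have h5 : √G * |t| ≤ (2 * K + 9 * L + 2) * √G * |t| := by
      refine mul_le_mul_of_nonneg_right (le_mul_of_one_le_left (Real.sqrt_nonneg _) ?_) htn
      linarith
    have j1 := abs_le.1 h1
    have j2 := abs_le.1 h2
    refine le_trans ?_ h5
    rw [abs_le]
    constructor <;> linarith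

end

/-! ### From almost maximality to differentiability. -/

section

variable {E : Type*} [NormedAddCommGroup E] [InnerProductSpace ℝ E]

theorem HasLineDerivAt.sub_inner {f : E → ℝ} {β : ℝ} {x v : E} (h : HasLineDerivAt ℝ f β x v)
    (p : E) : HasLineDerivAt ℝ (fun z => f z - ⟪p, z⟫_ℝ) (β - ⟪p, v⟫_ℝ) x v :=
  HasDerivAt.sub h (((innerSL ℝ p).hasFDerivAt (x := x)).hasLineDerivAt v)

theorem HasLineDerivAt.of_sub_inner {f : E → ℝ} {β : ℝ} {x v p : E}
    (h : HasLineDerivAt ℝ (fun z => f z - ⟪p, z⟫_ℝ) β x v) :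
    HasLineDerivAt ℝ f (β + ⟪p, v⟫_ℝ) x v := by
  have := h.sub_inner (-p)
  simpa using this

/-- Let `U q` be a monotone family of closed sets such that `U q` contains segments close to any
small segment near a point of `U p`, `p < q`. Then every Lipschitz function has points of
differentiability in the union of the `U q`, `q < 1`, close to any given point of this union. -/
theorem exists_differentiableAt_of_hasSegmentsNear [CompleteSpace E] {U : ℝ → Set E}
    (hmono : ∀ p q, p ≤ q → U p ⊆ U q) (hclosed : ∀ q, IsClosed (U q))
    (hseg : ∀ p q x, 0 ≤ p → p < q → q < 1 → x ∈ U p → HasSegmentsNear (U q) x)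
    {f : E → ℝ} {C : ℝ≥0} (hf : LipschitzWith C f) {q₀ : ℝ} {x₀ : E} (hx₀ : x₀ ∈ U q₀)
    (h0 : 0 ≤ q₀) (h1 : q₀ < 1) {r : ℝ} (hr : 0 < r) :
    ∃ x q, 0 ≤ q ∧ q < 1 ∧ x ∈ U q ∧ ‖x - x₀‖ ≤ r ∧ DifferentiableAt ℝ f x := by
  set L : ℝ := max C 1 with hL
  have hL1 : 1 ≤ L := le_max_right _ _
  have hfL : ∀ x y, |f x - f y| ≤ L * ‖x - y‖ := by
    intro x y
    have := hf.dist_le_mul x y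
    rw [Real.dist_eq, dist_eq_norm] at this
    exact this.trans (by gcongr; exact le_max_left _ _)
  -- The function to be bent is f - ⟪p, ·⟫, with Lipschitz constant L + 6L = 7L, and directions have
  -- norm at most 2L. The constant K of the search is chosen so that K/2 is the chord constant
  -- obtained for this function.
  set K₁ := 100 * √(7 * L * (2 * (2 * L) + 1)) + 1 with hK₁
  have hK₁0 : 0 ≤ K₁ := by positivity
  obtain ⟨x, v, β, q, hxr, hq0, hq1, hxU, hd, hv, hmax⟩ :=
    AscentStage.exists_almost_maximal_lineDeriv (K := 2 * (2 * K₁ + 9 * (7 * L) + 2)) hmono hclosed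
      hL1 (by linarith) hfL hx₀ h0 h1 hr
  refine ⟨x, q, hq0, hq1, hxU, hxr, differentiableAt_of_forall_exists_approx fun η hη => ?_⟩
  set A := max 2048 (2048 / η) with hA
  have hA1 : 2048 ≤ A := le_max_left _ _
  have hA0 : 0 < A := by linarith
  have hAη : 2048 / A ≤ η := by
    rw [div_le_iff₀ hA0, mul_comm, ← div_le_iff₀ hη]
    exact le_max_right _ _
  obtain ⟨p, hp, δ, hδ, q', hqq', hq'1, hno⟩ := hmax (128 / A ^ 2) (by positivity)
  refine ⟨p, ?_⟩
  by_contra hcon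
  have hfL' : ∀ x y, |(f x - ⟪p, x⟫_ℝ) - (f y - ⟪p, y⟫_ℝ)| ≤ 7 * L * ‖x - y‖ := by
    intro x y
    have e1 := abs_le.1 (hfL x y)
    have e2 : |⟪p, x - y⟫_ℝ| ≤ 6 * L * ‖x - y‖ :=
      (abs_real_inner_le_norm _ _).trans (by gcongr)
    rw [inner_sub_right] at e2
    have e3 := abs_le.1 e2
    rw [abs_le]
    constructor <;> linarith
  have hbad : ∀ ρ > 0, ∃ y, ‖y‖ < ρ ∧
      2048 / A * ‖y‖ < |(f (x + y) - ⟪p, x + y⟫_ℝ) - (f x - ⟪p, x⟫_ℝ)| := by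
    intro ρ hρ
    by_contra h
    push Not at h
    refine hcon (Metric.eventually_nhds_iff.2 ⟨ρ, hρ, fun y hy => ?_⟩)
    rw [dist_zero_right] at hy
    have e1 := h y hy
    rw [inner_add_right] at e1
    have e2 : f (x + y) - f x - ⟪p, y⟫_ℝ = f (x + y) - (⟪p, x⟫_ℝ + ⟪p, y⟫_ℝ) - (f x - ⟪p, x⟫_ℝ) := by
      ring
    rw [e2]
    exact e1.trans (by gcongr)
  obtain ⟨x', hx'U, hx'δ, v', β', hd', hg, hchord⟩ :=
    (hseg q q' x hq0 hqq' hq'1 hxU).exists_larger_lineDeriv (by linarith) (by linarith) hfL'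
      (hd.sub_inner p) hv hA1 hbad (show _ < K₁ by rw [hK₁]; linarith) hδ
  -- Returning to f, the gain for f - ⟪p, ·⟫ becomes precisely the quantity that near maximality
  -- forbids to be large.
  have e1 : β' - (β - ⟪p, v⟫_ℝ) - ‖v' - v‖ ^ 2 =
      β' + ⟪p, v'⟫_ℝ - β - ⟪p, v' - v⟫_ℝ - ‖v' - v‖ ^ 2 := by rw [inner_sub_right]; ring
  rw [e1] at hg hchord
  refine hno x' hx'U hx'δ v' (β' + ⟪p, v'⟫_ℝ) hd'.of_sub_inner hg fun t => ?_
  have e2 := hchord t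
  have e3 : 2 * (2 * K₁ + 9 * (7 * L) + 2) / 2 = 2 * K₁ + 9 * (7 * L) + 2 := by ring
  rw [e3]
  convert e2 using 2
  rw [inner_add_right, inner_add_right]
  ring

end

end

/-! ### Geometry of the line families. -/

noncomputable section

theorem IsMaximalSeparatedIn.exists_dist_le {X : Type*} [PseudoMetricSpace X] {ε : ℝ} (hε : 0 ≤ ε)
    {A T : Set X} (h : IsMaximalSeparatedIn ε A T) {y : X} (hy : y ∈ A) :
    ∃ c ∈ T, dist c y ≤ ε := by
  by_contra hcon
  push Not at hcon
  have hsep : Metric.IsSeparated (ENNReal.ofReal ε) (insert y T) := by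
    refine Set.pairwise_insert.2 ⟨h.prop.2, fun b hb _ => ?_⟩
    have hb' : ENNReal.ofReal ε < edist b y := by
      rw [edist_dist, ENNReal.ofReal_lt_ofReal_iff (lt_of_le_of_lt hε (hcon b hb))]
      exact hcon b hb
    exact ⟨by rwa [edist_comm], hb'⟩
  have hyT : y ∈ T := h.le_of_ge ⟨insert_subset hy h.prop.1, hsep⟩ (subset_insert y T)
    (mem_insert y T)
  have := hcon y hyT
  rw [dist_self] at this
  linarith

theorem mem_closedNhd {X : Type*} [PseudoMetricSpace X] {w : ℝ} {A : Set X} {z : X} :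
    z ∈ closedNhd w A ↔ ∃ x ∈ A, dist z x ≤ w := by
  simp [closedNhd]

namespace SegmentScheme

variable {d : ℕ} (D : SegmentScheme d)

local notation "𝔼" => EuclideanSpace ℝ (Fin d)

theorem Q_pos : 0 < D.Q := zero_lt_one.trans D.one_lt_Q

theorem width_pos (k : ℕ) : 0 < D.width k := by
  have := D.Q_pos
  unfold width
  induction k with
  | zero => rw [tubeWidth]; positivity
  | succ k ih => rw [tubeWidth]; positivity

theorem pow_mul_width_succ (k : ℕ) : D.Q ^ D.s (k + 1) * D.width (k + 1) = D.width k := by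
  have := D.Q_pos
  unfold width
  rw [tubeWidth, mul_inv_cancel_left₀ (by positivity)]

theorem three_le_s (k : ℕ) : 3 ≤ D.s k := (D.three_le_M k).trans (D.M_le_s k)

theorem three_le_s_real (k : ℕ) : (3 : ℝ) ≤ D.s k := by exact_mod_cast D.three_le_s k

theorem width_succ_le (k : ℕ) : D.width (k + 1) ≤ D.width k := by
  rw [← D.pow_mul_width_succ k]
  exact le_mul_of_one_le_left (D.width_pos _).le (one_le_pow₀ D.one_lt_Q.le)

theorem width_antitone : Antitone D.width := antitone_nat_of_succ_le D.width_succ_le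

theorem norm_of_mem_dirs {k : ℕ} {e : 𝔼} (he : e ∈ D.dirs k) : ‖e‖ = 1 := by
  simpa using (D.dirs_maximal k).prop.1 he

theorem exists_dir_near (k : ℕ) (v : 𝔼) : ∃ e ∈ D.dirs k, ‖‖v‖ • e - v‖ ≤ ‖v‖ / D.s k := by
  have key : ∀ u : 𝔼, ‖u‖ = 1 → ∃ e ∈ D.dirs k, ‖e - u‖ ≤ 1 / D.s k := by
    intro u hu
    obtain ⟨e, he, h⟩ := (D.dirs_maximal k).exists_dist_le (by positivity)
      (show u ∈ Metric.sphere (0 : 𝔼) 1 by simpa using hu)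
    exact ⟨e, he, by rwa [dist_eq_norm] at h⟩
  rcases eq_or_ne v 0 with rfl | hv
  -- Even the zero vector needs some direction; the unit vector a - b shows that the sphere is
  -- nonempty.
  · obtain ⟨e, he, -⟩ := key (D.a - D.b) (by rw [← dist_eq_norm, D.dist_a_b])
    exact ⟨e, he, by simp⟩
  · have hv' : 0 < ‖v‖ := norm_pos_iff.2 hv
    obtain ⟨e, he, h⟩ := key (‖v‖⁻¹ • v) (by rw [norm_smul]; simp [hv'.ne'])
    refine ⟨e, he, ?_⟩
    have h1 : ‖v‖ • e - v = ‖v‖ • (e - ‖v‖⁻¹ • v) := by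
      rw [smul_sub, smul_inv_smul₀ hv'.ne']
    rw [h1, norm_smul, norm_norm, div_eq_mul_one_div]
    gcongr

/-- The index `j` may be added to the category `J` of level `k`. -/
structure IsAdmissible (k j : ℕ) (J : List ℕ) : Prop where
  one_le : 1 ≤ j
  le_s : j ≤ D.s k
  pairwise : J.Pairwise (· ≤ ·)
  le_mem : ∀ i ∈ J, j ≤ i ∧ i ≤ D.s k

variable {D} in
theorem IsAdmissible.cons {k j : ℕ} {J : List ℕ} (h : D.IsAdmissible k j J) :
    D.IsAdmissible k j (j :: J) := by
  refine ⟨h.one_le, h.le_s, List.pairwise_cons.2 ⟨fun i hi => (h.le_mem i hi).1, h.pairwise⟩, ?_⟩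
  intro i hi
  rcases List.mem_cons.1 hi with rfl | hi
  · exact ⟨le_rfl, h.le_s⟩
  · exact h.le_mem i hi

variable {D} in
theorem IsAdmissible.isCategory {k j : ℕ} {J : List ℕ} (h : D.IsAdmissible k j J) :
    D.IsCategory k J.length J :=
  ⟨rfl, h.pairwise, fun i hi => ⟨h.one_le.trans (h.le_mem i hi).1, (h.le_mem i hi).2⟩⟩

/-- The segments of the collection `L₀` are long enough to serve as lines of class `0` for
level `k`. -/
def IsBase (k : ℕ) (L₀ : Set (Set 𝔼)) : Prop :=
  ∀ l ∈ L₀, ∃ x y : 𝔼, l = segment ℝ x y ∧ D.Q ^ D.s k * D.width k ≤ dist x y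

theorem dist_newLine {e : 𝔼} (he : ‖e‖ = 1) {c : ℝ} (hc : 0 ≤ c) (x : 𝔼) :
    dist (x - c • e) (x + c • e) = 2 * c := by
  rw [dist_eq_norm, show x - c • e - (x + c • e) = (-(2 * c)) • e by module, norm_smul, he,
    Real.norm_eq_abs, abs_neg, abs_of_nonneg (by positivity), mul_one]

variable {D} in
-- Indices do not increase along a category, so a line that is to carry lines of index j was itself
-- built with an index i ≥ j, or belongs to class 0 and is longer still. Thus the nets are only used
-- on segments long enough for their maximality.
theorem IsBase.exists_eq_segment {k : ℕ} {L₀ : Set (Set 𝔼)} (hL₀ : D.IsBase k L₀) {j : ℕ}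
    {J : List ℕ} (hJ : D.IsAdmissible k j J) {l : Set 𝔼} (hl : l ∈ D.categoryLines k L₀ J) :
    ∃ x y : 𝔼, l = segment ℝ x y ∧ D.Q ^ j * D.width k ≤ dist x y := by
  have hw := D.width_pos k
  have hQ := D.one_lt_Q
  cases J with
  | nil =>
    obtain ⟨x, y, rfl, h⟩ := hL₀ l hl
    refine ⟨x, y, rfl, le_trans ?_ h⟩
    gcongr
    · exact hQ.le
    · exact hJ.le_s
  | cons i J =>
    simp only [categoryLines, mem_iUnion, newLines] at hl
    obtain ⟨l', -, e, he, x, -, rfl⟩ := hl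
    have hQi : 0 ≤ D.Q ^ i * D.width k := by have := D.Q_pos; positivity
    refine ⟨_, _, rfl, ?_⟩
    rw [dist_newLine (D.norm_of_mem_dirs he) hQi]
    have : D.Q ^ j * D.width k ≤ D.Q ^ i * D.width k := by
      gcongr
      · exact hQ.le
      · exact (hJ.le_mem i (by simp)).1
    linarith

variable {D} in
theorem IsBase.net_maximal {k : ℕ} {L₀ : Set (Set 𝔼)} (hL₀ : D.IsBase k L₀) {j : ℕ}
    {J : List ℕ} (hJ : D.IsAdmissible k j J) {l : Set 𝔼} (hl : l ∈ D.categoryLines k L₀ J)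
    {e : 𝔼} (he : e ∈ D.dirs k) :
    IsMaximalSeparatedIn (D.Q ^ j * D.width k / D.s k) l (D.net k l j e) := by
  obtain ⟨x, y, rfl, h⟩ := hL₀.exists_eq_segment hJ hl
  refine D.net_maximal k x y j e hJ.one_le ((D.dirs_maximal k).prop.1 he) (le_trans ?_ h)
  have := D.Q_pos
  have := D.width_pos k
  exact div_le_self (by positivity) (by linarith [D.three_le_s_real k])

variable {D} in
/-- On every line there is a centre of a new line near any given point. -/
theorem IsBase.exists_newLine {k : ℕ} {L₀ : Set (Set 𝔼)} (hL₀ : D.IsBase k L₀) {j : ℕ}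
    {J : List ℕ} (hJ : D.IsAdmissible k j J) {l : Set 𝔼} (hl : l ∈ D.categoryLines k L₀ J)
    {e : 𝔼} (he : e ∈ D.dirs k) {y : 𝔼} (hy : y ∈ l) :
    ∃ c ∈ l, ‖c - y‖ ≤ D.Q ^ j * D.width k / D.s k ∧
      segment ℝ (c - (D.Q ^ j * D.width k) • e) (c + (D.Q ^ j * D.width k) • e) ∈
        D.categoryLines k L₀ (j :: J) := by
  have hmax := hL₀.net_maximal hJ hl he
  have := D.Q_pos
  have := D.width_pos k
  obtain ⟨c, hc, h⟩ := hmax.exists_dist_le (by positivity) hy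
  refine ⟨c, hmax.prop.1 hc, by rwa [dist_eq_norm] at h, ?_⟩
  simp only [categoryLines, mem_iUnion]
  exact ⟨l, hl, e, he, c, hc, rfl⟩

theorem add_smul_mem_newLine {c e : 𝔼} {ℓ t : ℝ} (hℓ : 0 < ℓ) (h : |t| ≤ ℓ) :
    c + t • e ∈ segment ℝ (c - ℓ • e) (c + ℓ • e) := by
  rw [segment_eq_image']
  have h' := abs_le.1 h
  refine ⟨(t + ℓ) / (2 * ℓ), ⟨div_nonneg (by linarith) (by linarith),
    (div_le_one (by linarith)).2 (by linarith)⟩, ?_⟩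
  have h1 : c + ℓ • e - (c - ℓ • e) = (2 * ℓ) • e := by module
  simp only [h1, smul_smul]
  rw [div_mul_cancel₀ _ (by positivity)]
  module

theorem exists_eq_add_smul_of_mem_newLine {c e z : 𝔼} {ℓ : ℝ} (hℓ : 0 ≤ ℓ)
    (h : z ∈ segment ℝ (c - ℓ • e) (c + ℓ • e)) : ∃ t : ℝ, |t| ≤ ℓ ∧ z = c + t • e := by
  rw [segment_eq_image'] at h
  obtain ⟨θ, ⟨h0, h1⟩, rfl⟩ := h
  refine ⟨2 * ℓ * θ - ℓ, abs_le.2 ⟨by nlinarith, by nlinarith⟩, ?_⟩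
  have h1 : c + ℓ • e - (c - ℓ • e) = (2 * ℓ) • e := by module
  simp only [h1]
  module

variable {D} in
/-- Chains of lines of the same direction and the same length cover long segments. -/
theorem IsBase.exists_line_of_chain {k : ℕ} {L₀ : Set (Set 𝔼)} (hL₀ : D.IsBase k L₀) {j : ℕ}
    (hs : 1 / D.Q ≤ 1 - 1 / (D.s k : ℝ)) {e : 𝔼} (he : e ∈ D.dirs k) (n : ℕ) :
    ∀ (J : List ℕ), D.IsAdmissible k j J → ∀ c : 𝔼,
      segment ℝ (c - (D.Q ^ j * D.width k) • e) (c + (D.Q ^ j * D.width k) • e) ∈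
        D.categoryLines k L₀ (j :: J) → ∀ t, 0 ≤ t → t ≤ n * (D.Q ^ j * D.width k / D.Q) →
      ∃ J', D.IsAdmissible k j J' ∧ J'.length ≤ J.length + 1 + n ∧
        ∃ l ∈ D.categoryLines k L₀ J', c + t • e ∈ l := by
  have hQ := D.Q_pos
  have hw := D.width_pos k
  set ℓ := D.Q ^ j * D.width k with hℓdef
  have hℓ : 0 < ℓ := by positivity
  have he1 := D.norm_of_mem_dirs he
  induction n with
  | zero =>
    intro J hJ c hc t ht0 ht
    refine ⟨j :: J, hJ.cons, by simp, _, hc, add_smul_mem_newLine hℓ ?_⟩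
    rw [abs_of_nonneg ht0]
    rw [Nat.cast_zero, zero_mul] at ht
    linarith
  | succ n ih =>
    intro J hJ c hc t ht0 ht
    rcases le_or_gt t ℓ with htℓ | htℓ
    · refine ⟨j :: J, hJ.cons, by simp only [List.length_cons]; omega, _, hc,
        add_smul_mem_newLine hℓ (by rwa [abs_of_nonneg ht0])⟩
    · obtain ⟨c', hc', hcc', hl'⟩ := hL₀.exists_newLine hJ.cons hc he
        (add_smul_mem_newLine (c := c) (e := e) hℓ (abs_of_pos hℓ).le)
      obtain ⟨b, hb, rfl⟩ := exists_eq_add_smul_of_mem_newLine hℓ.le hc'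
      rw [add_sub_add_left_eq_sub, ← sub_smul, norm_smul, he1, mul_one, Real.norm_eq_abs] at hcc'
      have hb1 := (abs_le.1 hb).2
      -- The next centre lies within ℓ/s of the far end of the current line, and 1 - 1/s ≥ 1/Q, so
      -- each link of the chain advances by at least ℓ/Q.
      have hb2 : ℓ / D.Q ≤ b := by
        have h1 := (abs_le.1 hcc').1
        have h2 : ℓ * (1 / D.Q) ≤ ℓ * (1 - 1 / (D.s k : ℝ)) := by gcongr
        rw [mul_one_div, mul_sub, mul_one, mul_one_div] at h2
        linarith
      obtain ⟨J', hJ', hlen, l, hl, hmem⟩ := ih (j :: J) hJ.cons (c + b • e) hl' (t - b)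
        (by linarith) (by push_cast at ht; linarith)
      refine ⟨J', hJ', by simp only [List.length_cons] at hlen; omega, l, hl, ?_⟩
      convert hmem using 1
      module

variable {D} in
/-- From a point `y` of a line one can go along new lines in the direction of a given vector. -/
theorem IsBase.exists_path {k : ℕ} {L₀ : Set (Set 𝔼)} (hL₀ : D.IsBase k L₀) {j : ℕ}
    (hs : 1 / D.Q ≤ 1 - 1 / (D.s k : ℝ)) {J : List ℕ} (hJ : D.IsAdmissible k j J) {l : Set 𝔼}
    (hl : l ∈ D.categoryLines k L₀ J) {y : 𝔼} (hy : y ∈ l) {n : ℕ} {v : 𝔼}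
    (hv : ‖v‖ ≤ n * (D.Q ^ j * D.width k / D.Q)) :
    ∃ e y₀ : 𝔼, ‖y₀ - y‖ ≤ D.Q ^ j * D.width k / D.s k ∧ ‖‖v‖ • e - v‖ ≤ ‖v‖ / D.s k ∧
      ∀ t, 0 ≤ t → t ≤ ‖v‖ → ∃ J', D.IsAdmissible k j J' ∧ J'.length ≤ J.length + 1 + n ∧
        ∃ l' ∈ D.categoryLines k L₀ J', y₀ + t • e ∈ l' := by
  obtain ⟨e, he, hev⟩ := D.exists_dir_near k v
  obtain ⟨c, -, hcy, hl'⟩ := hL₀.exists_newLine hJ hl he hy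
  exact ⟨e, c, hcy, hev, fun t ht0 ht =>
    hL₀.exists_line_of_chain hs he n J hJ c hl' t ht0 (ht.trans hv)⟩

variable {D} in
theorem IsBase.exists_line_near {k : ℕ} {L₀ : Set (Set 𝔼)} (hL₀ : D.IsBase k L₀) {j : ℕ}
    (hs : 1 / D.Q ≤ 1 - 1 / (D.s k : ℝ)) {J : List ℕ} (hJ : D.IsAdmissible k j J) {l : Set 𝔼}
    (hl : l ∈ D.categoryLines k L₀ J) {y : 𝔼} (hy : y ∈ l) {n : ℕ} {v : 𝔼}
    (hv : ‖v‖ ≤ n * (D.Q ^ j * D.width k / D.Q)) :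
    ∃ J', D.IsAdmissible k j J' ∧ J'.length ≤ J.length + 1 + n ∧
      ∃ l' ∈ D.categoryLines k L₀ J', ∃ y' ∈ l',
        ‖y' - (y + v)‖ ≤ (D.Q ^ j * D.width k + ‖v‖) / D.s k := by
  obtain ⟨e, y₀, h1, h2, h3⟩ := hL₀.exists_path hs hJ hl hy hv
  obtain ⟨J', hJ', hlen, l', hl', hmem⟩ := h3 ‖v‖ (norm_nonneg _) le_rfl
  refine ⟨J', hJ', hlen, l', hl', _, hmem, ?_⟩
  rw [show y₀ + ‖v‖ • e - (y + v) = (y₀ - y) + (‖v‖ • e - v) by abel, add_div]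
  exact norm_add_le_of_le h1 h2

variable {D} in
/-- Points of a line of arbitrary category are close to lines all of whose indices are at
least `j`. -/
theorem IsBase.exists_admissible_line {k : ℕ} {L₀ : Set (Set 𝔼)} (hL₀ : D.IsBase k L₀) {j : ℕ}
    (hj : 1 ≤ j) (hjs : j ≤ D.s k) : ∀ (J : List ℕ), J.Pairwise (· ≤ ·) →
    (∀ i ∈ J, 1 ≤ i ∧ i ≤ D.s k) → ∀ l ∈ D.categoryLines k L₀ J, ∀ z ∈ l,
    ∃ (J' : List ℕ) (n : ℕ), D.IsAdmissible k j J' ∧ J'.length + n = J.length ∧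
      ∃ l' ∈ D.categoryLines k L₀ J', ∃ y ∈ l', ‖z - y‖ ≤ n * (D.Q ^ j * D.width k / D.Q) := by
  intro J
  induction J with
  | nil =>
    intro _ _ l hl z hz
    exact ⟨[], 0, ⟨hj, hjs, List.Pairwise.nil, by simp⟩, rfl, l, hl, z, hz, by simp⟩
  | cons i J ih =>
    intro hp hm l hl z hz
    have hp' := List.pairwise_cons.1 hp
    rcases le_or_gt j i with hji | hji
    · refine ⟨i :: J, 0, ⟨hj, hjs, hp, fun a ha => ⟨?_, (hm a ha).2⟩⟩, rfl, l, hl, z, hz, by simp⟩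
      rcases List.mem_cons.1 ha with rfl | ha
      · exact hji
      · exact hji.trans (hp'.1 a ha)
    · have hw := D.width_pos k
      have hQ := D.Q_pos
      simp only [categoryLines, mem_iUnion, newLines] at hl
      obtain ⟨l₁, hl₁, e, he, c, hc, rfl⟩ := hl
      have hm' : ∀ a ∈ J, 1 ≤ a ∧ a ≤ D.s k := fun a ha => hm a (List.mem_cons_of_mem _ ha)
      have hadm : D.IsAdmissible k i J := ⟨(hm i (by simp)).1, (hm i (by simp)).2, hp'.2,
        fun a ha => ⟨hp'.1 a ha, (hm' a ha).2⟩⟩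
      have hcl : c ∈ l₁ := (hL₀.net_maximal hadm hl₁ he).prop.1 hc
      obtain ⟨t, ht, rfl⟩ := exists_eq_add_smul_of_mem_newLine (by positivity) hz
      obtain ⟨J', n, hJ', hlen, l', hl', y, hy, hdist⟩ := ih hp'.2 hm' l₁ hl₁ c hcl
      refine ⟨J', n + 1, hJ', by rw [List.length_cons, ← hlen]; ring, l', hl', y, hy, ?_⟩
      -- A line of index i < j has half-length at most ℓ/Q, so discarding it costs no more distance
      -- than one link of a chain of index j covers.
      have h1 : ‖t • e‖ ≤ D.Q ^ j * D.width k / D.Q := by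
        rw [norm_smul, D.norm_of_mem_dirs he, mul_one, Real.norm_eq_abs]
        refine ht.trans ?_
        rw [le_div_iff₀ hQ]
        calc D.Q ^ i * D.width k * D.Q = D.Q ^ (i + 1) * D.width k := by rw [pow_succ]; ring
          _ ≤ D.Q ^ j * D.width k := by
            gcongr
            · exact D.one_lt_Q.le
            · omega
      rw [show c + t • e - y = (c - y) + t • e by abel]
      refine (norm_add_le_of_le hdist h1).trans (le_of_eq ?_)
      push_cast
      ring

theorem levelLines_subset_succ (k : ℕ) : D.levelLines k ⊆ D.levelLines (k + 1) := by
  intro l hl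
  simp only [levelLines, mem_iUnion, classLinesOver]
  exact ⟨0, Nat.zero_le _, [], ⟨rfl, List.Pairwise.nil, by simp⟩, hl⟩

theorem levelLines_mono : Monotone D.levelLines := monotone_nat_of_le_succ D.levelLines_subset_succ

theorem mem_classLines_succ {k m : ℕ} {l : Set 𝔼} : l ∈ D.classLines (k + 1) m ↔
    ∃ J, D.IsCategory (k + 1) m J ∧ l ∈ D.categoryLines (k + 1) (D.levelLines k) J := by
  simp [classLines, classLinesOver]

theorem mem_classLines_zero_of_mem_levelLines {k : ℕ} {l : Set 𝔼} (h : l ∈ D.levelLines k) :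
    l ∈ D.classLines (k + 1) 0 :=
  D.mem_classLines_succ.2 ⟨[], ⟨rfl, List.Pairwise.nil, by simp⟩, h⟩

theorem mem_levelLines_succ_of_mem_classLines {k m : ℕ} (hm : m ≤ D.M (k + 1)) {l : Set 𝔼}
    (h : l ∈ D.classLines (k + 1) m) : l ∈ D.levelLines (k + 1) := by
  simp only [levelLines, mem_iUnion]
  exact ⟨m, hm, h⟩

theorem classLines_subset_levelLines {k m : ℕ} (hm : m ≤ D.M k) :
    D.classLines k m ⊆ D.levelLines k := by
  intro l hl
  cases k with
  | zero =>
    cases m with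
    | zero => exact hl
    | succ m => exact absurd hl (notMem_empty _)
  | succ k => exact D.mem_levelLines_succ_of_mem_classLines hm hl

/-- The shortest admissible index is 1, giving length at least w_k = Q^(s_(k+1)) w_(k+1). This is
exactly the length required of class 0 lines on the next level. -/
theorem exists_eq_segment_of_mem_levelLines (k : ℕ) : ∀ l ∈ D.levelLines k,
    ∃ x y : 𝔼, l = segment ℝ x y ∧ D.width k ≤ dist x y := by
  induction k with
  | zero =>
    intro l hl
    refine ⟨D.a, D.b, hl, ?_⟩
    rw [D.dist_a_b]
    exact inv_le_one_of_one_le₀ (one_le_pow₀ D.one_lt_Q.le)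
  | succ k ih =>
    intro l hl
    have hbase : D.IsBase (k + 1) (D.levelLines k) := by
      intro l hl
      rw [D.pow_mul_width_succ]
      exact ih l hl
    simp only [levelLines, mem_iUnion, classLinesOver] at hl
    obtain ⟨m, -, J, ⟨-, hp, hm⟩, hl⟩ := hl
    have hadm : D.IsAdmissible (k + 1) 1 J :=
      ⟨le_rfl, by linarith [D.three_le_s (k + 1)], hp, hm⟩
    obtain ⟨x, y, hxy, h⟩ := hbase.exists_eq_segment hadm hl
    refine ⟨x, y, hxy, le_trans ?_ h⟩
    rw [pow_one]
    exact le_mul_of_one_le_left (D.width_pos _).le D.one_lt_Q.le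

theorem isBase_levelLines (k : ℕ) : D.IsBase (k + 1) (D.levelLines k) := by
  intro l hl
  rw [D.pow_mul_width_succ]
  exact D.exists_eq_segment_of_mem_levelLines k l hl

theorem mem_tubeSet {q : ℝ} {z : 𝔼} : z ∈ D.tubeSet q ↔ ∀ k, ∃ m : ℕ, (m : ℝ) ≤ q * D.M k ∧
    ∃ l ∈ D.classLines k m, ∃ y ∈ l, dist z y ≤ q * D.width k := by
  simp only [tubeSet, mem_iInter, mem_iUnion, mem_closedNhd, exists_prop]

theorem tubeSet_mono {p q : ℝ} (hpq : p ≤ q) : D.tubeSet p ⊆ D.tubeSet q := by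
  intro z hz
  rw [mem_tubeSet] at hz ⊢
  intro k
  obtain ⟨m, hm, l, hl, y, hy, h⟩ := hz k
  have := D.width_pos k
  exact ⟨m, hm.trans (by gcongr), l, hl, y, hy, h.trans (by gcongr)⟩

theorem tendsto_width : Tendsto D.width atTop (𝓝 0) := by
  have h1 : ∀ k, D.width k ≤ (D.Q⁻¹) ^ k := by
    intro k
    induction k with
    | zero =>
      rw [pow_zero]
      exact inv_le_one_of_one_le₀ (one_le_pow₀ D.one_lt_Q.le)
    | succ k ih =>
      have h2 := D.pow_mul_width_succ k
      have h3 : D.Q * D.width (k + 1) ≤ D.Q ^ D.s (k + 1) * D.width (k + 1) := by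
        have := D.width_pos (k + 1)
        gcongr
        exact le_self_pow₀ D.one_lt_Q.le (by linarith [D.three_le_s (k + 1)])
      rw [pow_succ', ← div_eq_inv_mul, le_div_iff₀ D.Q_pos]
      linarith
  refine squeeze_zero (fun k => (D.width_pos k).le) h1 ?_
  exact tendsto_pow_atTop_nhds_zero_of_lt_one (inv_nonneg.2 D.Q_pos.le)
    (inv_lt_one_of_one_lt₀ D.one_lt_Q)

/-- Every small scale is comparable to the half-length of some lines. -/
theorem exists_scale (K : ℕ) {δ : ℝ} (hδ0 : 0 < δ) (hδ : δ < D.Q * D.width (K + 1)) :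
    ∃ k j, K ≤ k ∧ δ < D.Q * D.width (k + 1) ∧ 1 ≤ j ∧ j ≤ D.s (k + 2) ∧
      D.Q ^ j * D.width (k + 2) ≤ δ ∧ δ < D.Q ^ (j + 1) * D.width (k + 2) := by
  classical
  -- The first level with Q w ≤ δ is called k + 2. By minimality δ < Q w on level k + 1, so a
  -- suitable index j ≤ s exists on level k + 2.
  have hex : ∃ k, D.Q * D.width k ≤ δ := by
    have := (D.tendsto_width.const_mul D.Q)
    rw [mul_zero] at this
    obtain ⟨k, hk⟩ := (this.eventually_lt_const hδ0).exists
    exact ⟨k, hk.le⟩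
  have hmin : ∀ i, i < Nat.find hex → δ < D.Q * D.width i := fun i hi =>
    not_le.1 (Nat.find_min hex hi)
  have hspec := Nat.find_spec hex
  have hK : K + 1 < Nat.find hex := by
    by_contra h
    have h1 := D.width_antitone (not_lt.1 h)
    have h2 : D.Q * D.width (K + 1) ≤ D.Q * D.width (Nat.find hex) := by
      have := D.Q_pos
      gcongr
    linarith
  obtain ⟨k, hk⟩ : ∃ k, Nat.find hex = k + 2 := ⟨Nat.find hex - 2, by omega⟩
  rw [hk] at hspec
  have hk1 : δ < D.Q * D.width (k + 1) := hmin _ (by omega)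
  have hex2 : ∃ j, δ < D.Q ^ (j + 1) * D.width (k + 2) := by
    refine ⟨D.s (k + 2), ?_⟩
    rw [pow_succ', mul_assoc, D.pow_mul_width_succ (k + 1)]
    exact hk1
  have hj1 : 1 ≤ Nat.find hex2 := by
    rw [Nat.one_le_iff_ne_zero]
    intro h
    have := Nat.find_spec hex2
    rw [h, zero_add, pow_one] at this
    linarith
  refine ⟨k, Nat.find hex2, by omega, hk1, hj1, ?_, ?_, Nat.find_spec hex2⟩
  · refine Nat.find_min' hex2 ?_
    rw [pow_succ', mul_assoc, D.pow_mul_width_succ (k + 1)]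
    exact hk1
  · have := Nat.find_min hex2 (m := Nat.find hex2 - 1) (by omega)
    rw [Nat.sub_add_cancel hj1] at this
    exact not_lt.1 this

theorem tendsto_M_div_s : Tendsto (fun k => (D.M k : ℝ) / D.s k) atTop (𝓝 0) := by
  refine squeeze_zero (fun k => by positivity) (fun k => ?_) D.tendsto_ratio
  have hs := D.three_le_s_real k
  have hlog : 1 ≤ Real.log (D.s k) := by
    rw [Real.le_log_iff_exp_le (by linarith)]
    linarith [Real.exp_one_lt_d9]
  gcongr
  exact le_mul_of_one_le_right (by positivity) hlog

/-- Points close to a point of `𝒰_p`, on the scale of `w_k`, satisfy the condition on level `k` in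
the definition of `𝒰_q`. -/
theorem exists_line_near_of_mem_tubeSet {p q : ℝ} {x : 𝔼} (hx : x ∈ D.tubeSet p) {k : ℕ}
    (hs : 1 / D.Q ≤ 1 - 1 / (D.s (k + 1) : ℝ)) (hM : 20 ≤ (q - p) * D.M (k + 1))
    (hsq : 6 / (D.s (k + 1) : ℝ) ≤ q - p) {z : 𝔼} (hz : ‖z - x‖ ≤ 2 * (D.Q * D.width (k + 1))) :
    ∃ m : ℕ, (m : ℝ) ≤ q * D.M (k + 1) ∧ ∃ l ∈ D.classLines (k + 1) m, ∃ y ∈ l,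
      dist z y ≤ q * D.width (k + 1) := by
  obtain ⟨m, hm, l, hl, y, hy, hxy⟩ := D.mem_tubeSet.1 hx (k + 1)
  obtain ⟨J, ⟨hlen, hp, hmem⟩, hl⟩ := D.mem_classLines_succ.1 hl
  have hadm : D.IsAdmissible (k + 1) 1 J :=
    ⟨le_rfl, by linarith [D.three_le_s (k + 1)], hp, hmem⟩
  have hw := D.width_pos (k + 1)
  have hQ := D.Q_pos
  have hQ2 := D.Q_lt_two
  have hs3 := D.three_le_s_real (k + 1)
  -- Lines of index 1 advance by w_(k+1) per link and 2Q ≤ 4, so four links suffice and the class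
  -- grows by at most 5.
  have hbound : ‖z - x‖ ≤ (4 : ℕ) * (D.Q ^ 1 * D.width (k + 1) / D.Q) := by
    rw [pow_one, mul_div_cancel_left₀ _ hQ.ne']
    push_cast
    nlinarith
  obtain ⟨J', hJ', hlen', l', hl', y', hy', hdist⟩ :=
    (D.isBase_levelLines k).exists_line_near hs hadm hl hy hbound
  refine ⟨J'.length, ?_, l', D.mem_classLines_succ.2 ⟨J', hJ'.isCategory, hl'⟩, y', hy', ?_⟩
  · have h1 : (J'.length : ℝ) ≤ m + 1 + 4 := by rw [← hlen]; exact_mod_cast hlen'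
    linarith
  · have h1 : ‖y' - (y + (z - x))‖ ≤ (q - p) * D.width (k + 1) := by
      refine hdist.trans ?_
      rw [pow_one]
      calc (D.Q * D.width (k + 1) + ‖z - x‖) / D.s (k + 1)
          ≤ (6 * D.width (k + 1)) / D.s (k + 1) := by gcongr; nlinarith
        _ = 6 / D.s (k + 1) * D.width (k + 1) := by ring
        _ ≤ _ := by gcongr
    rw [dist_eq_norm, show z - y' = (x - y) - (y' - (y + (z - x))) by abel]
    rw [dist_eq_norm] at hxy
    refine (norm_sub_le_of_le hxy h1).trans (le_of_eq ?_)
    ring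

/-- Close to any short segment near a point of `𝒰_p` there is a segment consisting of points
that lie on lines of level `k` and of class only slightly larger than allowed for `p`. -/
theorem exists_segment_near_of_mem_tubeSet {p : ℝ} (hp1 : p ≤ 1) {x : 𝔼}
    (hx : x ∈ D.tubeSet p) {k j : ℕ} (hs : 1 / D.Q ≤ 1 - 1 / (D.s (k + 1) : ℝ)) (hj : 1 ≤ j)
    (hjs : j ≤ D.s (k + 1)) {δ : ℝ} (hℓδ : D.Q ^ j * D.width (k + 1) ≤ δ)
    (hδℓ : δ < D.Q ^ (j + 1) * D.width (k + 1)) {u₁ u₂ : 𝔼} (hu₁ : ‖u₁‖ ≤ δ) (hu₂ : ‖u₂‖ ≤ δ) :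
    ∃ u₁' u₂' : 𝔼, ‖u₁' - u₁‖ ≤ (D.M (k + 1) + 7) / D.s (k + 1) * δ ∧
      ‖u₂' - u₂‖ ≤ (D.M (k + 1) + 7) / D.s (k + 1) * δ ∧
      ∀ z ∈ segment ℝ (x + u₁') (x + u₂'), ∃ m : ℕ, (m : ℝ) ≤ p * D.M (k + 1) + 16 ∧
        ∃ l ∈ D.classLines (k + 1) m, z ∈ l := by
  obtain ⟨m, hm, l, hl, z, hz, hxz⟩ := D.mem_tubeSet.1 hx (k + 1)
  obtain ⟨J, ⟨hlen, hp, hmem⟩, hl⟩ := D.mem_classLines_succ.1 hl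
  have hbase := D.isBase_levelLines k
  obtain ⟨J₁, n, hJ₁, hlen₁, l₁, hl₁, y, hy, hzy⟩ :=
    hbase.exists_admissible_line hj hjs J hp hmem l hl z hz
  have hw := D.width_pos (k + 1)
  have hQ := D.Q_pos
  have hQ1 := D.one_lt_Q
  have hQ2 := D.Q_lt_two
  have hs3 := D.three_le_s_real (k + 1)
  have hs0 : (0 : ℝ) < D.s (k + 1) := by linarith
  set ℓ := D.Q ^ j * D.width (k + 1) with hℓ
  have hℓ0 : 0 < ℓ := by positivity
  have hδℓ' : δ ≤ 4 * (ℓ / D.Q) := by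
    rw [mul_div_assoc', le_div_iff₀ hQ]
    have h1 : δ < D.Q * ℓ := by rw [hℓ, ← mul_assoc, ← pow_succ']; exact hδℓ
    nlinarith
  have hwℓ : D.width (k + 1) ≤ ℓ / D.Q := by
    rw [le_div_iff₀ hQ, mul_comm, hℓ]
    gcongr
    exact le_self_pow₀ hQ1.le (by omega)
  have hpM : (m : ℝ) ≤ D.M (k + 1) := hm.trans (mul_le_of_le_one_left (by positivity) hp1)
  have hnm : (n : ℝ) ≤ m := by
    have : n ≤ m := by omega
    exact_mod_cast this
  -- Moving to lines of index at least j discarded n lines, and coming back to x takes a path with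
  -- bound n + 1. The discarded lines pay for it: the class is at most m + 2 afterwards.
  have hv : ‖x - y‖ ≤ (n + 1 : ℕ) * (ℓ / D.Q) := by
    rw [show x - y = (z - y) + (x - z) by abel]
    rw [dist_eq_norm] at hxz
    have h1 : p * D.width (k + 1) ≤ ℓ / D.Q :=
      (mul_le_of_le_one_left hw.le hp1).trans hwℓ
    refine (norm_add_le_of_le hzy (hxz.trans h1)).trans (le_of_eq ?_)
    push_cast
    ring
  obtain ⟨J₂, hJ₂, hlen₂, l₂, hl₂, y₂, hy₂, hd₂⟩ := hbase.exists_line_near hs hJ₁ hl₁ hy hv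
  have hℓQ : ℓ / D.Q ≤ ℓ := div_le_self hℓ0.le hQ1.le
  have hd₂' : ‖y₂ - x‖ ≤ (D.M (k + 1) + 2) * δ / D.s (k + 1) := by
    rw [add_sub_cancel] at hd₂
    refine hd₂.trans ?_
    gcongr
    calc ℓ + ‖x - y‖ ≤ ℓ + (n + 1 : ℕ) * ℓ := by
          have h2 : ((n + 1 : ℕ) : ℝ) * (ℓ / D.Q) ≤ (n + 1 : ℕ) * ℓ := by gcongr
          linarith
      _ = (n + 2) * ℓ := by push_cast; ring
      _ ≤ (D.M (k + 1) + 2) * δ := by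
          gcongr
          exact_mod_cast hnm.trans hpM
  obtain ⟨J₃, hJ₃, hlen₃, l₃, hl₃, y₃, hy₃, hd₃⟩ :=
    hbase.exists_line_near hs hJ₂ hl₂ hy₂ (n := 4) (v := u₁) (by push_cast; linarith)
  have hd₃' : ‖y₃ - (y₂ + u₁)‖ ≤ 2 * δ / D.s (k + 1) := by
    refine hd₃.trans ?_
    gcongr
    linarith
  have huu : ‖u₂ - u₁‖ ≤ 2 * δ := (norm_sub_le_of_le hu₂ hu₁).trans (by linarith)
  obtain ⟨e, y₄, hd₄, hev, hline⟩ :=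
    hbase.exists_path hs hJ₃ hl₃ hy₃ (n := 8) (v := u₂ - u₁) (by push_cast; linarith)
  have hd₄' : ‖y₄ - y₃‖ ≤ δ / D.s (k + 1) := hd₄.trans (by gcongr)
  have hev' : ‖‖u₂ - u₁‖ • e - (u₂ - u₁)‖ ≤ 2 * δ / D.s (k + 1) := hev.trans (by gcongr)
  have h₁ : ‖y₄ - x - u₁‖ ≤ (D.M (k + 1) + 5) / D.s (k + 1) * δ := by
    rw [show y₄ - x - u₁ = (y₄ - y₃) + (y₃ - (y₂ + u₁)) + (y₂ - x) by abel]
    refine (norm_add_le_of_le (norm_add_le_of_le hd₄' hd₃') hd₂').trans (le_of_eq ?_)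
    ring
  refine ⟨y₄ - x, y₄ - x + ‖u₂ - u₁‖ • e, ?_, ?_, ?_⟩
  · refine h₁.trans ?_
    have : 0 ≤ δ := by linarith
    gcongr
    norm_num
  · rw [show y₄ - x + ‖u₂ - u₁‖ • e - u₂ = (y₄ - x - u₁) + (‖u₂ - u₁‖ • e - (u₂ - u₁)) by abel]
    refine (norm_add_le_of_le h₁ hev').trans (le_of_eq ?_)
    ring
  · intro z' hz'
    rw [segment_eq_image'] at hz'
    obtain ⟨θ, ⟨hθ0, hθ1⟩, rfl⟩ := hz'
    obtain ⟨J', hJ', hlen', l', hl', hmem'⟩ := hline (θ * ‖u₂ - u₁‖) (by positivity)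
      (mul_le_of_le_one_left (norm_nonneg _) hθ1)
    refine ⟨J'.length, ?_, l', D.mem_classLines_succ.2 ⟨J', hJ'.isCategory, hl'⟩, ?_⟩
    -- The class rises by 2 on returning to x, by 1 + 4 on reaching x + u₁, and by 1 + 8 along the
    -- segment.
    · have h1 : J'.length ≤ m + 16 := by omega
      have h2 : (J'.length : ℝ) ≤ m + 16 := by exact_mod_cast h1
      linarith
    · convert hmem' using 1
      simp only [add_sub_add_left_eq_sub, add_sub_cancel_left, smul_smul]
      abel

/-- The scale δ singles out a level on which the segment is built from lines of class at most pM +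
16 ≤ qM. On finer levels these lines have class 0. On coarser levels, x is within p w_i of an
allowed line, and the enlargement (q - p)w_i exceeds the distance to x, except on the level
immediately before, where a short chain of lines is added. -/
theorem hasSegmentsNear_tubeSet {p q : ℝ} (hp : 0 ≤ p) (hpq : p < q) (hq : q < 1) {x : 𝔼}
    (hx : x ∈ D.tubeSet p) : HasSegmentsNear (D.tubeSet q) x := by
  intro η hη
  have hqp : 0 < q - p := by linarith
  have hsr : Tendsto (fun k => (D.s k : ℝ)) atTop atTop :=
    tendsto_natCast_atTop_atTop.comp D.tendsto_s
  have hMr : Tendsto (fun k => (D.M k : ℝ)) atTop atTop :=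
    tendsto_natCast_atTop_atTop.comp D.tendsto_M
  have hQ := D.Q_pos
  have hQ1 := D.one_lt_Q
  have hQ2 := D.Q_lt_two
  have E1 : ∀ᶠ k in atTop, 20 ≤ (q - p) * D.M k := (hMr.const_mul_atTop hqp).eventually_ge_atTop 20
  have E2 : ∀ᶠ k in atTop, 1 / D.Q ≤ 1 - 1 / (D.s k : ℝ) := by
    have h1 : Tendsto (fun k => 1 - 1 / (D.s k : ℝ)) atTop (𝓝 (1 - 0)) :=
      tendsto_const_nhds.sub (hsr.const_div_atTop 1)
    have h2 : 1 / D.Q < 1 - 0 := by rw [sub_zero, div_lt_one hQ]; exact hQ1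
    exact (h1.eventually_const_lt h2).mono fun k hk => hk.le
  have E3 : ∀ᶠ k in atTop, (D.M k + 7) / (D.s k : ℝ) ≤ min η 1 := by
    have h1 : Tendsto (fun k => (D.M k + 7) / (D.s k : ℝ)) atTop (𝓝 (0 + 0)) := by
      simp only [add_div]
      exact D.tendsto_M_div_s.add (hsr.const_div_atTop 7)
    rw [add_zero] at h1
    exact (h1.eventually_lt_const (lt_min hη one_pos)).mono fun k hk => hk.le
  have E4 : ∀ᶠ k in atTop, 6 / (D.s k : ℝ) ≤ q - p :=
    ((hsr.const_div_atTop 6).eventually_lt_const hqp).mono fun k hk => hk.le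
  have E5 : ∀ᶠ k in atTop, 4 ≤ (q - p) * D.Q ^ D.s k :=
    (((tendsto_pow_atTop_atTop_of_one_lt hQ1).comp D.tendsto_s).const_mul_atTop
      hqp).eventually_ge_atTop 4
  obtain ⟨K, hK⟩ := eventually_atTop.1 (((E1.and E2).and (E3.and E4)).and E5)
  refine ⟨D.Q * D.width (K + 1), mul_pos hQ (D.width_pos _), fun δ hδ0 hδ u₁ u₂ hu₁ hu₂ => ?_⟩
  obtain ⟨k, j, hKk, hδk, hj, hjs, hℓδ, hδℓ⟩ := D.exists_scale K hδ0 hδ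
  obtain ⟨⟨⟨F1, F2⟩, F3, -⟩, -⟩ := hK (k + 2) (by omega)
  obtain ⟨⟨⟨G1, G2⟩, -, G4⟩, G5⟩ := hK (k + 1) (by omega)
  obtain ⟨u₁', u₂', h₁, h₂, hseg⟩ := D.exists_segment_near_of_mem_tubeSet (by linarith) hx
    (k := k + 1) F2 hj hjs hℓδ hδℓ hu₁ hu₂
  have F3δ : (D.M (k + 2) + 7) / (D.s (k + 2) : ℝ) * δ ≤ η * δ := by
    gcongr; exact F3.trans (min_le_left _ _)
  have F3δ' : (D.M (k + 2) + 7) / (D.s (k + 2) : ℝ) * δ ≤ 1 * δ := by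
    gcongr; exact F3.trans (min_le_right _ _)
  refine ⟨u₁', u₂', h₁.trans F3δ, h₂.trans F3δ, fun z hz => ?_⟩
  have hzx : ‖z - x‖ ≤ 2 * δ := by
    have hn : ∀ u u' : 𝔼, ‖u‖ ≤ δ → ‖u' - u‖ ≤ 1 * δ → x + u' ∈ Metric.closedBall x (2 * δ) := by
      intro u u' hu hu'
      rw [mem_closedBall_iff_norm, add_sub_cancel_left]
      have := norm_add_le (u' - u) u
      rw [sub_add_cancel] at this
      linarith
    have := (convex_closedBall x (2 * δ)).segment_subset (hn u₁ u₁' hu₁ (h₁.trans F3δ'))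
      (hn u₂ u₂' hu₂ (h₂.trans F3δ')) hz
    rwa [mem_closedBall_iff_norm] at this
  obtain ⟨m, hm, l, hl, hzl⟩ := hseg z hz
  have hmq : (m : ℝ) ≤ q * D.M (k + 2) := by linarith
  have hq0 : 0 < q := by linarith
  rw [mem_tubeSet]
  intro i
  have hwi := D.width_pos i
  rcases lt_trichotomy i (k + 2) with hi | rfl | hi
  · rcases Nat.lt_succ_iff_lt_or_eq.1 hi with hi | rfl
    · obtain ⟨m', hm', l', hl', y, hy, hxy⟩ := D.mem_tubeSet.1 hx i
      refine ⟨m', hm'.trans (by gcongr), l', hl', y, hy, ?_⟩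
      have h1 : ‖z - x‖ ≤ (q - p) * D.width i := by
        have h2 : D.width k ≤ D.width i := D.width_antitone (by omega)
        have h3 := D.pow_mul_width_succ k
        have h4 := D.width_pos (k + 1)
        calc ‖z - x‖ ≤ 2 * δ := hzx
          _ ≤ 2 * (2 * D.width (k + 1)) := by
              have : D.Q * D.width (k + 1) ≤ 2 * D.width (k + 1) := by gcongr
              linarith
          _ = 4 * D.width (k + 1) := by ring
          -- Two levels up the tubes are wider by a factor Q^(s_(k+1)), which absorbs the constant
          -- 4/(q - p).
          _ ≤ (q - p) * D.Q ^ D.s (k + 1) * D.width (k + 1) := by gcongr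
          _ = (q - p) * D.width k := by rw [mul_assoc, h3]
          _ ≤ _ := by gcongr
      have h5 := dist_triangle z x y
      rw [← dist_eq_norm] at h1
      linarith
    · exact D.exists_line_near_of_mem_tubeSet hx G2 G1 G4 (by linarith)
  · exact ⟨m, hmq, l, hl, z, hzl, by rw [dist_self]; positivity⟩
  · obtain ⟨i, rfl⟩ : ∃ i', i = i' + 1 := ⟨i - 1, by omega⟩
    have hmM : m ≤ D.M (k + 2) := by
      have : (m : ℝ) ≤ D.M (k + 2) := hmq.trans (mul_le_of_le_one_left (by positivity) hq.le)
      exact_mod_cast this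
    refine ⟨0, by rw [Nat.cast_zero]; positivity, l,
      D.mem_classLines_zero_of_mem_levelLines (D.levelLines_mono (show k + 2 ≤ i by omega)
        (D.classLines_subset_levelLines hmM hl)), z, hzl, by rw [dist_self]; positivity⟩

theorem segment_subset_tubeSet_zero : segment ℝ D.a D.b ⊆ D.tubeSet 0 := by
  intro z hz
  rw [mem_tubeSet]
  have h0 : segment ℝ D.a D.b ∈ D.levelLines 0 := mem_singleton _
  rintro (_ | k)
  · exact ⟨0, by simp, _, rfl, z, hz, by simp⟩
  · exact ⟨0, by simp, _, D.mem_classLines_zero_of_mem_levelLines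
      (D.levelLines_mono (Nat.zero_le k) h0), z, hz, by simp⟩

end SegmentScheme
end

/-! ### Counting lines and bounding their total length. -/

noncomputable section

theorem Metric.IsSeparated.lt_dist {X : Type*} [PseudoMetricSpace X] {ε : ℝ} {T : Set X}
    (h : Metric.IsSeparated (ENNReal.ofReal ε) T) {x y : X} (hx : x ∈ T) (hy : y ∈ T)
    (hxy : x ≠ y) : ε < dist x y := by
  have : ENNReal.ofReal ε < edist x y := h hx hy hxy
  rw [edist_dist] at this
  exact (ENNReal.ofReal_lt_ofReal_iff' .. |>.1 this).1

theorem Metric.IsSeparated.finite_and_ncard_le_of_subset_segment {E : Type*}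
    [NormedAddCommGroup E] [NormedSpace ℝ E] {ε : ℝ} (hε : 0 < ε) {T : Set E} {x y : E}
    (hT : T ⊆ segment ℝ x y) (hsep : Metric.IsSeparated (ENNReal.ofReal ε) T) :
    T.Finite ∧ (T.ncard : ℝ) ≤ dist x y / ε + 1 := by
  have hθ : ∀ z : E, ∃ θ : ℝ, z ∈ T → 0 ≤ θ ∧ θ ≤ 1 ∧ x + θ • (y - x) = z := by
    intro z
    by_cases hz : z ∈ T
    · have := hT hz
      rw [segment_eq_image'] at this
      obtain ⟨θ, ⟨h0, h1⟩, h⟩ := this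
      exact ⟨θ, fun _ => ⟨h0, h1, h⟩⟩
    · exact ⟨0, fun h => (hz h).elim⟩
  choose θ hθ using hθ
  have hD : 0 ≤ dist x y / ε := by positivity
  have hmaps : ∀ z ∈ T, ⌊θ z * (dist x y / ε)⌋ ∈ (Finset.Icc 0 ⌊dist x y / ε⌋ : Set ℤ) := by
    intro z hz
    obtain ⟨h0, h1, -⟩ := hθ z hz
    rw [Finset.coe_Icc]
    exact ⟨Int.floor_nonneg.2 (by positivity),
      Int.floor_le_floor (mul_le_of_le_one_left hD h1)⟩
  have hinj : InjOn (fun z => ⌊θ z * (dist x y / ε)⌋) T := by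
    intro z hz z' hz' h
    by_contra hne
    have h1 := Int.abs_sub_lt_one_of_floor_eq_floor h
    have h2 := hsep.lt_dist hz hz' hne
    have h3 : dist z z' = |θ z - θ z'| * dist x y := by
      conv_lhs => rw [← (hθ z hz).2.2, ← (hθ z' hz').2.2]
      rw [dist_eq_norm, add_sub_add_left_eq_sub, ← sub_smul, norm_smul, Real.norm_eq_abs,
        dist_comm x y, dist_eq_norm]
    rw [← sub_mul, abs_mul, abs_of_nonneg hD, ← mul_div_assoc, div_lt_one hε] at h1
    linarith
  have hfin : (Finset.Icc 0 ⌊dist x y / ε⌋ : Set ℤ).Finite := Finset.finite_toSet _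
  refine ⟨Set.Finite.of_injOn hmaps hinj hfin, ?_⟩
  have h := Set.ncard_le_ncard_of_injOn _ hmaps hinj hfin
  rw [Set.ncard_coe_finset, Int.card_Icc] at h
  have h4 : 0 ≤ ⌊dist x y / ε⌋ := Int.floor_nonneg.2 hD
  have h5 : (T.ncard : ℤ) ≤ ⌊dist x y / ε⌋ + 1 := by omega
  have h6 : (T.ncard : ℝ) ≤ ⌊dist x y / ε⌋ + 1 := by exact_mod_cast h5
  linarith [Int.floor_le (dist x y / ε)]

theorem EuclideanSpace.norm_le_sum_abs {d : ℕ} (x : EuclideanSpace ℝ (Fin d)) :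
    ‖x‖ ≤ ∑ i, |x i| := by
  rw [EuclideanSpace.norm_eq]
  refine Real.sqrt_le_iff.2 ⟨Finset.sum_nonneg fun i _ => abs_nonneg _, ?_⟩
  simpa using Finset.sum_sq_le_sq_sum_of_nonneg (s := Finset.univ) (f := fun i => |x i|)
    (fun i _ => abs_nonneg _)

/-- Rounding coordinates to a grid of mesh 1/(sd) is injective on T, because points in a common cell
have distance at most 1/s. -/
theorem Metric.IsSeparated.finite_and_ncard_le_of_subset_sphere {d s : ℕ} (hs : 0 < s)
    {T : Set (EuclideanSpace ℝ (Fin d))} (hT : T ⊆ Metric.sphere 0 1)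
    (hsep : Metric.IsSeparated (ENNReal.ofReal (1 / (s : ℝ))) T) :
    T.Finite ∧ T.ncard ≤ (2 * (s * d) + 1) ^ d := by
  set B : Finset (Fin d → ℤ) := Fintype.piFinset fun _ => Finset.Icc (-((s * d : ℕ) : ℤ)) (s * d : ℕ)
    with hB
  have hmaps : ∀ z ∈ T, (fun i => ⌊z i * ((s * d : ℕ) : ℝ)⌋) ∈ (B : Set (Fin d → ℤ)) := by
    intro z hz
    have h1 : ‖z‖ = 1 := by simpa using hT hz
    rw [Finset.mem_coe, hB, Fintype.mem_piFinset]
    intro i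
    have h2 : |z i| ≤ 1 := by
      have := PiLp.norm_apply_le z i
      rwa [h1, Real.norm_eq_abs] at this
    rw [abs_le] at h2
    have h3 : (0 : ℝ) ≤ ((s * d : ℕ) : ℝ) := Nat.cast_nonneg _
    rw [Finset.mem_Icc]
    constructor
    · rw [Int.le_floor]
      push_cast at h3 ⊢
      nlinarith [h2.1]
    · rw [← Int.floor_natCast (R := ℝ) (s * d)]
      exact Int.floor_le_floor (mul_le_of_le_one_left h3 h2.2)
  have hinj : InjOn (fun (z : EuclideanSpace ℝ (Fin d)) i => ⌊z i * ((s * d : ℕ) : ℝ)⌋) T := by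
    intro z hz z' hz' h
    by_contra hne
    have h1 := hsep.lt_dist hz hz' hne
    have h2 : dist z z' ≤ ∑ i : Fin d, 1 / ((s * d : ℕ) : ℝ) := by
      rw [dist_eq_norm]
      refine (EuclideanSpace.norm_le_sum_abs _).trans (Finset.sum_le_sum fun i _ => ?_)
      have h3 := Int.abs_sub_lt_one_of_floor_eq_floor (congrFun h i)
      have h4 : (0 : ℝ) < ((s * d : ℕ) : ℝ) := by
        have : 0 < d := i.pos
        exact_mod_cast Nat.mul_pos hs this
      rw [← sub_mul, abs_mul, abs_of_pos h4, ← lt_div_iff₀ h4] at h3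
      simpa using h3.le
    rw [Finset.sum_const, Finset.card_univ, Fintype.card_fin, nsmul_eq_mul] at h2
    have h5 : (d : ℝ) * (1 / ((s * d : ℕ) : ℝ)) ≤ 1 / s := by
      push_cast
      rcases Nat.eq_zero_or_pos d with h0 | h0
      · simp [h0]
      · have : (0 : ℝ) < d := by exact_mod_cast h0
        have : (0 : ℝ) < s := by exact_mod_cast hs
        exact le_of_eq (by field_simp)
    linarith
  have hfin : (B : Set (Fin d → ℤ)).Finite := Finset.finite_toSet _
  refine ⟨Set.Finite.of_injOn hmaps hinj hfin, ?_⟩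
  have h := Set.ncard_le_ncard_of_injOn _ hmaps hinj hfin
  refine h.trans (le_of_eq ?_)
  rw [Set.ncard_coe_finset, hB, Fintype.card_piFinset, Finset.prod_const, Finset.card_univ,
    Fintype.card_fin, Int.card_Icc]
  congr 1
  omega

theorem exists_isMaximalSeparatedIn {X : Type*} [PseudoEMetricSpace X] (ε : ℝ) (A : Set X) :
    ∃ T, IsMaximalSeparatedIn ε A T := by
  obtain ⟨T, hT⟩ := zorn_subset {N : Set X | N ⊆ A ∧ Metric.IsSeparated (ENNReal.ofReal ε) N} (by
    intro c hc hchain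
    refine ⟨⋃₀ c, ⟨sUnion_subset fun N hN => (hc hN).1, ?_⟩, fun N hN => subset_sUnion_of_mem hN⟩
    exact (pairwise_sUnion hchain.directedOn).2 fun N hN => (hc hN).2)
  exact ⟨T, hT⟩

theorem diam_segment_eq_dist {E : Type*} [NormedAddCommGroup E] [NormedSpace ℝ E] (x y : E) :
    Metric.diam (segment ℝ x y) = dist x y := by
  rw [← convexHull_pair, convexHull_diam, Metric.diam_pair]

/-- The collection `L` of sets is finite and the sum of the diameters of its members is at
most `Λ`. -/
def HasTotalDiamLE {X : Type} [PseudoMetricSpace X] (L : Set (Set X)) (Λ : ℝ) : Prop :=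
  ∃ (ι : Type) (_ : Fintype ι) (l : ι → Set X), L = range l ∧ ∑ i, Metric.diam (l i) ≤ Λ

namespace HasTotalDiamLE

variable {X : Type} [PseudoMetricSpace X]

theorem finite {L : Set (Set X)} {Λ : ℝ} (h : HasTotalDiamLE L Λ) : L.Finite := by
  obtain ⟨ι, _, l, rfl, -⟩ := h
  exact finite_range l

theorem mono {L : Set (Set X)} {Λ Λ' : ℝ} (h : HasTotalDiamLE L Λ) (hΛ : Λ ≤ Λ') :
    HasTotalDiamLE L Λ' := by
  obtain ⟨ι, i, l, hL, h⟩ := h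
  exact ⟨ι, i, l, hL, h.trans hΛ⟩

/-- Families may list a set repeatedly, so bounds simply add over the disjoint union of the index
types and lines never have to be shown distinct. -/
theorem iUnion {α : Type} [Fintype α] {L : α → Set (Set X)} {Λ : α → ℝ}
    (h : ∀ a, HasTotalDiamLE (L a) (Λ a)) : HasTotalDiamLE (⋃ a, L a) (∑ a, Λ a) := by
  choose ι i l hL h using h
  refine ⟨Σ a, ι a, inferInstance, fun p => l p.1 p.2, ?_, ?_⟩
  · ext t
    simp only [mem_iUnion, hL, mem_range, Sigma.exists]
  · rw [Fintype.sum_sigma]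
    exact Finset.sum_le_sum fun a _ => h a

theorem empty : HasTotalDiamLE (∅ : Set (Set X)) 0 :=
  ⟨Empty, inferInstance, fun i => i.elim, (range_eq_empty _).symm, by simp⟩

theorem biUnion_finite {α : Type} {A : Set α} (hA : A.Finite) {L : α → Set (Set X)} {Λ : ℝ}
    (h : ∀ a ∈ A, HasTotalDiamLE (L a) Λ) : HasTotalDiamLE (⋃ a ∈ A, L a) (A.ncard * Λ) := by
  have := hA.fintype
  have h1 := iUnion (L := fun a : A => L a) fun a => h a a.2
  rw [iUnion_coe_set] at h1
  refine h1.mono (le_of_eq ?_)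
  rw [Finset.sum_const, nsmul_eq_mul, Finset.card_univ, ← Nat.card_eq_fintype_card,
    Nat.card_coe_set_eq]

theorem image_finite {α : Type} {A : Set α} (hA : A.Finite) {f : α → Set X} {Λ : ℝ}
    (h : ∀ a ∈ A, Metric.diam (f a) ≤ Λ) : HasTotalDiamLE (f '' A) (A.ncard * Λ) := by
  rw [← biUnion_of_singleton (f '' A), biUnion_image]
  exact biUnion_finite hA fun a ha => ⟨Unit, inferInstance, fun _ => f a, by simp, by simpa using h a ha⟩

theorem biUnion {L : Set (Set X)} {Λ : ℝ} (hL : HasTotalDiamLE L Λ) {F : Set X → Set (Set X)}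
    {C : ℝ} (hC : 0 ≤ C) (h : ∀ l ∈ L, HasTotalDiamLE (F l) (C * Metric.diam l)) :
    HasTotalDiamLE (⋃ l ∈ L, F l) (C * Λ) := by
  obtain ⟨ι, _, l, rfl, hΛ⟩ := hL
  rw [biUnion_range]
  refine (iUnion fun i => h (l i) (mem_range_self i)).mono ?_
  rw [← Finset.mul_sum]
  gcongr

end HasTotalDiamLE

namespace SegmentScheme

variable {d : ℕ} (D : SegmentScheme d)

local notation "𝔼" => EuclideanSpace ℝ (Fin d)

theorem finite_dirs_and_ncard_le (k : ℕ) :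
    (D.dirs k).Finite ∧ (D.dirs k).ncard ≤ D.s k ^ ((d + 2) * d) := by
  have h3 := D.three_le_s k
  obtain ⟨h1, h2⟩ := Metric.IsSeparated.finite_and_ncard_le_of_subset_sphere (by omega)
    (D.dirs_maximal k).prop.1 (D.dirs_maximal k).prop.2
  refine ⟨h1, h2.trans ?_⟩
  rw [pow_mul]
  rcases Nat.eq_zero_or_pos d with h0 | h0
  · simp [h0]
  refine Nat.pow_le_pow_left ?_ d
  have h4 : d < D.s k ^ d := Nat.lt_pow_self (by omega)
  have h5 : 1 ≤ D.s k * d := Nat.mul_pos (by omega) h0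
  calc 2 * (D.s k * d) + 1 ≤ 3 * (D.s k * d) := by omega
    _ ≤ D.s k * (D.s k * D.s k ^ d) := by gcongr
    _ = D.s k ^ (d + 2) := by ring

variable {D} in
-- On a line of length λ there are at most 2λs/ℓ centres, each carrying a new line of length 2ℓ. The
-- scale ℓ = Q^j w_k cancels: each direction multiplies the length by at most 4s, whatever j is.
theorem IsBase.hasTotalDiamLE_categoryLines {k : ℕ} {L₀ : Set (Set 𝔼)} (hL₀ : D.IsBase k L₀)
    {Λ : ℝ} (hΛ : HasTotalDiamLE L₀ Λ) (J : List ℕ) (hp : J.Pairwise (· ≤ ·))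
    (hmem : ∀ i ∈ J, 1 ≤ i ∧ i ≤ D.s k) :
    HasTotalDiamLE (D.categoryLines k L₀ J)
      ((4 * D.s k * (D.s k : ℝ) ^ ((d + 2) * d)) ^ J.length * Λ) := by
  induction J with
  | nil => simpa [categoryLines] using hΛ
  | cons j J ih =>
    have hp' := List.pairwise_cons.1 hp
    have hJ : D.IsAdmissible k j J := ⟨(hmem j (by simp)).1, (hmem j (by simp)).2, hp'.2,
      fun i hi => ⟨hp'.1 i hi, (hmem i (by simp [hi])).2⟩⟩
    have ih := ih hp'.2 fun i hi => hmem i (by simp [hi])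
    have hs := D.three_le_s_real k
    rw [List.length_cons, pow_succ', mul_assoc]
    refine ih.biUnion (by positivity) fun l hl => ?_
    obtain ⟨x, y, rfl, hxy⟩ := hL₀.exists_eq_segment hJ hl
    obtain ⟨hfin, hcard⟩ := D.finite_dirs_and_ncard_le k
    have hpos : 0 < D.Q ^ j * D.width k := mul_pos (pow_pos D.Q_pos j) (D.width_pos k)
    have key : ∀ e ∈ D.dirs k, HasTotalDiamLE (D.newLines k (segment ℝ x y) j e)
        (4 * D.s k * Metric.diam (segment ℝ x y)) := by
      intro e he
      have hmax := hL₀.net_maximal hJ hl he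
      obtain ⟨hf, hc⟩ := Metric.IsSeparated.finite_and_ncard_le_of_subset_segment
        (by positivity) hmax.prop.1 hmax.prop.2
      refine (HasTotalDiamLE.image_finite hf (Λ := 2 * (D.Q ^ j * D.width k)) fun z _ => ?_).mono ?_
      · rw [diam_segment_eq_dist, dist_newLine (D.norm_of_mem_dirs he) hpos.le]
      · rw [diam_segment_eq_dist]
        have h1 : 1 ≤ dist x y / (D.Q ^ j * D.width k / D.s k) := by
          rw [one_le_div (by positivity)]
          exact (div_le_self hpos.le (by linarith)).trans hxy
        calc _ ≤ (2 * (dist x y / (D.Q ^ j * D.width k / D.s k))) * (2 * (D.Q ^ j * D.width k)) := by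
              gcongr
              linarith
          _ = _ := by
              set c := D.Q ^ j * D.width k
              have := hpos.ne'
              field_simp
              ring
    refine (HasTotalDiamLE.biUnion_finite hfin key).mono ?_
    have : ((D.dirs k).ncard : ℝ) ≤ (D.s k : ℝ) ^ ((d + 2) * d) := by exact_mod_cast hcard
    calc _ ≤ (D.s k : ℝ) ^ ((d + 2) * d) * (4 * D.s k * Metric.diam (segment ℝ x y)) := by
          gcongr
      _ = _ := by ring

variable {D} in
-- There are at most s^m categories of class m; counting all lists with entries 1, …, s, with empty
-- collections for inadmissible ones, gives one further factor s per step.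
theorem IsBase.hasTotalDiamLE_classLinesOver {k : ℕ} {L₀ : Set (Set 𝔼)} (hL₀ : D.IsBase k L₀)
    {Λ : ℝ} (hΛ0 : 0 ≤ Λ) (hΛ : HasTotalDiamLE L₀ Λ) (m : ℕ) :
    HasTotalDiamLE (D.classLinesOver k L₀ m)
      ((4 * D.s k * D.s k * (D.s k : ℝ) ^ ((d + 2) * d)) ^ m * Λ) := by
  set C : ℝ := (4 * D.s k * (D.s k : ℝ) ^ ((d + 2) * d)) ^ m * Λ with hC
  have hC0 : 0 ≤ C := by positivity
  have h1 : HasTotalDiamLE (⋃ v : Fin m → Fin (D.s k),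
      {l | D.IsCategory k m (List.ofFn fun i => (v i : ℕ) + 1) ∧
        l ∈ D.categoryLines k L₀ (List.ofFn fun i => (v i : ℕ) + 1)})
      (∑ v : Fin m → Fin (D.s k), C) := by
    refine HasTotalDiamLE.iUnion fun v => ?_
    by_cases h : D.IsCategory k m (List.ofFn fun i => (v i : ℕ) + 1)
    · simp only [h, true_and, ofPred_mem_eq]
      have := hL₀.hasTotalDiamLE_categoryLines hΛ _ h.2.1 h.2.2
      rwa [h.1] at this
    · simp only [h, false_and, ofPred_false]
      exact HasTotalDiamLE.empty.mono hC0
  have h2 : D.classLinesOver k L₀ m = ⋃ v : Fin m → Fin (D.s k),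
      {l | D.IsCategory k m (List.ofFn fun i => (v i : ℕ) + 1) ∧
        l ∈ D.categoryLines k L₀ (List.ofFn fun i => (v i : ℕ) + 1)} := by
    ext l
    simp only [classLinesOver, mem_iUnion, exists_prop, mem_ofPred_eq]
    constructor
    · rintro ⟨J, hJ, hl⟩
      obtain ⟨rfl, -, hmem⟩ := id hJ
      have hJ' : J = List.ofFn fun i : Fin J.length => (J.get i - 1) + 1 := by
        conv_lhs => rw [← List.ofFn_get J]
        congr 1
        ext i
        have := (hmem (J.get i) (List.get_mem J i)).1
        omega
      refine ⟨fun i => ⟨J.get i - 1, ?_⟩, ?_⟩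
      · have := hmem (J.get i) (List.get_mem J i)
        omega
      · simp only
        rw [← hJ']
        exact ⟨hJ, hl⟩
    · rintro ⟨v, hJ, hl⟩
      exact ⟨_, hJ, hl⟩
  rw [h2]
  refine h1.mono (le_of_eq ?_)
  rw [Finset.sum_const, Finset.card_univ, Fintype.card_fun, Fintype.card_fin, Fintype.card_fin,
    nsmul_eq_mul, hC]
  push_cast
  rw [← mul_assoc, ← mul_pow]
  congr 2
  ring

theorem hasTotalDiamLE_levelLines_succ (k : ℕ) {Λ : ℝ} (hΛ0 : 0 ≤ Λ)
    (hΛ : HasTotalDiamLE (D.levelLines k) Λ) : HasTotalDiamLE (D.levelLines (k + 1))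
      (((D.s (k + 1) : ℝ) ^ ((d + 2) * d + 4)) ^ D.M (k + 1) * Λ) := by
  have hs := D.three_le_s_real (k + 1)
  set s : ℝ := (D.s (k + 1) : ℝ) with hs'
  set M := D.M (k + 1)
  have h1 : HasTotalDiamLE (⋃ m ∈ Iic M, D.classLinesOver (k + 1) (D.levelLines k) m)
      ((Iic M).ncard * ((4 * s * s * s ^ ((d + 2) * d)) ^ M * Λ)) := by
    refine HasTotalDiamLE.biUnion_finite (finite_Iic M) fun m hm => ?_
    refine ((D.isBase_levelLines k).hasTotalDiamLE_classLinesOver hΛ0 hΛ m).mono ?_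
    refine mul_le_mul_of_nonneg_right (pow_le_pow_right₀ ?_ hm) hΛ0
    have h2 : 1 ≤ s ^ ((d + 2) * d) := one_le_pow₀ (by linarith)
    exact one_le_mul_of_one_le_of_one_le (by nlinarith) h2
  refine HasTotalDiamLE.mono h1 ?_
  have h2 : ((Iic M).ncard : ℝ) ≤ 2 ^ M := by
    have h3 : (Iic M).ncard = M + 1 := by
      rw [← Finset.coe_Iic, Set.ncard_coe_finset, Nat.card_Iic]
    rw [h3]
    exact_mod_cast Nat.lt_two_pow_self (n := M)
  calc ((Iic M).ncard : ℝ) * ((4 * s * s * s ^ ((d + 2) * d)) ^ M * Λ)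
      ≤ 2 ^ M * ((4 * s * s * s ^ ((d + 2) * d)) ^ M * Λ) := by gcongr
    _ = (8 * (s * s * s ^ ((d + 2) * d))) ^ M * Λ := by
        rw [← mul_assoc, ← mul_pow]
        congr 2
        ring
    -- The numerical factors, including the number M + 1 ≤ 2^M of classes, are absorbed by 8 ≤ s².
    _ ≤ ((s * s) * (s * s * s ^ ((d + 2) * d))) ^ M * Λ := by
        gcongr
        nlinarith
    _ = _ := by
        congr 2
        ring

/-- A bound for the total length of the lines of level `k`. -/
def lengthBound (k : ℕ) : ℝ :=
  ∏ i ∈ Finset.range (k + 1), ((D.s i : ℝ) ^ ((d + 2) * d + 4)) ^ D.M i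

theorem one_le_lengthBound (k : ℕ) : 1 ≤ D.lengthBound k := by
  refine Finset.prod_induction _ (1 ≤ ·) (fun a b ha hb => one_le_mul_of_one_le_of_one_le ha hb)
    le_rfl fun i _ => ?_
  exact one_le_pow₀ (one_le_pow₀ (by linarith [D.three_le_s_real i]))

theorem hasTotalDiamLE_levelLines (k : ℕ) :
    HasTotalDiamLE (D.levelLines k) (D.lengthBound k) := by
  induction k with
  | zero =>
    refine (HasTotalDiamLE.mono (Λ := 1) ⟨Unit, inferInstance, fun _ => segment ℝ D.a D.b, ?_, ?_⟩
      (D.one_le_lengthBound 0))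
    · simp [levelLines]
    · simp [diam_segment_eq_dist, D.dist_a_b]
  | succ k ih =>
    have h0 : 0 ≤ D.lengthBound k := zero_le_one.trans (D.one_le_lengthBound k)
    have := D.hasTotalDiamLE_levelLines_succ k h0 ih
    rwa [lengthBound, Finset.prod_range_succ, mul_comm]

theorem finite_levelLines (k : ℕ) : (D.levelLines k).Finite := (D.hasTotalDiamLE_levelLines k).finite

end SegmentScheme

end

/-! ### Compactness and asymptotics of covering numbers. -/

noncomputable section

theorem isCompact_segment_real {E : Type*} [NormedAddCommGroup E] [NormedSpace ℝ E] (x y : E) :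
    IsCompact (segment ℝ x y) := by
  rw [segment_eq_image']
  exact isCompact_Icc.image (by fun_prop)

theorem IsCompact.closedNhd {X : Type*} [PseudoMetricSpace X] [ProperSpace X] {A : Set X}
    (hA : IsCompact A) (w : ℝ) : IsCompact (closedNhd w A) := by
  rcases lt_or_ge w 0 with hw | hw
  · simp [_root_.closedNhd, Metric.closedBall_eq_empty.2 hw]
  · rw [_root_.closedNhd, ← hA.cthickening_eq_biUnion_closedBall hw]
    exact hA.cthickening

namespace SegmentScheme

variable {d : ℕ} (D : SegmentScheme d)

local notation "𝔼" => EuclideanSpace ℝ (Fin d)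

theorem finite_classLines (k m : ℕ) : (D.classLines k m).Finite := by
  cases k with
  | zero => cases m <;> simp [classLines]
  | succ k =>
    exact ((D.isBase_levelLines k).hasTotalDiamLE_classLinesOver
      (zero_le_one.trans (D.one_le_lengthBound k)) (D.hasTotalDiamLE_levelLines k) m).finite

theorem isCompact_of_mem_classLines {k m : ℕ} {l : Set 𝔼} (hl : l ∈ D.classLines k m) :
    IsCompact l := by
  cases k with
  | zero =>
    cases m with
    | zero =>
      obtain rfl : l = _ := hl
      exact isCompact_segment_real _ _
    | succ m => exact hl.elim
  | succ k =>
    obtain ⟨J, hJ, hl⟩ := D.mem_classLines_succ.1 hl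
    obtain ⟨x, y, rfl, -⟩ := (D.isBase_levelLines k).exists_eq_segment (j := 1)
      ⟨le_rfl, by linarith [D.three_le_s (k + 1)], hJ.2.1, hJ.2.2⟩ hl
    exact isCompact_segment_real _ _

theorem isClosed_tubeSet (q : ℝ) : IsClosed (D.tubeSet q) := by
  refine isClosed_iInter fun k => ?_
  have hfin : {m : ℕ | (m : ℝ) ≤ q * D.M k}.Finite :=
    (finite_Iic ⌊q * D.M k⌋₊).subset fun m hm => Nat.le_floor hm
  exact hfin.isClosed_biUnion fun m _ => (D.finite_classLines k m).isClosed_biUnion fun l hl =>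
    ((D.isCompact_of_mem_classLines hl).closedNhd _).isClosed

theorem tubeSet_subset_limitSet {q : ℝ} (h0 : 0 ≤ q) (h1 : q < 1) :
    D.tubeSet q ⊆ D.limitSet :=
  (subset_biUnion_of_mem (u := D.tubeSet) (show q ∈ Ico (0 : ℝ) 1 from ⟨h0, h1⟩)).trans subset_closure

theorem isCompact_biUnion_levelLines (k : ℕ) :
    IsCompact (⋃ l ∈ D.levelLines k, closedNhd (D.width k) l) := by
  refine (D.finite_levelLines k).isCompact_biUnion fun l hl => ?_
  obtain ⟨x, y, rfl, -⟩ := D.exists_eq_segment_of_mem_levelLines k l hl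
  exact (isCompact_segment_real x y).closedNhd _

/-- All 𝒰_q with q < 1 lie in the same finite union of compact tubes, and this union is closed, so
it also contains the closure. -/
theorem limitSet_subset (k : ℕ) :
    D.limitSet ⊆ ⋃ l ∈ D.levelLines k, closedNhd (D.width k) l := by
  refine closure_minimal (iUnion₂_subset fun q hq z hz => ?_)
    (D.isCompact_biUnion_levelLines k).isClosed
  obtain ⟨m, hm, l, hl, y, hy, hzy⟩ := D.mem_tubeSet.1 hz k
  have hmM : m ≤ D.M k := by
    have : (m : ℝ) ≤ D.M k := hm.trans (mul_le_of_le_one_left (Nat.cast_nonneg _) hq.2.le)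
    exact_mod_cast this
  simp only [mem_iUnion, mem_closedNhd, exists_prop]
  exact ⟨l, D.classLines_subset_levelLines hmM hl, y, hy,
    hzy.trans (mul_le_of_le_one_left (D.width_pos k).le hq.2.le)⟩

theorem isCompact_limitSet : IsCompact D.limitSet :=
  (D.isCompact_biUnion_levelLines 0).of_isClosed_subset isClosed_closure (D.limitSet_subset 0)

/-- A w_k-net of each line, with radii doubled, covers its tube. Lines have length at least w_k, so
the rounding term 1 in the size of the net at most doubles the count. -/
theorem externalCoveringNumber_limitSet_le (k : ℕ) :
    ((Metric.externalCoveringNumber (2 * D.width k).toNNReal D.limitSet : ℕ∞) : ℝ≥0∞) ≤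
      ENNReal.ofReal (2 * D.lengthBound k / D.width k) := by
  have hw := D.width_pos k
  obtain ⟨ι, _, l, hL, hsum⟩ := D.hasTotalDiamLE_levelLines k
  have hT : ∀ i, ∃ T : Set 𝔼, T.Finite ∧ (T.ncard : ℝ) ≤ 2 / D.width k * Metric.diam (l i) ∧
      ∀ y ∈ l i, ∃ c ∈ T, dist c y ≤ D.width k := by
    intro i
    obtain ⟨x, y, hxy, hlen⟩ := D.exists_eq_segment_of_mem_levelLines k (l i) (hL ▸ mem_range_self i)
    obtain ⟨T, hT⟩ := exists_isMaximalSeparatedIn (D.width k) (segment ℝ x y)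
    obtain ⟨hf, hc⟩ := Metric.IsSeparated.finite_and_ncard_le_of_subset_segment hw hT.prop.1
      hT.prop.2
    rw [hxy, diam_segment_eq_dist]
    refine ⟨T, hf, hc.trans ?_, fun z hz => hT.exists_dist_le hw.le hz⟩
    have : 1 ≤ dist x y / D.width k := (one_le_div hw).2 hlen
    calc _ ≤ dist x y / D.width k + dist x y / D.width k := by gcongr
      _ = _ := by ring
  choose T hf hc hcov using hT
  have hcover : Metric.IsCover (2 * D.width k).toNNReal D.limitSet (⋃ i, T i) := by
    rw [Metric.isCover_iff_subset_iUnion_closedBall]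
    intro z hz
    have hz' := D.limitSet_subset k hz
    simp only [mem_iUnion, mem_closedNhd, exists_prop] at hz'
    obtain ⟨l', hl', y, hy, hzy⟩ := hz'
    rw [hL] at hl'
    obtain ⟨i, rfl⟩ := hl'
    obtain ⟨c, hc, hcy⟩ := hcov i y hy
    refine mem_biUnion (mem_iUnion.2 ⟨i, hc⟩) ?_
    rw [Metric.mem_closedBall, Real.coe_toNNReal _ (by positivity)]
    rw [dist_comm] at hcy
    linarith [dist_triangle z y c]
  have hfin : (⋃ i, T i).Finite := finite_iUnion hf
  refine (ENat.toENNReal_le.2 hcover.externalCoveringNumber_le_encard).trans ?_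
  rw [← hfin.cast_ncard_eq, ENat.toENNReal_coe, ← ENNReal.ofReal_natCast]
  refine ENNReal.ofReal_le_ofReal ?_
  calc ((⋃ i, T i).ncard : ℝ) ≤ ∑ i, ((T i).ncard : ℝ) := by
        exact_mod_cast Set.ncard_iUnion_le_of_fintype T
    _ ≤ ∑ i, 2 / D.width k * Metric.diam (l i) := Finset.sum_le_sum fun i _ => hc i
    _ = 2 / D.width k * ∑ i, Metric.diam (l i) := by rw [Finset.mul_sum]
    _ ≤ 2 / D.width k * D.lengthBound k := by gcongr
    _ = _ := by ring

theorem width_eq (k : ℕ) :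
    D.width k = Real.exp (-(Real.log D.Q * ∑ i ∈ Finset.range (k + 1), (D.s i : ℝ))) := by
  have hQ : ∀ n : ℕ, (D.Q ^ n)⁻¹ = Real.exp (-(Real.log D.Q * n)) := by
    intro n
    rw [Real.exp_neg, mul_comm, Real.exp_nat_mul, Real.exp_log D.Q_pos]
  induction k with
  | zero => simp [width, tubeWidth, hQ]
  | succ k ih =>
    rw [Finset.sum_range_succ, mul_add, neg_add, Real.exp_add, ← ih, ← hQ, mul_comm]
    rfl

theorem lengthBound_eq (k : ℕ) :
    D.lengthBound k = Real.exp (((d + 2) * d + 4 : ℕ) *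
      ∑ i ∈ Finset.range (k + 1), D.M i * Real.log (D.s i)) := by
  rw [Finset.mul_sum, Real.exp_sum, lengthBound]
  refine Finset.prod_congr rfl fun i _ => ?_
  have : (0 : ℝ) < D.s i := by linarith [D.three_le_s_real i]
  rw [← pow_mul, ← mul_assoc, ← Nat.cast_mul, Real.exp_nat_mul, Real.exp_log this]

/-- The sums `s_0 + ⋯ + s_k`. -/
def sumS (k : ℕ) : ℝ := ∑ i ∈ Finset.range (k + 1), (D.s i : ℝ)

theorem tendsto_sum_range_s :
    Tendsto (fun n => ∑ i ∈ Finset.range n, (D.s i : ℝ)) atTop atTop := by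
  refine tendsto_atTop_mono (fun n => ?_) tendsto_natCast_atTop_atTop
  calc (n : ℝ) = ∑ i ∈ Finset.range n, (1 : ℝ) := by simp
    _ ≤ _ := Finset.sum_le_sum fun i _ => by linarith [D.three_le_s_real i]

theorem tendsto_sumS : Tendsto D.sumS atTop atTop :=
  D.tendsto_sum_range_s.comp (tendsto_add_atTop_nat 1)

/-- A termwise little-o relation passes to partial sums because the sums of s_i diverge. -/
theorem isLittleO_sum_M_mul_log :
    (fun n => ∑ i ∈ Finset.range (n + 1), D.M i * Real.log (D.s i)) =o[atTop] D.sumS := by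
  have h : (fun i => D.M i * Real.log (D.s i)) =o[atTop] fun i => (D.s i : ℝ) := by
    refine (Asymptotics.isLittleO_iff_tendsto fun i hi => ?_).2 D.tendsto_ratio
    linarith [D.three_le_s_real i]
  exact (h.sum_range (fun i => Nat.cast_nonneg _) D.tendsto_sum_range_s).comp_tendsto
    (tendsto_add_atTop_nat 1)

/-- The majorant telescopes, and its increments are o(s_i), so it is o of the partial sums. This is
needed because consecutive widths differ by the factor Q^(s_k). -/
theorem isLittleO_s : (fun n => (D.s n : ℝ)) =o[atTop] D.sumS := by
  obtain ⟨σ, hσ, hlim⟩ := D.exists_majorant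
  have h1 : (fun i => σ (i + 1) - σ i) =o[atTop] fun i => (D.s (i + 1) : ℝ) := by
    refine (Asymptotics.isLittleO_iff_tendsto fun i hi => ?_).2 hlim
    linarith [D.three_le_s_real (i + 1)]
  have htop : Tendsto (fun n => ∑ i ∈ Finset.range n, (D.s (i + 1) : ℝ)) atTop atTop := by
    refine tendsto_atTop_mono (fun n => ?_) tendsto_natCast_atTop_atTop
    calc (n : ℝ) = ∑ i ∈ Finset.range n, (1 : ℝ) := by simp
      _ ≤ _ := Finset.sum_le_sum fun i _ => by linarith [D.three_le_s_real (i + 1)]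
  have h2 := h1.sum_range (fun i => Nat.cast_nonneg _) htop
  simp only [Finset.sum_range_sub] at h2
  have h3 : (fun n => ∑ i ∈ Finset.range n, (D.s (i + 1) : ℝ)) =O[atTop] D.sumS := by
    refine Asymptotics.IsBigO.of_bound 1 (Eventually.of_forall fun n => ?_)
    rw [Real.norm_of_nonneg (by positivity), sumS, Real.norm_of_nonneg (by positivity), one_mul,
      Finset.sum_range_succ']
    linarith [D.three_le_s_real 0]
  have h4 : (fun _ : ℕ => σ 0) =o[atTop] D.sumS :=
    Asymptotics.isLittleO_const_left.2 (Or.inr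
      (tendsto_norm_atTop_atTop.comp D.tendsto_sumS))
  have h5 := (h2.trans_isBigO h3).add h4
  simp only [sub_add_cancel] at h5
  refine Asymptotics.IsBigO.trans_isLittleO (Asymptotics.IsBigO.of_bound 1 ?_) h5
  refine Eventually.of_forall fun n => ?_
  rw [one_mul, Real.norm_natCast]
  exact (hσ n).trans (le_abs_self _)

/-- Balls at scale w_(k+1) are weighed by the larger radius 2w_k. Apart from little-o terms the
exponent is -(t - 1) log Q (s_0 + ⋯ + s_(k+1)); the change of scale costs only t log Q s_(k+1). -/
theorem tendsto_coveringBound {t : ℝ} (ht : 1 < t) :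
    Tendsto (fun k => 2 * D.lengthBound (k + 1) / D.width (k + 1) * (2 * D.width k) ^ t) atTop
      (𝓝 0) := by
  set c : ℝ := (((d + 2) * d + 4 : ℕ) : ℝ) with hc
  set κ := Real.log D.Q with hκ
  have hκ0 : 0 < κ := Real.log_pos D.one_lt_Q
  set A : ℕ → ℝ := fun n => ∑ i ∈ Finset.range (n + 1), D.M i * Real.log (D.s i) with hA
  have hS : ∀ k, D.sumS (k + 1) = D.sumS k + D.s (k + 1) := fun k => by
    rw [sumS, Finset.sum_range_succ, sumS]
  have heq : ∀ k, 2 * D.lengthBound (k + 1) / D.width (k + 1) * (2 * D.width k) ^ t =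
      2 * 2 ^ t * Real.exp (c * A (k + 1) + t * κ * D.s (k + 1) - (t - 1) * κ * D.sumS (k + 1)) := by
    intro k
    rw [Real.mul_rpow (by norm_num) (D.width_pos k).le, D.width_eq k, ← Real.exp_mul, D.width_eq,
      D.lengthBound_eq, ← hκ, div_eq_mul_inv, ← Real.exp_neg]
    have : c * A (k + 1) + t * κ * D.s (k + 1) - (t - 1) * κ * D.sumS (k + 1) =
        c * A (k + 1) + - -(κ * D.sumS (k + 1)) + -(κ * D.sumS k) * t := by
      rw [hS k]
      ring
    rw [this, Real.exp_add, Real.exp_add]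
    simp only [hc, hA, sumS]
    ring
  simp_rw [heq]
  rw [show (0 : ℝ) = 2 * 2 ^ t * 0 by simp]
  refine Tendsto.const_mul _ (Real.tendsto_exp_atBot.comp ?_)
  have h1 : (fun n => c * A n + t * κ * D.s n) =o[atTop] D.sumS :=
    (D.isLittleO_sum_M_mul_log.const_mul_left c).add (D.isLittleO_s.const_mul_left (t * κ))
  have hη : 0 < (t - 1) * κ / 2 := by
    have : 0 < t - 1 := by linarith
    positivity
  have h2 := h1.bound hη
  have h3 : Tendsto (fun n => -((t - 1) * κ / 2 * D.sumS n)) atTop atBot :=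
    tendsto_neg_atTop_atBot.comp (D.tendsto_sumS.const_mul_atTop hη)
  refine Tendsto.comp (g := fun n => c * A n + t * κ * D.s n - (t - 1) * κ * D.sumS n) ?_
    (tendsto_add_atTop_nat 1)
  refine tendsto_atBot_mono' _ ?_ h3
  filter_upwards [h2] with n hn
  have h4 : 0 ≤ D.sumS n := Finset.sum_nonneg fun i _ => Nat.cast_nonneg _
  rw [Real.norm_of_nonneg h4] at hn
  have := (le_abs_self _).trans hn
  linarith

end SegmentScheme

end

/-! ### Dimension, universality and existence of the construction. -/

noncomputable section

/-- Projection to the direction of the segment does not increase distances, so the N balls yield N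
intervals of length 2ε covering [0, 1]. -/
theorem one_le_externalCoveringNumber_mul_of_segment_subset {E : Type*} [NormedAddCommGroup E]
    [InnerProductSpace ℝ E] {a b : E} (hab : dist a b = 1) {A : Set E}
    (hA : segment ℝ a b ⊆ A) {ε : ℝ≥0} (hε : 0 < ε) :
    1 ≤ ((Metric.externalCoveringNumber ε A : ℕ∞) : ℝ≥0∞) * (2 * ε) := by
  by_cases htop : Metric.externalCoveringNumber ε A = ⊤
  · rw [htop, ENat.toENNReal_top, ENNReal.top_mul (by simpa using hε.ne')]
    exact le_top
  obtain ⟨C, hC, hcard⟩ : ∃ C : Set E, Metric.IsCover ε A C ∧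
      C.encard ≤ Metric.externalCoveringNumber ε A := by
    have h : Metric.externalCoveringNumber ε A < Metric.externalCoveringNumber ε A + 1 :=
      ENat.lt_add_one_iff htop |>.2 le_rfl
    conv_lhs at h => rw [Metric.externalCoveringNumber]
    obtain ⟨C, hC⟩ := iInf_lt_iff.1 h
    obtain ⟨hC, h⟩ := iInf_lt_iff.1 hC
    exact ⟨C, hC, (ENat.lt_add_one_iff htop).1 h⟩
  have hfin : C.Finite := encard_lt_top_iff.1 (hcard.trans_lt (lt_top_iff_ne_top.2 htop))
  have hnorm : ‖b - a‖ = 1 := by rw [← dist_eq_norm, dist_comm, hab]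
  have hsub : Icc (0 : ℝ) 1 ⊆ ⋃ c ∈ C, Metric.closedBall (inner ℝ (b - a) (c - a)) (ε : ℝ) := by
    intro t ht
    have hz : a + t • (b - a) ∈ A := hA (by
      rw [segment_eq_image']
      exact mem_image_of_mem _ ht)
    obtain ⟨c, hc, hzc⟩ := mem_iUnion₂.1 (Metric.isCover_iff_subset_iUnion_closedBall.1 hC hz)
    refine mem_biUnion hc ?_
    rw [Metric.mem_closedBall, dist_eq_norm] at hzc ⊢
    have h1 : t - inner ℝ (b - a) (c - a) = inner ℝ (b - a) (a + t • (b - a) - c) := by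
      rw [show a + t • (b - a) - c = t • (b - a) - (c - a) by abel,
        inner_sub_right (b - a) (t • (b - a)),
        inner_smul_right, real_inner_self_eq_norm_sq, hnorm]
      ring
    rw [h1]
    refine (norm_inner_le_norm _ _).trans ?_
    rwa [hnorm, one_mul]
  have hvol := (MeasureTheory.measure_mono (μ := MeasureTheory.volume) hsub).trans
    (MeasureTheory.measure_biUnion_le _ hfin.countable _)
  have := hfin.fintype
  simp only [Real.volume_Icc, sub_zero, ENNReal.ofReal_one, Real.volume_closedBall,
    tsum_fintype, Finset.sum_const, Finset.card_univ, nsmul_eq_mul] at hvol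
  refine hvol.trans ?_
  rw [ENNReal.ofReal_mul zero_le_two, ENNReal.ofReal_coe_nnreal, ENNReal.ofReal_ofNat]
  gcongr
  rw [encard_eq_coe_toFinset_card, toFinset_card] at hcard
  exact_mod_cast (ENat.toENNReal_le.2 hcard)

namespace SegmentScheme

variable {d : ℕ} (D : SegmentScheme d)

local notation "𝔼" => EuclideanSpace ℝ (Fin d)

theorem tendsto_externalCoveringNumber_limitSet {t : ℝ≥0} (ht : 1 < t) :
    Tendsto (fun ε : ℝ≥0 => ((Metric.externalCoveringNumber ε D.limitSet : ℕ∞) : ℝ≥0∞) *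
      (ε : ℝ≥0∞) ^ (t : ℝ)) (𝓝[>] 0) (𝓝 0) := by
  rw [ENNReal.tendsto_nhds_zero]
  intro δ hδ
  have ht' : (1 : ℝ) < t := by exact_mod_cast ht
  have h1 := ENNReal.tendsto_ofReal (D.tendsto_coveringBound ht')
  rw [ENNReal.ofReal_zero] at h1
  obtain ⟨K, hK⟩ := eventually_atTop.1 (ENNReal.tendsto_nhds_zero.1 h1 δ hδ)
  have hwK : 0 < (2 * D.width K).toNNReal := Real.toNNReal_pos.2 (by linarith [D.width_pos K])
  filter_upwards [Ioo_mem_nhdsGT hwK] with ε hε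
  have hε0 : (0 : ℝ) < ε := hε.1
  have hεK : (ε : ℝ) < 2 * D.width K := by
    have := hε.2
    rwa [← NNReal.coe_lt_coe, Real.coe_toNNReal _ (by linarith [D.width_pos K])] at this
  -- Each small ε lies between consecutive radii: the covering number is bounded at the smaller one,
  -- 2w_(k+1), and the power of ε at the larger, 2w_k.
  obtain ⟨k, hk, hle, hlt⟩ : ∃ k, K ≤ k ∧ (ε : ℝ) ≤ 2 * D.width k ∧ 2 * D.width (k + 1) < ε := by
    classical
    have hex : ∃ n, 2 * D.width (K + n) < ε := by
      have h2 := D.tendsto_width.const_mul 2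
      rw [mul_zero] at h2
      obtain ⟨n, hn⟩ := ((h2.comp (tendsto_add_atTop_nat K)).eventually_lt_const hε0).exists
      exact ⟨n, by simpa [add_comm] using hn⟩
    have hpos : Nat.find hex ≠ 0 := by
      intro h0
      have := Nat.find_spec hex
      rw [h0, add_zero] at this
      linarith
    obtain ⟨n, hn⟩ := Nat.exists_eq_succ_of_ne_zero hpos
    refine ⟨K + n, by omega, not_lt.1 (Nat.find_min hex (by omega)), ?_⟩
    have := Nat.find_spec hex
    rwa [hn] at this
  refine le_trans ?_ (hK k hk)
  have hw := D.width_pos k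
  have hw' := D.width_pos (k + 1)
  have hΛ := D.one_le_lengthBound (k + 1)
  rw [ENNReal.ofReal_mul (by positivity)]
  gcongr
  · refine le_trans ?_ (D.externalCoveringNumber_limitSet_le (k + 1))
    exact_mod_cast Metric.externalCoveringNumber_anti (Real.toNNReal_le_iff_le_coe.2 hlt.le)
  · rw [← ENNReal.ofReal_rpow_of_nonneg (by positivity) (by positivity)]
    gcongr
    rw [← ENNReal.ofReal_coe_nnreal]
    exact ENNReal.ofReal_le_ofReal hle

theorem segment_subset_limitSet : segment ℝ D.a D.b ⊆ D.limitSet :=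
  D.segment_subset_tubeSet_zero.trans (D.tubeSet_subset_limitSet le_rfl zero_lt_one)

theorem upperMinkowskiDim_limitSet : upperMinkowskiDim D.limitSet = 1 := by
  refine le_antisymm ?_ ?_
  · refine ENNReal.le_of_forall_pos_le_add fun η hη _ => ?_
    have h1 : (1 : ℝ≥0) < 1 + η := lt_add_of_pos_right 1 hη
    refine (iInf₂_le (1 + η) (zero_lt_one.trans h1)).trans ?_
    refine (iInf_le _ (D.tendsto_externalCoveringNumber_limitSet h1).limsup_eq).trans ?_
    simp
  · refine le_iInf fun t => le_iInf fun _ => le_iInf fun h => ?_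
    by_contra! hlt
    have ht : t < 1 := by exact_mod_cast hlt
    have h2 : limsup (fun ε : ℝ≥0 => ((Metric.externalCoveringNumber ε D.limitSet : ℕ∞) : ℝ≥0∞) *
        (ε : ℝ≥0∞) ^ (t : ℝ)) (𝓝[>] 0) < 1 / 2 := by
      rw [h]
      simp
    have h3 := (eventually_lt_of_limsup_lt h2).and (Ioo_mem_nhdsGT (zero_lt_one (α := ℝ≥0)))
    obtain ⟨ε, hε, h0, h1⟩ := h3.exists
    have h4 := one_le_externalCoveringNumber_mul_of_segment_subset D.dist_a_b
      D.segment_subset_limitSet h0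
    -- For ε < 1 and t < 1 the power exceeds ε, so N ε^t ≥ 1/2 and the limsup cannot vanish.
    have h5 : (ε : ℝ≥0∞) ≤ (ε : ℝ≥0∞) ^ (t : ℝ) := by
      conv_lhs => rw [← ENNReal.rpow_one (ε : ℝ≥0∞)]
      exact ENNReal.rpow_le_rpow_of_exponent_ge (by exact_mod_cast h1.le) (by exact_mod_cast ht.le)
    have h6 : (1 : ℝ≥0∞) ≤ ((Metric.externalCoveringNumber ε D.limitSet : ℕ∞) : ℝ≥0∞) *
        (ε : ℝ≥0∞) ^ (t : ℝ) * 2 := by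
      refine h4.trans ?_
      rw [mul_comm (2 : ℝ≥0∞), ← mul_assoc]
      gcongr
    have h7 := ENNReal.mul_lt_mul_left (a := 2) (by simp) (by simp) hε
    rw [ENNReal.div_mul_cancel (by simp) (by simp)] at h7
    exact absurd h6 (not_le.2 h7)

theorem exists_differentiableAt_near {g : 𝔼 → ℝ} {C : ℝ≥0} (hg : LipschitzWith C g) {x : 𝔼}
    (hx : x ∈ D.limitSet) {r : ℝ} (hr : 0 < r) :
    ∃ y ∈ D.limitSet, dist x y < r ∧ DifferentiableAt ℝ g y := by
  obtain ⟨x₀, hx₀, hxx₀⟩ := Metric.mem_closure_iff.1 hx (r / 2) (by positivity)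
  obtain ⟨q₀, hq₀, hx₀⟩ := mem_iUnion₂.1 hx₀
  obtain ⟨y, q, h0, h1, hy, hyx, hdiff⟩ := exists_differentiableAt_of_hasSegmentsNear
    (fun p q => D.tubeSet_mono) D.isClosed_tubeSet
    (fun p q x hp hpq hq hx => D.hasSegmentsNear_tubeSet hp hpq hq hx) hg hx₀ hq₀.1 hq₀.2
    (show 0 < r / 4 by positivity)
  refine ⟨y, D.tubeSet_subset_limitSet h0 h1 hy, ?_, hdiff⟩
  rw [← dist_eq_norm, dist_comm] at hyx
  linarith [dist_triangle x x₀ y]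

theorem isUniversalDifferentiabilitySet_limitSet : IsUniversalDifferentiabilitySet D.limitSet := by
  rintro g ⟨K, hg⟩
  obtain ⟨y, hy, -, h⟩ := D.exists_differentiableAt_near hg
    (D.segment_subset_limitSet (left_mem_segment ℝ D.a D.b)) one_pos
  exact ⟨y, hy, h⟩

theorem limitSet_subset_closure_differentiableAt {g : 𝔼 → ℝ} (hg : ∃ K : ℝ≥0, LipschitzWith K g) :
    D.limitSet ⊆ closure {x | x ∈ D.limitSet ∧ DifferentiableAt ℝ g x} := by
  obtain ⟨K, hg⟩ := hg
  intro x hx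
  refine Metric.mem_closure_iff.2 fun r hr => ?_
  obtain ⟨y, hy, hxy, h⟩ := D.exists_differentiableAt_near hg hx hr
  exact ⟨y, ⟨hy, h⟩, hxy⟩

theorem tendsto_sqrt_mul_log_div :
    Tendsto (fun k : ℕ => (Nat.sqrt (k + 9) : ℝ) * Real.log ((k + 9 : ℕ) : ℝ) / ((k + 9 : ℕ) : ℝ))
      atTop (𝓝 0) := by
  have h1 : Tendsto (fun x : ℝ => Real.log x / x ^ (1 / 2 : ℝ)) atTop (𝓝 0) :=
    (isLittleO_log_rpow_atTop (by norm_num)).tendsto_div_nhds_zero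
  have h2 : Tendsto (fun k : ℕ => ((k + 9 : ℕ) : ℝ)) atTop atTop :=
    tendsto_natCast_atTop_atTop.comp (tendsto_add_atTop_nat 9)
  refine squeeze_zero (fun k => ?_) (fun k => ?_) (h1.comp h2)
  · have : 0 ≤ Real.log ((k + 9 : ℕ) : ℝ) := Real.log_natCast_nonneg _
    positivity
  · have h3 : 0 ≤ Real.log ((k + 9 : ℕ) : ℝ) := Real.log_natCast_nonneg _
    have h4 : (0 : ℝ) < ((k + 9 : ℕ) : ℝ) := by positivity
    have h5 := Real.nat_sqrt_le_real_sqrt (a := k + 9)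
    have h6 := Real.sqrt_pos.2 h4
    simp only [Function.comp]
    rw [← Real.sqrt_eq_rpow, div_le_div_iff₀ h4 h6]
    have h7 := Real.mul_self_sqrt h4.le
    calc (Nat.sqrt (k + 9) : ℝ) * Real.log ((k + 9 : ℕ) : ℝ) * √((k + 9 : ℕ) : ℝ)
        ≤ √((k + 9 : ℕ) : ℝ) * Real.log ((k + 9 : ℕ) : ℝ) * √((k + 9 : ℕ) : ℝ) := by gcongr
      _ = Real.log ((k + 9 : ℕ) : ℝ) * (√((k + 9 : ℕ) : ℝ) * √((k + 9 : ℕ) : ℝ)) := by ring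
      _ = _ := by rw [h7]

theorem nonempty_of_pos (hd : 0 < d) : Nonempty (SegmentScheme d) := by
  choose T hT using fun (ε : ℝ) (A : Set 𝔼) => exists_isMaximalSeparatedIn ε A
  refine ⟨{
    -- The shift by 9 makes the integer square root at least 3.
    s := fun k => k + 9
    M := fun k => Nat.sqrt (k + 9)
    three_le_M := fun k => Nat.le_sqrt.2 (by omega)
    M_le_s := fun k => Nat.sqrt_le_self _
    tendsto_M := ?_
    tendsto_s := tendsto_add_atTop_nat 9
    tendsto_ratio := tendsto_sqrt_mul_log_div
    -- The sequence s grows by 1 at each level, so it can serve as its own majorant.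
    exists_majorant := ⟨fun k => ((k + 9 : ℕ) : ℝ), fun k => le_rfl, ?_⟩
    Q := 3 / 2
    one_lt_Q := by norm_num
    Q_lt_two := by norm_num
    a := 0
    b := EuclideanSpace.single ⟨0, hd⟩ 1
    dist_a_b := by simp
    dirs := fun k => T (1 / ((k + 9 : ℕ) : ℝ)) (Metric.sphere 0 1)
    dirs_maximal := fun k => hT _ _
    net := fun k l j _ =>
      T ((3 / 2) ^ j * tubeWidth (3 / 2) (fun k => k + 9) k / ((k + 9 : ℕ) : ℝ)) l
    net_maximal := fun k x y j e _ _ _ => hT _ _ }⟩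
  · refine tendsto_atTop_atTop.2 fun n => ⟨n * n, fun k hk => Nat.le_sqrt.2 (by omega)⟩
  · have h1 : Tendsto (fun k : ℕ => 1 / (((k + 1) + 9 : ℕ) : ℝ)) atTop (𝓝 0) :=
      tendsto_one_div_atTop_nhds_zero_nat.comp (tendsto_add_atTop_nat 10)
    refine h1.congr fun k => ?_
    push_cast
    ring_nf

end SegmentScheme

end

theorem theorem4 (d : ℕ) (hd : 1 ≤ d) :
    (∃ S : Set (EuclideanSpace ℝ (Fin d)),
      IsCompact S ∧ upperMinkowskiDim S = 1 ∧ IsUniversalDifferentiabilitySet S ∧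
      ∀ g : EuclideanSpace ℝ (Fin d) → ℝ, (∃ K : ℝ≥0, LipschitzWith K g) →
        S ⊆ closure {x | x ∈ S ∧ DifferentiableAt ℝ g x}) ∧
    (2 ≤ d → Nonempty (SegmentScheme d) ∧ ∀ D : SegmentScheme d,
      IsCompact D.limitSet ∧ upperMinkowskiDim D.limitSet = 1 ∧
      IsUniversalDifferentiabilitySet D.limitSet ∧
      ∀ g : EuclideanSpace ℝ (Fin d) → ℝ, (∃ K : ℝ≥0, LipschitzWith K g) →
        D.limitSet ⊆ closure {x | x ∈ D.limitSet ∧ DifferentiableAt ℝ g x}) := by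
  have key : ∀ D : SegmentScheme d,
      IsCompact D.limitSet ∧ upperMinkowskiDim D.limitSet = 1 ∧
      IsUniversalDifferentiabilitySet D.limitSet ∧
      ∀ g : EuclideanSpace ℝ (Fin d) → ℝ, (∃ K : ℝ≥0, LipschitzWith K g) →
        D.limitSet ⊆ closure {x | x ∈ D.limitSet ∧ DifferentiableAt ℝ g x} := fun D =>
    ⟨D.isCompact_limitSet, D.upperMinkowskiDim_limitSet, D.isUniversalDifferentiabilitySet_limitSet,
      fun _ hg => D.limitSet_subset_closure_differentiableAt hg⟩
  -- The construction also works on the line, so dimension 1 needs no separate argument.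
  have hne := SegmentScheme.nonempty_of_pos (d := d) hd
  exact ⟨⟨hne.some.limitSet, key _⟩, fun _ => ⟨hne, key⟩⟩
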